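/- \textbf{Setting.} Let $X$ be a totally ordered set. Let $Z$ be the set of formal products $z=\prod_{x\in X}x^{v_x(z)}$ with $v_x(z)\in\mathbb Z_{\ge 0}$ (infinitely many exponents may be nonzero); $z$ is finite if only finitely many $v_x(z)$ are nonzero, and then $\deg z=\sum_x v_x(z)$. Divisibility and coprimality are as for integers; $\bar z=\prod_{x\mid z}x$ is the support of $z$, $z(x)=x^{v_x(z)}$, and $z'$ is a \emph{stalk} of $z$, written $z'\mid_s z$, if $z'\mid z$ and $\gcd(z',z/z')=1$. Let $G$ be a profinite group with open subgroups $H_z$ ($z\in Z$ finite) such that $[G,G]\le H_z$; $H_z\le H_{z'}$ if $z'\mid z$; and $H_{zz'}=H_z\cap H_{z'}$, $G=H_zH_{z'}$ if $z,z'$ are coprime. Put $G_z=G/H_z$, a finite abelian group, for $z$ finite, and let $G_z=\varprojlim G_{z'}$ over the finite stalks $z'\mid_s z$ for $z$ infinite. For each $x\in X$ let $\mathrm{Fr}_x\in G$ be an element whose image in $G_{x^n}$ is trivial for all $n$. Let $\mathcal O$ be an integral domain, $\mathcal T$ a commutative $\mathcal O$-algebra which is torsion free and finitely generated as an $\mathcal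 O$-module, and let $p(x;t)\in\mathcal T[t]$ be given for each $x\in X$. For $z\in Z$ let $\mathcal A_z$ be the free $\mathcal T$-module on the symbols $[gz']$ with $z'\mid_s z$ finite and $g\in G_{z'}$, with $G_z$ acting by $h[gz']=[h_{z'}gz']$, where $h_{z'}$ is the image of $h$ in $G_{z'}$. For $x\mid z$ let $\lambda_{z(x)}$ be the $\mathcal T[G_z]$-endomorphism of $\mathcal A_z$ with $$\lambda_{z(x)}[z']=p(x;\mathrm{Fr}_x^{-1})[z']-N_{z(x)}[z(x)z']\ \text{ if } x\nmid z',\qquad \lambda_{z(x)}[z']=0\ \text{ if } x\mid z',$$ where $N_{z(x)}$ is the sum of the elements of the factor $G_{z(x)}$ of $G_{z(x)z'}=G_{z(x)}\times G_{z'}$. Let $\mathcal D_z=\sum_{x\mid z}\lambda_{z(x)}(\mathcal A_z)$, and let $\mathcal U_z=\mathcal A_z/\mathcal D_z$ be the universal norm distribution. Write $H^*(G_z,-)$ for group cohomology with discrete coefficients (continuous cohomology of the profinite group $G_z$ if $z$ is infinite). \textbf{Theorem.} Let $z\in Z$ be such that $G_{z(x)}$ is cyclic for every $x\mid z$, and let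 $M\in\mathcal O$ be a common divisor of $|G_{z(x)}|$ (in $\mathcal O$) and of $p(x;1)$ (in $\mathcal T$) for all $x\mid z$. Then $$H^*(G_z,\mathcal U_z/M\mathcal U_z)=\bigoplus_{(y,w)}\langle c(y,w)\rangle$$ is a direct sum of rank one free graded $\mathcal T/M\mathcal T$-modules, indexed by the pairs $(y,w)$ with $w\in Z$ finite, $y$ squarefree and $y\mid\bar w\mid \bar z$; the generator $c(y,w)$ is homogeneous of degree $\deg w-\deg y$. In other words, the $c(y,w)$ form a homogeneous $\mathcal T/M\mathcal T$-basis of $\bigoplus_{n\ge 0}H^n(G_z,\mathcal U_z/M\mathcal U_z)$. -/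

import Mathlib

open scoped Pointwise

/-- The group-theoretic data of a norm distribution over the set `X` of "primes". Elements of `Z`
are functions `z : X → ℕ` (possibly of infinite support), finite elements are `z : X →₀ ℕ`,
multiplication is written additively and `z' ∣ z` is `z' ≤ z`. The open subgroup `H z` is the
stabilizer of the points of the orbit `B_z ≅ G ⧸ H z`, and `Fr x` is the Frobenius element. -/
structure NormSystem (X G : Type*) [Group G] [TopologicalSpace G] where
  H : (X →₀ ℕ) → Subgroup G
  isOpen_H : ∀ z, IsOpen (H z : Set G)
  commutator_le : ∀ z, commutator G ≤ H z
  H_anti : ∀ z' z, z' ≤ z → H z ≤ H z'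
  H_add : ∀ z z', Disjoint z.support z'.support → H (z + z') = H z ⊓ H z'
  H_mul : ∀ z z', Disjoint z.support z'.support → (H z : Set G) * (H z' : Set G) = Set.univ
  Fr : X → G
  Fr_mem : ∀ x n, Fr x ∈ H (Finsupp.single x n)

namespace NormSystem

section Groups

variable {X G : Type*} [Group G] [TopologicalSpace G] (S : NormSystem X G)

instance normal_H (z : X →₀ ℕ) : (S.H z).Normal := by
  refine ⟨fun n hn g => ?_⟩
  have h : g * n * g⁻¹ * n⁻¹ ∈ S.H z := S.commutator_le z
    (Subgroup.commutator_mem_commutator (Subgroup.mem_top g) (Subgroup.mem_top n))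
  simpa using (S.H z).mul_mem h hn

lemma Gfin_comm (z : X →₀ ℕ) (a b : G ⧸ S.H z) : a * b = b * a := by
  induction a using QuotientGroup.induction_on with | H a =>
  induction b using QuotientGroup.induction_on with | H b =>
  have h : a⁻¹ * b⁻¹ * a⁻¹⁻¹ * b⁻¹⁻¹ ∈ S.H z := S.commutator_le z
    (Subgroup.commutator_mem_commutator (Subgroup.mem_top a⁻¹) (Subgroup.mem_top b⁻¹))
  rw [← QuotientGroup.mk_mul, ← QuotientGroup.mk_mul, eq_comm, QuotientGroup.eq]
  simpa [mul_assoc] using h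

/-- `G_z = G / H_z` for finite `z`. -/
abbrev Gfin (z : X →₀ ℕ) : Type _ := G ⧸ S.H z

/-- The set of primes dividing `z`. -/
abbrev Primes (z : X → ℕ) : Type _ := {x : X // z x ≠ 0}

open Classical in
/-- For a finite set `s` of primes dividing `z`, the stalk `∏_{x ∈ s} x ^ v_x(z)` of `z`. -/
noncomputable def stalk (z : X → ℕ) (s : Finset (Primes z)) : X →₀ ℕ :=
  ∑ x ∈ s, Finsupp.single x.1 (z x.1)

/-- `z(x) = x ^ v_x(z)`. -/
noncomputable def primePart (z : X → ℕ) (x : X) : X →₀ ℕ := Finsupp.single x (z x)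

lemma stalk_mono (z : X → ℕ) {s t : Finset (Primes z)} (h : s ⊆ t) : stalk z s ≤ stalk z t :=
  Finset.sum_le_sum_of_subset h

/-- The restriction map `G_{z'} → G_{z''}` between finite stalks `z'' ∣ z'` of `z`. -/
noncomputable def proj (z : X → ℕ) {s t : Finset (Primes z)} (h : s ⊆ t) :
    S.Gfin (stalk z t) →* S.Gfin (stalk z s) :=
  QuotientGroup.map _ _ (MonoidHom.id G) (S.H_anti _ _ (stalk_mono z h))

/-- `G_z` for arbitrary `z`: the inverse limit of the groups `G_{z'}` over all finite stalks `z'`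
of `z`. If `z` is finite then `z` is its own largest stalk and this is `G / H_z`. -/
noncomputable def Glim (z : X → ℕ) : Subgroup (∀ s : Finset (Primes z), S.Gfin (stalk z s)) where
  carrier := {g | ∀ s t (h : s ⊆ t), S.proj z h (g t) = g s}
  one_mem' := fun s t h => by simp
  mul_mem' := fun {a b} ha hb s t h => by simp [ha s t h, hb s t h]
  inv_mem' := fun {a} ha s t h => by simp [ha s t h]

/-- The canonical map `G → G_z`. -/
noncomputable def toGlim (z : X → ℕ) : G →* S.Glim z where
  toFun g := ⟨fun _ => (g : G ⧸ _), fun _ _ _ => rfl⟩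
  map_one' := rfl
  map_mul' _ _ := rfl

/-- The set `A_z`, the disjoint union of the orbits `B_{z'} = {[g z'] : g ∈ G_{z'}}` over the finite
stalks `z'` of `z`: the point `[g z']` is given by the support `supp` of `z'` and by `g ∈ G_{z'}`. -/
structure Apts (z : X → ℕ) where
  supp : Finset (Primes z)
  val : S.Gfin (stalk z supp)

/-- The action `g [g' z'] = [g_{z'} g' z']` of `G_z` on `A_z`. -/
noncomputable instance mulActionApts (z : X → ℕ) :
    MulAction (S.Glim z) (S.Apts z) where
  smul g a := ⟨a.supp, g.1 a.supp * a.val⟩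
  one_smul a := congrArg (Apts.mk a.supp) (one_mul a.val)
  mul_smul g h a := congrArg (Apts.mk a.supp) (mul_assoc (g.1 a.supp) (h.1 a.supp) a.val)

end Groups

section Distribution

variable {X G : Type*} [Group G] [TopologicalSpace G] (S : NormSystem X G)
  (T : Type*) [CommRing T]

/-- The free `T`-module `𝒜_z` on the set `A_z`. -/
abbrev Amod (z : X → ℕ) : Type _ := S.Apts z →₀ T

/-- The action of `G_z` on `𝒜_z`. -/
noncomputable def rhoA (z : X → ℕ) : Representation T (S.Glim z) (S.Amod T z) where
  toFun g := Finsupp.lmapDomain T T (g • ·)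
  map_one' := by ext; simp
  map_mul' g h := by ext; simp [mul_smul]

lemma rhoA_single (z : X → ℕ) (g : S.Glim z) (a : S.Apts z) (t : T) :
    S.rhoA T z g (Finsupp.single a t) = Finsupp.single (g • a) t := by
  simp [rhoA]

/-- The action of the Frobenius inverse `Fr_x⁻¹` on `𝒜_z`. -/
noncomputable def frobInv (z : X → ℕ) (x : X) : Module.End T (S.Amod T z) :=
  S.rhoA T z (S.toGlim z (S.Fr x)⁻¹)

lemma rhoA_frobInv (z : X → ℕ) (g : S.Glim z) (x : X) :
    Commute (S.rhoA T z g) (S.frobInv T z x) := by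
  have h : g * S.toGlim z (S.Fr x)⁻¹ = S.toGlim z (S.Fr x)⁻¹ * g :=
    Subtype.ext (funext fun s => S.Gfin_comm _ _ _)
  change S.rhoA T z g * S.rhoA T z _ = S.rhoA T z _ * S.rhoA T z g
  rw [← map_mul, h, map_mul]

lemma rhoA_aeval (z : X → ℕ) (g : S.Glim z) (x : X) (q : Polynomial T) (v : S.Amod T z) :
    S.rhoA T z g (Polynomial.aeval (S.frobInv T z x) q v)
      = Polynomial.aeval (S.frobInv T z x) q (S.rhoA T z g v) := by
  have h : Commute (S.rhoA T z g) (Polynomial.aeval (S.frobInv T z x) q) := by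
    induction q using Polynomial.induction_on with
    | C a => rw [Polynomial.aeval_C]; exact (Algebra.commutes a (S.rhoA T z g)).symm
    | add p q hp hq => simpa using hp.add_right hq
    | monomial n a _ =>
      rw [map_mul, Polynomial.aeval_C, map_pow, Polynomial.aeval_X]
      exact Commute.mul_right (Algebra.commutes a (S.rhoA T z g)).symm
        ((S.rhoA_frobInv T z g x).pow_right (n + 1))
  exact LinearMap.congr_fun h.eq v

variable [IsTopologicalGroup G] [CompactSpace G]

instance finite_Gfin (z : X →₀ ℕ) : Finite (S.Gfin z) :=
  Subgroup.quotient_finite_of_isOpen _ (S.isOpen_H z)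

noncomputable instance fintype_Gfin (z : X →₀ ℕ) : Fintype (S.Gfin z) := Fintype.ofFinite _

open Classical in
/-- The element `N_{z(x)} [g z(x) z']` where `z'` is the stalk of `z` on `s`, `x ∉ s`, and
`g ∈ G_{z(x) z'}` is any lift of `a ∈ G_{z'}`. As `G_{z(x)} ⊆ G_{z(x) z'} = G_{z(x)} × G_{z'}` is
the kernel of the restriction to `G_{z'}`, it is the sum of `[b z(x) z']` over all
`b ∈ G_{z(x) z'}` that restrict to `a`. -/
noncomputable def normLift (z : X → ℕ) (x : Primes z) (s : Finset (Primes z))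
    (a : S.Gfin (stalk z s)) : S.Amod T z :=
  ∑ b : S.Gfin (stalk z (insert x s)) with S.proj z (Finset.subset_insert x s) b = a,
    Finsupp.single ⟨insert x s, b⟩ 1

open Classical in
/-- The homomorphism `λ_{z(x)}` of `𝒜_z`: for `x ∤ z'` it sends `[g z']` to
`p(x; Fr_x⁻¹) [g z'] - N_{z(x)} [g z(x) z']`, and for `x ∣ z'` it sends `[g z']` to `0`. -/
noncomputable def lam (p : X → Polynomial T) (z : X → ℕ) (x : Primes z) :
    S.Amod T z →ₗ[T] S.Amod T z :=
  Finsupp.linearCombination T fun a : S.Apts z =>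
    if x ∈ a.supp then 0
    else Polynomial.aeval (S.frobInv T z x.1) (p x.1) (Finsupp.single a 1)
      - S.normLift T z x a.supp a.val

/-- The module `𝒟_z` of distribution relations, generated by the images of all `λ_{z(x)}`,
`x ∣ z`. (As `λ_{z(x)} [g z'] = 0` if `x ∣ z'`, the image of `𝒜_z` is that of `𝒜_{z/z(x)}`.) -/
noncomputable def Dmod (p : X → Polynomial T) (z : X → ℕ) : Submodule T (S.Amod T z) :=
  ⨆ x : Primes z, LinearMap.range (S.lam T p z x)

/-- The universal norm distribution `𝒰_z = 𝒜_z / 𝒟_z`. -/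
abbrev Umod (p : X → Polynomial T) (z : X → ℕ) : Type _ := S.Amod T z ⧸ S.Dmod T p z

lemma rhoA_normLift (z : X → ℕ) (g : S.Glim z) (x : Primes z) (s : Finset (Primes z))
    (a : S.Gfin (stalk z s)) :
    S.rhoA T z g (S.normLift T z x s a) = S.normLift T z x s (g.1 s * a) := by
  classical
  unfold normLift
  rw [map_sum]
  refine Finset.sum_bij (fun b _ => g.1 _ * b) ?_ ?_ ?_ ?_
  · intro b hb
    simp only [Finset.mem_filter, Finset.mem_univ, true_and] at hb ⊢
    rw [map_mul, hb, g.2 _ _ (Finset.subset_insert x s)]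
  · intro b _ b' _ h
    exact mul_left_cancel h
  · intro b hb
    simp only [Finset.mem_filter, Finset.mem_univ, true_and] at hb
    refine ⟨(g.1 _)⁻¹ * b, ?_, by simp⟩
    simp only [Finset.mem_filter, Finset.mem_univ, true_and]
    rw [map_mul, map_inv, hb, g.2 _ _ (Finset.subset_insert x s)]
    simp
  · intro b _
    exact S.rhoA_single T z g _ 1

lemma rhoA_lam (p : X → Polynomial T) (z : X → ℕ) (g : S.Glim z) (x : Primes z)
    (v : S.Amod T z) :
    S.rhoA T z g (S.lam T p z x v) = S.lam T p z x (S.rhoA T z g v) := by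
  classical
  induction v using Finsupp.induction_linear with
  | zero => simp
  | add v w hv hw => simp only [map_add, hv, hw]
  | single a t =>
    obtain ⟨s, a⟩ := a
    rw [rhoA_single]
    simp only [lam, Finsupp.linearCombination_single, map_smul]
    change _ = t • (if x ∈ s then 0 else _)
    by_cases hx : x ∈ s
    · simp [hx]
    · simp only [hx, if_false, map_sub]
      rw [rhoA_aeval, rhoA_single, rhoA_normLift]
      rfl

lemma Dmod_le_comap (p : X → Polynomial T) (z : X → ℕ) (g : S.Glim z) :
    S.Dmod T p z ≤ (S.Dmod T p z).comap (S.rhoA T z g) := by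
  refine iSup_le fun x => ?_
  rintro _ ⟨v, rfl⟩
  rw [Submodule.mem_comap, rhoA_lam]
  exact Submodule.mem_iSup_of_mem x ⟨_, rfl⟩

/-- The action of `G_z` on `𝒰_z`. -/
noncomputable def rhoU (p : X → Polynomial T) (z : X → ℕ) :
    Representation T (S.Glim z) (S.Umod T p z) :=
  (S.rhoA T z).quotient _ (S.Dmod_le_comap T p z)

end Distribution

section Reduction

universe uX uG uT

variable {O : Type*} [CommRing O] (T : Type uT) [CommRing T] [Algebra O T] (M : O)

/-- The ring `T / M T`, with the discrete topology. -/
def Tred : Type _ := T ⧸ Ideal.span {algebraMap O T M}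

noncomputable instance : CommRing (Tred T M) :=
  inferInstanceAs (CommRing (T ⧸ Ideal.span {algebraMap O T M}))

instance : TopologicalSpace (Tred T M) := ⊥

instance : DiscreteTopology (Tred T M) := ⟨rfl⟩

variable {X : Type uX} {G : Type uG} [Group G] [TopologicalSpace G] (S : NormSystem X G)
  [IsTopologicalGroup G] [CompactSpace G] (p : X → Polynomial T) (z : X → ℕ)

/-- The `T / M T`-module `𝒰_z / M 𝒰_z`, with the discrete topology. -/
def Ured : Type _ :=
  S.Umod T p z ⧸ (Ideal.span {algebraMap O T M} • (⊤ : Submodule T (S.Umod T p z)))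

noncomputable instance : AddCommGroup (S.Ured T M p z) :=
  inferInstanceAs (AddCommGroup
    (S.Umod T p z ⧸ (Ideal.span {algebraMap O T M} • (⊤ : Submodule T (S.Umod T p z)))))

noncomputable instance : Module (Tred T M) (S.Ured T M p z) :=
  inferInstanceAs (Module (T ⧸ Ideal.span {algebraMap O T M})
    (S.Umod T p z ⧸ (Ideal.span {algebraMap O T M} • (⊤ : Submodule T (S.Umod T p z)))))

instance : TopologicalSpace (S.Ured T M p z) := ⊥

instance : DiscreteTopology (S.Ured T M p z) := ⟨rfl⟩

instance : ContinuousSMul (Tred T M) (S.Ured T M p z) := ⟨continuous_of_discreteTopology⟩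

lemma MU_le_comap (g : S.Glim z) :
    (Ideal.span {algebraMap O T M} • (⊤ : Submodule T (S.Umod T p z))) ≤
      (Ideal.span {algebraMap O T M} • (⊤ : Submodule T (S.Umod T p z))).comap
        (S.rhoU T p z g) := by
  rw [← Submodule.map_le_iff_le_comap, Submodule.map_smul'']
  exact Submodule.smul_mono le_rfl le_top

/-- The action of a single element of `G_z` on `𝒰_z / M 𝒰_z`. -/
noncomputable def actUred (g : S.Glim z) : S.Ured T M p z →L[Tred T M] S.Ured T M p z where
  toFun := Submodule.mapQ _ _ (S.rhoU T p z g) (S.MU_le_comap T M p z g)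
  map_add' := map_add _
  map_smul' c v := by
    obtain ⟨c, rfl⟩ := Ideal.Quotient.mk_surjective c
    obtain ⟨v, rfl⟩ := Submodule.Quotient.mk_surjective _ v
    exact congrArg Submodule.Quotient.mk ((S.rhoU T p z g).map_smul c v)
  cont := continuous_of_discreteTopology

/-- `𝒰_z / M 𝒰_z` as a discrete `T / M T`-linear representation of the profinite group `G_z`. -/
noncomputable def repUred : TopRep.{max (max uX uG) uT} (Tred T M) (S.Glim z) :=
  TopRep.of (X := S.Ured T M p z) (ContRepresentation.ofMonoidHom
    { toFun := S.actUred T M p z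
      map_one' := by
        ext v
        obtain ⟨v, rfl⟩ := Submodule.Quotient.mk_surjective _ v
        change Submodule.Quotient.mk (S.rhoU T p z 1 v) = Submodule.Quotient.mk v
        rw [map_one]; rfl
      map_mul' := fun g h => by
        ext v
        obtain ⟨v, rfl⟩ := Submodule.Quotient.mk_surjective _ v
        change Submodule.Quotient.mk (S.rhoU T p z (g * h) v) =
          Submodule.Quotient.mk (S.rhoU T p z g (S.rhoU T p z h v))
        rw [map_mul]; rfl })

/-- `H^n(G_z, 𝒰_z / M 𝒰_z)`: continuous cohomology of the profinite group `G_z` with coefficients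
in a discrete module (the usual group cohomology if `z`, hence `G_z`, is finite). -/
noncomputable abbrev cohUred (n : ℕ) : TopModuleCat (Tred T M) :=
  continuousCohomology.{uT, max uX uG, uT} n (S.repUred T M p z)

end Reduction

/-- The index set of the canonical basis: pairs `(y, w)` with `y` squarefree and finite, `w` finite
and `y ∣ w̄ ∣ z`, where `w̄` is the support of `w`. -/
structure CanonicalIndex {X : Type*} (z : X → ℕ) where
  y : Finset X
  w : X →₀ ℕ
  y_dvd : y ⊆ w.support
  w_dvd : ∀ x ∈ w.support, z x ≠ 0

end NormSystem

/-!
Put `R = T / M T`. By the Chinese remainder theorem (`comps_bijective`) the group `G_z` is the product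
of the cyclic groups `C x = G_{z(x)}` over the primes `x ∣ z`, and in `R` the order of every `C x` and
every value `p(x; 1)` is zero. A symbol `[g z']` becomes a *point*, a finitely supported family of
elements of `WithZero (C x)`, and `𝒰_z / M 𝒰_z` the free `R`-module on the points modulo one relation
for each prime `x` and each point `a` without `x`: the sum of all points obtained by adding `x` to `a`
equals the Euler factor at `x` applied to `a`.

For a set `Q` of primes let `U_Q` be the module of points over `Q` modulo the relations at `Q`, with
its action of `Γ_Q = ∏ x ∈ Q, C x`. Solving each relation for the point with trivial component at `x`
gives a confluent rewriting system (`normalize_relation`), so `U_Q` is free on the points with no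
trivial component, and `U_Q` embeds in `U_{Q'}` for `Q ⊆ Q'` (`quotMap_injOn`).

To add a prime `x` to `Q`, let `W` be the module of points that involve `x`, modulo the relations at
`Q` only, and let `B` be the image of `g - 1` on `W`, for a generator `g` of `C x`. There are three short
exact sequences
* `U_Q → W → B`, by adding `x` in all possible ways and applying `g - 1` (`isSES_norm_diff`),
* `U_Q → U_{Q ∪ {x}} → B` (`isSES_insert_quotDiff`),
* `B → W → U_Q`, by removing `x` (`isSES_incl_remove`).
The module `W` is relatively injective for `C x`, hence `H^*(Γ_{Q ∪ {x}}, W) = H^*(Γ_Q, U_Q)`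
(`inflation_bijective`). The composite `U_Q → W → U_Q` of the first and third sequence is multiplication
by `|C x| = 0`, which forces the first and the third long exact sequence to split into short ones.
The second sequence is the pushout of the first along the Euler factor at `x`, which acts on cohomology
as `p(x; 1) = 0` (`cohHom_polyHom`), so its long exact sequence splits as well. Counting degree by
degree (`exists_basis_step`), a basis of `H^*(Γ_Q, U_Q)` extends to one of
`H^*(Γ_{Q ∪ {x}}, U_{Q ∪ {x}})`. A basis element of degree `m` indexed by `(y, w)` gives, besides
itself, one element of each degree `n > m`, for `(y, w x^(n - m))`, and one of each degree `n ≥ m`, for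
`(y x, w x^(n + 1 - m))`.

Starting from the empty set of primes, where the cohomology is `R` in degree zero, Zorn's lemma
for sets of primes with compatible bases gives a basis over all primes (`exists_basis_univ`). Chains
have upper bounds since a cochain with values in the distribution of a directed union comes from a
member of the union (`exists_resTrans_eq`). The same argument covers finite and infinite `z`.
-/

set_option linter.unusedSectionVars false

open CategoryTheory ContRepresentation TopRep

/-! ### Discrete representations and their cochains -/

namespace DiscreteCohomology

universe u v w

section Discrete

lemma discreteTopology_continuousMap {K M : Type*} [TopologicalSpace K] [CompactSpace K]
    [TopologicalSpace M] [DiscreteTopology M] : DiscreteTopology C(K, M) := by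
  rw [discreteTopology_iff_isOpen_singleton]
  intro f
  have hfin : (Set.range f).Finite := (isCompact_range f.continuous).finite_of_discrete
  have : ({f} : Set C(K, M)) = ⋂ m ∈ Set.range f, {g : C(K, M) | Set.MapsTo g (f ⁻¹' {m}) {m}} := by
    ext g
    simp only [Set.mem_singleton_iff, Set.mem_iInter, Set.mem_ofPred_eq]
    refine ⟨fun h m _ x hx => h ▸ hx, fun h => ContinuousMap.ext fun x => h (f x) ⟨x, rfl⟩ rfl⟩
  rw [this]
  refine hfin.isOpen_biInter fun m _ => ?_
  exact ContinuousMap.isOpen_setOfPred_mapsTo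
    ((isClosed_discrete {m}).preimage f.continuous).isCompact (isOpen_discrete {m})

end Discrete

variable {k : Type u} [CommRing k] [TopologicalSpace k]
  {G : Type v} [Group G] [TopologicalSpace G] [IsTopologicalGroup G]
  {H : Type v} [Group H] [TopologicalSpace H] [IsTopologicalGroup H]

/-- A smooth representation: a discrete module on which the group acts with continuous orbit maps.
Over a compact group these are the coefficients of continuous cohomology considered here, and the
class is stable under `X ↦ C(G, X)`, so that all cochain modules are again discrete. -/
class IsSmooth (X : TopRep.{w} k G) : Prop where
  discrete : DiscreteTopology X
  continuous_orbit : ∀ x : X, Continuous fun g : G => X.ρ g x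

instance (X : TopRep.{w} k G) [IsSmooth X] : DiscreteTopology X := IsSmooth.discrete

lemma rho_mul (X : TopRep.{w} k G) (g h : G) (x : X) : X.ρ (g * h) x = X.ρ g (X.ρ h x) := by
  rw [map_mul]; rfl

lemma rho_one (X : TopRep.{w} k G) (x : X) : X.ρ 1 x = x := by
  rw [map_one]; rfl

lemma rho_rho_inv (X : TopRep.{w} k G) (g : G) (x : X) : X.ρ g (X.ρ g⁻¹ x) = x := by
  rw [← rho_mul, mul_inv_cancel, rho_one]

lemma continuous_action (X : TopRep.{w} k G) [IsSmooth X] :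
    Continuous fun a : G × X => X.ρ a.1 a.2 :=
  continuous_prod_of_discrete_right.mpr fun x => IsSmooth.continuous_orbit x

instance isSmooth_coind₁ (X : TopRep.{max v w} k G) [CompactSpace G] [IsSmooth X] :
    IsSmooth X.coind₁ where
  discrete := discreteTopology_continuousMap
  continuous_orbit f := by
    have h : Continuous fun a : G × G => X.ρ a.1 (f (a.1⁻¹ * a.2)) :=
      (continuous_action X).comp
        (continuous_fst.prodMk (f.continuous.comp (continuous_fst.inv.mul continuous_snd)))
    exact (ContinuousMap.curry ⟨_, h⟩).continuous

instance isSmooth_resolutionX (X : TopRep.{max v w} k G) [CompactSpace G] [IsSmooth X] :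
    ∀ n, IsSmooth (resolutionX X n)
  | 0 => ‹_›
  | n + 1 => haveI := isSmooth_resolutionX X n; isSmooth_coind₁ _

instance isSmooth_res (X : TopRep.{w} k G) [IsSmooth X] (φ : H →ₜ* G) :
    IsSmooth (TopRep.res (φ : H →* G) X) where
  discrete := (inferInstance : DiscreteTopology X)
  continuous_orbit x := (IsSmooth.continuous_orbit (X := X) x).comp φ.continuous

/-- A morphism of topological representations given by an equivariant linear map out of a
discrete representation. -/
def homOf {X Y : TopRep.{w} k G} [IsSmooth X] (f : X →ₗ[k] Y)
    (hf : ∀ g x, f (X.ρ g x) = Y.ρ g (f x)) : X ⟶ Y :=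
  TopRep.ofHom (ρ := X.ρ) (σ := Y.ρ)
    { toLinearMap := f
      cont := continuous_of_discreteTopology
      isIntertwining' := fun g => by ext x; exact hf g x }

lemma hom_ext_apply {X Y : TopRep.{w} k G} {f g : X ⟶ Y} (h : ∀ x, f.hom x = g.hom x) :
    f = g := by
  ext x; exact h x

lemma hom_rho {X Y : TopRep.{w} k G} (f : X ⟶ Y) (g : G) (x : X) :
    f.hom (X.ρ g x) = Y.ρ g (f.hom x) := hom_comm_apply f g x

/-- The linear representation underlying a topological representation. -/
abbrev linRep (X : TopRep.{w} k G) : Representation k G X := X.ρ.toRepresentation _ _ _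

section Cohomology

/-- The complex of homogeneous cochains as a complex of modules without topology. -/
noncomputable abbrev cochains (X : TopRep.{max v w} k G) : CochainComplex (ModuleCat.{max v w} k) ℕ :=
  ((forget₂ (TopModuleCat.{max v w} k) (ModuleCat.{max v w} k)).mapHomologicalComplex _).obj
    (homogeneousCochains X)

/-- The cohomology of `cochains X`. It is the continuous cohomology of `X` with the topology
forgotten, see `continuousCohomologyEquiv`, and has the advantage of living in an abelian category.
-/
noncomputable abbrev coh (X : TopRep.{max v w} k G) (n : ℕ) : ModuleCat.{max v w} k :=
  (cochains X).homology n

/-- The map of cochains induced by a homomorphism `φ : H → G` and an `H`-equivariant map `f : X →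
Y`. -/
noncomputable def cochainMap {X : TopRep.{max v w} k G} {Y : TopRep.{max v w} k H} (φ : H →ₜ* G)
    (f : TopRep.res (φ : H →* G) X ⟶ Y) : cochains X ⟶ cochains Y :=
  ((forget₂ (TopModuleCat.{max v w} k) (ModuleCat.{max v w} k)).mapHomologicalComplex _).map
    (ContinuousCohomology.cochainsMap φ f)

/-- The map on cohomology induced by a homomorphism `φ : H → G` and an `H`-equivariant map `f : X →
Y`: inflation, restriction and functoriality in the coefficients are all of this form. -/
noncomputable def cohMap {X : TopRep.{max v w} k G} {Y : TopRep.{max v w} k H} (φ : H →ₜ* G)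
    (f : TopRep.res (φ : H →* G) X ⟶ Y) (n : ℕ) : coh X n →ₗ[k] coh Y n :=
  (HomologicalComplex.homologyMap (cochainMap φ f) n).hom

/-- Continuous cohomology, without its topology, is the cohomology of the complex `cochains`. -/
noncomputable def continuousCohomologyEquiv (X : TopRep.{max v w} k G) (n : ℕ) :
    (continuousCohomology n X : TopModuleCat.{max v w} k) ≃ₗ[k] coh X n :=
  (((homogeneousCochains X).sc n).mapHomologyIso
    (forget₂ (TopModuleCat.{max v w} k) (ModuleCat.{max v w} k))).symm.toLinearEquiv

lemma cochains_d_apply (X : TopRep.{max v w} k G) (n : ℕ) (x : (resolutionX X (n + 1)).ρ.invariants) :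
    (((cochains X).d n (n + 1)).hom x).1 = (d X (n + 1)).hom x.1 := by
  change (((homogeneousCochains X).d n (n + 1)).hom x).1 = _
  rw [homogeneousCochains.d_eq]
  rfl

end Cohomology

end DiscreteCohomology

/-! ### Cohomology classes, functoriality and the long exact sequence -/

namespace DiscreteCohomology

universe u v w

section Classes

variable {k : Type u} [CommRing k]

/-- The cohomology class of a cocycle. -/
noncomputable def cocycleClass (K : CochainComplex (ModuleCat.{w} k) ℕ) (n : ℕ) :
    LinearMap.ker (K.d n (n + 1)).hom →ₗ[k] K.homology n :=
  (K.liftCycles (ModuleCat.ofHom (LinearMap.ker (K.d n (n + 1)).hom).subtype) (n + 1) (by simp)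
    (by ext x; exact x.2) ≫ K.homologyπ n).hom

lemma cocycleClass_surjective (K : CochainComplex (ModuleCat.{w} k) ℕ) (n : ℕ) :
    Function.Surjective (cocycleClass K n) := by
  intro h
  obtain ⟨c, rfl⟩ := (ModuleCat.epi_iff_surjective (K.homologyπ n)).1 inferInstance h
  have hc : (K.d n (n + 1)).hom ((K.iCycles n).hom c) = 0 :=
    congr($(K.iCycles_d n (n + 1)).hom c)
  refine ⟨⟨(K.iCycles n).hom c, hc⟩, ?_⟩
  have hinj := (ModuleCat.mono_iff_injective (K.iCycles n)).1 inferInstance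
  refine congrArg (K.homologyπ n).hom (hinj ?_)
  exact congr($(K.liftCycles_i (ModuleCat.ofHom (LinearMap.ker (K.d n (n + 1)).hom).subtype)
    (n + 1) (by simp) (by ext x; exact x.2)).hom ⟨(K.iCycles n).hom c, hc⟩)

lemma cocycleClass_eq_zero_iff (K : CochainComplex (ModuleCat.{w} k) ℕ) (m n : ℕ)
    (hm : (ComplexShape.up ℕ).prev n = m) (z : LinearMap.ker (K.d n (n + 1)).hom) :
    cocycleClass K n z = 0 ↔ ∃ w, (K.d m n).hom w = z.1 := by
  have hinj := (ModuleCat.mono_iff_injective (K.iCycles n)).1 inferInstance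
  have hex : (ShortComplex.mk _ _ (K.toCycles_comp_homologyπ m n)).Exact :=
    ShortComplex.exact_of_g_is_cokernel _ (K.homologyIsCokernel m n hm)
  rw [ShortComplex.moduleCat_exact_iff] at hex
  have hi : ∀ z, (K.iCycles n).hom ((K.liftCycles
      (ModuleCat.ofHom (LinearMap.ker (K.d n (n + 1)).hom).subtype)
    (n + 1) (by simp) (by ext x; exact x.2)).hom z) = z.1 := fun z =>
    congr($(K.liftCycles_i (ModuleCat.ofHom (LinearMap.ker (K.d n (n + 1)).hom).subtype)
    (n + 1) (by simp) (by ext x; exact x.2)).hom z)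
  have hd : ∀ w, (K.iCycles n).hom ((K.toCycles m n).hom w) = (K.d m n).hom w := fun w =>
    congr($(K.toCycles_i m n).hom w)
  constructor
  · intro h
    obtain ⟨w, hw⟩ := hex _ h
    refine ⟨w, ?_⟩
    rw [← hi z, ← hd]
    exact congrArg _ hw
  · rintro ⟨w, hw⟩
    rw [← hi z, ← hd] at hw
    have := hinj hw
    refine (congrArg (K.homologyπ n).hom this.symm).trans ?_
    exact congr($(K.toCycles_comp_homologyπ m n).hom w)

lemma map_mem_ker {K L : CochainComplex (ModuleCat.{w} k) ℕ} (f : K ⟶ L) (n : ℕ)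
    (z : LinearMap.ker (K.d n (n + 1)).hom) :
    (f.f n).hom z.1 ∈ LinearMap.ker (L.d n (n + 1)).hom := by
  have h := congr($(f.comm n (n + 1)).hom z.1)
  have hz : (K.d n (n + 1)).hom z.1 = 0 := z.2
  simp only [ModuleCat.hom_comp, LinearMap.comp_apply, hz, map_zero] at h
  exact h

lemma homologyMap_cocycleClass {K L : CochainComplex (ModuleCat.{w} k) ℕ} (f : K ⟶ L) (n : ℕ)
    (z : LinearMap.ker (K.d n (n + 1)).hom) :
    (HomologicalComplex.homologyMap f n).hom (cocycleClass K n z) =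
      cocycleClass L n ⟨(f.f n).hom z.1, map_mem_ker f n z⟩ := by
  have hinj := (ModuleCat.mono_iff_injective (L.iCycles n)).1 inferInstance
  have h := congr($(HomologicalComplex.homologyπ_naturality f n).hom ((K.liftCycles
      (ModuleCat.ofHom (LinearMap.ker (K.d n (n + 1)).hom).subtype)
    (n + 1) (by simp) (by ext x; exact x.2)).hom z))
  refine h.trans (congrArg (L.homologyπ n).hom (hinj ?_))
  have h1 := congr($(HomologicalComplex.cyclesMap_i f n).hom ((K.liftCycles
      (ModuleCat.ofHom (LinearMap.ker (K.d n (n + 1)).hom).subtype)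
    (n + 1) (by simp) (by ext x; exact x.2)).hom z))
  refine h1.trans ?_
  have h2 := congr($(K.liftCycles_i (ModuleCat.ofHom (LinearMap.ker (K.d n (n + 1)).hom).subtype)
    (n + 1) (by simp) (by ext x; exact x.2)).hom z)
  have h3 := congr($(L.liftCycles_i (ModuleCat.ofHom (LinearMap.ker (L.d n (n + 1)).hom).subtype)
    (n + 1) (by simp) (by ext x; exact x.2)).hom ⟨(f.f n).hom z.1, map_mem_ker f n z⟩)
  refine Eq.trans ?_ h3.symm
  exact congrArg (f.f n).hom h2

end Classes

variable {k : Type u} [CommRing k] [TopologicalSpace k]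
  {G : Type v} [Group G] [TopologicalSpace G] [IsTopologicalGroup G]
  {H : Type v} [Group H] [TopologicalSpace H] [IsTopologicalGroup H]
  {H' : Type v} [Group H'] [TopologicalSpace H'] [IsTopologicalGroup H']

section Functoriality

lemma cochainMap_comp {X : TopRep.{max v w} k G} {Y : TopRep.{max v w} k H}
    {Z : TopRep.{max v w} k H'} (φ : H →ₜ* G) (ψ : H' →ₜ* H) (χ : H' →ₜ* G)
    (hχ : χ = φ.comp ψ)
    (f : TopRep.res (φ : H →* G) X ⟶ Y) (g : TopRep.res (ψ : H' →* H) Y ⟶ Z)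
    (h : TopRep.res (χ : H' →* G) X ⟶ Z) (hh : ∀ x, h.hom x = g.hom (f.hom x)) :
    cochainMap φ f ≫ cochainMap ψ g = cochainMap χ h := by
  subst hχ
  have e : h = ((resFunctor (ψ : H' →* H)).map f ≫ g : TopRep.res _ X ⟶ Z) :=
    hom_ext_apply hh
  subst e
  unfold cochainMap
  rw [← Functor.map_comp]
  exact congrArg _ (ContinuousCohomology.cochainsMap_comp φ ψ f g).symm

lemma cohMap_cohMap {X : TopRep.{max v w} k G} {Y : TopRep.{max v w} k H}
    {Z : TopRep.{max v w} k H'} (φ : H →ₜ* G) (ψ : H' →ₜ* H) (χ : H' →ₜ* G)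
    (hχ : χ = φ.comp ψ)
    (f : TopRep.res (φ : H →* G) X ⟶ Y) (g : TopRep.res (ψ : H' →* H) Y ⟶ Z)
    (h : TopRep.res (χ : H' →* G) X ⟶ Z) (hh : ∀ x, h.hom x = g.hom (f.hom x)) (n : ℕ)
    (x : coh X n) :
    cohMap ψ g n (cohMap φ f n x) = cohMap χ h n x := by
  unfold cohMap
  rw [← cochainMap_comp φ ψ χ hχ f g h hh, HomologicalComplex.homologyMap_comp]
  rfl

lemma cohMap_id (X : TopRep.{max v w} k G) (n : ℕ) (x : coh X n) :
    cohMap (ContinuousMonoidHom.id G) (𝟙 X) n x = x := by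
  unfold cohMap cochainMap
  rw [ContinuousCohomology.cochainsMap_id, CategoryTheory.Functor.map_id,
    HomologicalComplex.homologyMap_id]
  rfl

/-- The map on cohomology induced by a morphism of representations of the same group. -/
noncomputable abbrev cohHom {X Y : TopRep.{max v w} k G} (f : X ⟶ Y) (n : ℕ) :
    coh X n →ₗ[k] coh Y n :=
  cohMap (ContinuousMonoidHom.id G) f n

/-- Naturality of the map on cohomology along a group homomorphism. -/
lemma cohMap_cohHom {X' Y' : TopRep.{max v w} k G} {X Y : TopRep.{max v w} k H} (φ : H →ₜ* G)
    (f : TopRep.res (φ : H →* G) X' ⟶ X) (g : TopRep.res (φ : H →* G) Y' ⟶ Y)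
    (a' : X' ⟶ Y') (a : X ⟶ Y) (h : ∀ x, g.hom (a'.hom x) = a.hom (f.hom x)) (n : ℕ)
    (x : coh X' n) :
    cohMap φ g n (cohHom a' n x) = cohHom a n (cohMap φ f n x) :=
  (cohMap_cohMap (.id G) φ φ rfl a' g (f ≫ a) (fun x => (h x).symm) n x).trans
    (cohMap_cohMap φ (.id H) φ rfl f a (f ≫ a) (fun _ => rfl) n x).symm

lemma cohHom_cohHom {X Y Z : TopRep.{max v w} k G} (f : X ⟶ Y) (g : Y ⟶ Z) (h : X ⟶ Z)
    (hh : ∀ x, h.hom x = g.hom (f.hom x)) (n : ℕ) (x : coh X n) :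
    cohHom g n (cohHom f n x) = cohHom h n x :=
  cohMap_cohMap (.id G) (.id G) (.id G) rfl f g h hh n x

end Functoriality

section LongExact

variable {X Y Z : TopRep.{max v w} k G}

/-- The sequence `0 → X → Y → Z → 0` of the underlying modules is exact. -/
structure IsSES {X Y Z : TopRep.{w} k G} (f : X ⟶ Y) (g : Y ⟶ Z) : Prop where
  injective : Function.Injective f.hom
  surjective : Function.Surjective g.hom
  zero : ∀ x, g.hom (f.hom x) = 0
  exact : ∀ y, g.hom y = 0 → ∃ x, f.hom x = y

variable [CompactSpace G] [IsSmooth X] [IsSmooth Y] [IsSmooth Z] {f : X ⟶ Y} {g : Y ⟶ Z}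

/-- `C(G, -)` is exact on discrete modules: continuous functions into a discrete module can be
lifted by composing with a set-theoretic section. -/
lemma IsSES.coind₁ (h : IsSES f g) :
    IsSES ((coind₁Functor k G).map f) ((coind₁Functor k G).map g) where
  injective a b hab := ContinuousMap.ext fun x => h.injective congr($hab x)
  surjective c := by
    obtain ⟨s, hs⟩ := h.surjective.hasRightInverse
    exact ⟨⟨s ∘ c, continuous_of_discreteTopology.comp c.continuous⟩,
      ContinuousMap.ext fun x => hs (c x)⟩
  zero a := ContinuousMap.ext fun x => h.zero (a x)
  exact b hb := by
    have h' : ∀ y : Y, ∃ x : X, g.hom y = 0 → f.hom x = y := fun y => by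
      by_cases hy : g.hom y = 0
      · obtain ⟨x, hx⟩ := h.exact y hy
        exact ⟨x, fun _ => hx⟩
      · exact ⟨0, fun h => (hy h).elim⟩
    choose s hs using h'
    exact ⟨⟨s ∘ b, continuous_of_discreteTopology.comp b.continuous⟩,
      ContinuousMap.ext fun x => hs _ congr($hb x)⟩

/-- The map of standard resolutions induced by a morphism of representations. -/
noncomputable abbrev resMap {X Y : TopRep.{max v w} k G} (f : X ⟶ Y) (n : ℕ) :
    resolutionX X n ⟶ resolutionX Y n :=
  ContinuousCohomology.resolutionMap (ContinuousMonoidHom.id G) f n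

lemma IsSES.resMap (h : IsSES f g) : ∀ n, IsSES (resMap f n) (resMap g n)
  | 0 => h
  | n + 1 => (IsSES.resMap h n).coind₁

lemma IsSES.shortExact_aux (h : IsSES f g) :
    cochainMap (ContinuousMonoidHom.id G) f ≫ cochainMap (ContinuousMonoidHom.id G) g = 0 := by
  ext n x
  exact Subtype.ext ((h.resMap (n + 1)).zero x.1)

/-- A short exact sequence of smooth representations gives one of cochain complexes, hence a long
exact sequence in cohomology. -/
lemma IsSES.shortExact (h : IsSES f g) :
    (ShortComplex.mk (cochainMap (ContinuousMonoidHom.id G) f)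
      (cochainMap (ContinuousMonoidHom.id G) g) h.shortExact_aux).ShortExact := by
  refine HomologicalComplex.shortExact_of_degreewise_shortExact _ fun n => ?_
  have hn := h.resMap n
  have hn1 := h.resMap (n + 1)
  refine { exact := ?_, mono_f := ?_, epi_g := ?_ }
  · rw [ShortComplex.moduleCat_exact_iff]
    intro y hy
    obtain ⟨x, hx⟩ := hn1.exact y.1 congr($(hy).1)
    refine ⟨⟨x, fun γ => hn1.injective ?_⟩, Subtype.ext hx⟩
    rw [hom_rho, hx]
    exact y.2 γ
  · rw [ModuleCat.mono_iff_injective]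
    intro a b hab
    exact Subtype.ext (hn1.injective congr($(hab).1))
  · rw [ModuleCat.epi_iff_surjective]
    intro c
    -- an invariant function is determined by its value at `1`, which can be lifted
    obtain ⟨y, hy⟩ := hn.surjective (c.1 1)
    refine ⟨⟨⟨fun γ => (resolutionX Y n).ρ γ y, IsSmooth.continuous_orbit y⟩, ?_⟩, ?_⟩
    · intro γ
      refine ContinuousMap.ext fun γ' => ?_
      change (resolutionX Y n).ρ γ ((resolutionX Y n).ρ (γ⁻¹ * γ') y) = _
      rw [← rho_mul, mul_inv_cancel_left]
      rfl
    · refine Subtype.ext (ContinuousMap.ext fun γ => ?_)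
      change (DiscreteCohomology.resMap g n).hom ((resolutionX Y n).ρ γ y) = c.1 γ
      rw [hom_rho, hy]
      have := congr($(c.2 γ) γ)
      change (resolutionX Z n).ρ γ (c.1 (γ⁻¹ * γ)) = c.1 γ at this
      rwa [inv_mul_cancel] at this

/-- The connecting homomorphism. -/
noncomputable def IsSES.δ (h : IsSES f g) (n : ℕ) : coh Z n →ₗ[k] coh X (n + 1) :=
  (h.shortExact.δ n (n + 1) rfl).hom

lemma IsSES.exact₁ (h : IsSES f g) (n : ℕ) : Function.Exact (h.δ n) (cohHom f (n + 1)) :=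
  (ShortComplex.ShortExact.moduleCat_exact_iff_function_exact _).1
    (h.shortExact.homology_exact₁ n (n + 1) rfl)

lemma IsSES.exact₂ (h : IsSES f g) (n : ℕ) : Function.Exact (cohHom f n) (cohHom g n) :=
  (ShortComplex.ShortExact.moduleCat_exact_iff_function_exact _).1
    (h.shortExact.homology_exact₂ n)

lemma IsSES.exact₃ (h : IsSES f g) (n : ℕ) : Function.Exact (cohHom g n) (h.δ n) :=
  (ShortComplex.ShortExact.moduleCat_exact_iff_function_exact _).1
    (h.shortExact.homology_exact₃ n (n + 1) rfl)

/-- Naturality of the connecting homomorphism, for maps that may change the group. -/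
lemma cohMap_δ [CompactSpace H] {X' Y' Z' : TopRep.{max v w} k H} [IsSmooth X'] [IsSmooth Y'] [IsSmooth Z']
    {f' : X' ⟶ Y'} {g' : Y' ⟶ Z'} (h : IsSES f g) (h' : IsSES f' g') (φ : H →ₜ* G)
    (a : TopRep.res (φ : H →* G) X ⟶ X') (b : TopRep.res (φ : H →* G) Y ⟶ Y')
    (c : TopRep.res (φ : H →* G) Z ⟶ Z') (hab : ∀ x, b.hom (f.hom x) = f'.hom (a.hom x))
    (hbc : ∀ y, c.hom (g.hom y) = g'.hom (b.hom y)) (n : ℕ) (z : coh Z n) :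
    cohMap φ a (n + 1) (h.δ n z) = h'.δ n (cohMap φ c n z) := by
  let τ : ShortComplex.mk (cochainMap (ContinuousMonoidHom.id G) f)
      (cochainMap (ContinuousMonoidHom.id G) g) h.shortExact_aux ⟶
      ShortComplex.mk (cochainMap (ContinuousMonoidHom.id H) f')
      (cochainMap (ContinuousMonoidHom.id H) g') h'.shortExact_aux :=
    { τ₁ := cochainMap φ a
      τ₂ := cochainMap φ b
      τ₃ := cochainMap φ c
      comm₁₂ := (cochainMap_comp φ (.id H) φ rfl a f' (a ≫ f') fun _ => rfl).trans
        (cochainMap_comp (.id G) φ φ rfl f b (a ≫ f') fun x => (hab x).symm).symm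
      comm₂₃ := (cochainMap_comp φ (.id H) φ rfl b g' (b ≫ g') fun _ => rfl).trans
        (cochainMap_comp (.id G) φ φ rfl g c (b ≫ g') fun x => (hbc x).symm).symm }
  exact congr($(HomologicalComplex.HomologySequence.δ_naturality τ h.shortExact h'.shortExact
    n (n + 1) rfl).hom z)

/-- Cohomology in degree zero is left exact; this replaces the piece of the long exact sequence
before the first connecting homomorphism. -/
lemma cohHom_zero_injective (h : IsSES f g) : Function.Injective (cohHom f 0) := by
  rw [injective_iff_map_eq_zero]
  intro x hx
  obtain ⟨z, rfl⟩ := cocycleClass_surjective _ _ x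
  have hx' := (homologyMap_cocycleClass (cochainMap (ContinuousMonoidHom.id G) f) 0 z).symm.trans hx
  rw [cocycleClass_eq_zero_iff _ 0 0 (by simp)] at hx'
  obtain ⟨w, hw⟩ := hx'
  rw [HomologicalComplex.shape _ _ _ (by simp)] at hw
  have : z = 0 := by
    refine Subtype.ext (Subtype.ext ((h.resMap 1).injective ?_))
    refine (congr($(hw).1)).symm.trans ?_
    exact (map_zero (resMap f 1).hom).symm
  rw [this, map_zero]

end LongExact

end DiscreteCohomology

/-! ### Acyclic representations, degree zero and polynomials in central elements -/

namespace DiscreteCohomology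

universe u v w

variable {k : Type u} [CommRing k] [TopologicalSpace k]
  {G : Type v} [Group G] [TopologicalSpace G] [IsTopologicalGroup G]
  {H : Type v} [Group H] [TopologicalSpace H] [IsTopologicalGroup H]

section Acyclic

/-- The homotopy on the standard resolution induced by an equivariant retraction of the embedding
of `X` into `C(G, X)`. -/
noncomputable def retractionHomotopy (X : TopRep.{max v w} k G) (r : X.coind₁ ⟶ X) :
    (n : ℕ) → (resolutionX X (n + 1) ⟶ resolutionX X n)
  | 0 => r
  | n + 1 => -(coind₁Functor k G).map (retractionHomotopy X r n)

lemma retractionHomotopy_spec (X : TopRep.{max v w} k G) (r : X.coind₁ ⟶ X)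
    (hr : ∀ x : X, r.hom (ContinuousMap.const G x) = x) (n : ℕ) (x : resolutionX X (n + 1)) :
    (d X n).hom ((retractionHomotopy X r n).hom x) +
      (retractionHomotopy X r (n + 1)).hom ((d X (n + 1)).hom x) = x := by
  induction n with
  | zero =>
    refine ContinuousMap.ext fun γ => ?_
    change r.hom x + (- r.hom (x - ContinuousMap.const G ((show C(G, X) from x) γ))) = _
    rw [map_sub, hr]
    abel
  | succ n ih =>
    refine ContinuousMap.ext fun γ => ?_
    have h := ih ((show C(G, resolutionX X (n + 1)) from x) γ)
    change ((retractionHomotopy X r (n + 1)).hom x -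
      (d X n).hom (- (retractionHomotopy X r n).hom ((show C(G, resolutionX X (n + 1)) from x) γ)))
      + (- (retractionHomotopy X r (n + 1)).hom
        (x - (d X (n + 1)).hom ((show C(G, resolutionX X (n + 1)) from x) γ))) = _
    rw [map_neg, map_sub]
    refine Eq.trans ?_ h
    abel

/-- A representation that is an equivariant retract of `C(G, X)` has no cohomology in positive
degrees, by the contracting homotopy `retractionHomotopy`. -/
lemma coh_succ_eq_zero_of_retraction (X : TopRep.{max v w} k G) (r : X.coind₁ ⟶ X)
    (hr : ∀ x : X, r.hom (ContinuousMap.const G x) = x) (n : ℕ) (x : coh X (n + 1)) : x = 0 := by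
  obtain ⟨z, rfl⟩ := cocycleClass_surjective _ _ x
  rw [cocycleClass_eq_zero_iff _ n (n + 1) (by simp)]
  obtain ⟨⟨z, hz⟩, hz'⟩ := z
  have hdz : (d X (n + 2)).hom z = 0 := by
    have := congrArg Subtype.val hz'
    rw [cochains_d_apply] at this
    exact this
  refine ⟨⟨(retractionHomotopy X r (n + 1)).hom z, fun γ => ?_⟩, Subtype.ext ?_⟩
  · rw [← hom_rho]
    exact congrArg _ (hz γ)
  · rw [cochains_d_apply]
    have := retractionHomotopy_spec X r hr (n + 1) z
    rwa [hdz, map_zero, add_zero] at this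

variable [CompactSpace G]

/-- Evaluation on the diagonal, a retraction for coinduced representations. -/
noncomputable def diagonal (X : TopRep.{max v w} k G) [IsSmooth X] : X.coind₁.coind₁ ⟶ X.coind₁ :=
  haveI : IsSmooth X.coind₁.coind₁ := isSmooth_coind₁.{u, v, w} X.coind₁
  homOf (X := X.coind₁.coind₁) (Y := X.coind₁)
    { toFun := fun F : C(G, C(G, X)) => ⟨fun γ => F γ γ, by fun_prop⟩
      map_add' := fun _ _ => rfl
      map_smul' := fun _ _ => rfl } fun _ _ => rfl

lemma coh_coind₁_succ (X : TopRep.{max v w} k G) [IsSmooth X] (n : ℕ)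
    (x : coh X.coind₁ (n + 1)) : x = 0 :=
  coh_succ_eq_zero_of_retraction _ (diagonal X) (fun _ => rfl) n x

end Acyclic

section DegreeZero

lemma const_mem_invariants (X : TopRep.{max v w} k G) (x : X.ρ.invariants) :
    ContinuousMap.const G x.1 ∈ (resolutionX X 1).ρ.invariants :=
  fun g => ContinuousMap.ext fun _ => x.2 g

lemma const_mem_ker (X : TopRep.{max v w} k G) (x : X.ρ.invariants) :
    (⟨ContinuousMap.const G x.1, const_mem_invariants X x⟩ : (resolutionX X 1).ρ.invariants) ∈
      LinearMap.ker ((cochains X).d 0 1).hom := by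
  refine Subtype.ext ?_
  rw [cochains_d_apply]
  refine ContinuousMap.ext fun γ => ContinuousMap.ext fun γ' => ?_
  exact sub_self x.1

/-- The class in degree zero of an invariant vector. -/
noncomputable def invariantClass (X : TopRep.{max v w} k G) (x : X.ρ.invariants) : coh X 0 :=
  cocycleClass (cochains X) 0 ⟨_, const_mem_ker X x⟩

lemma invariantClass_surjective (X : TopRep.{max v w} k G) :
    Function.Surjective (invariantClass X) := by
  intro x
  obtain ⟨⟨⟨z, hz⟩, hz'⟩, rfl⟩ := cocycleClass_surjective _ _ x
  have hdz : (d X 1).hom z = 0 := by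
    have := congrArg Subtype.val hz'
    rw [cochains_d_apply] at this
    exact this
  have hc : ∀ γ, (show C(G, X) from z) γ = (show C(G, X) from z) 1 := fun γ => by
    have : (show C(G, X) from z) 1 - (show C(G, X) from z) γ = 0 :=
      congr((show C(G, X) from (show C(G, C(G, X)) from $hdz) γ) 1)
    exact (sub_eq_zero.1 this).symm
  refine ⟨⟨(show C(G, X) from z) 1, fun γ => ?_⟩, ?_⟩
  · have := congr((show C(G, X) from $(hz γ)) γ)
    refine Eq.trans ?_ (this.trans (hc γ))
    change X.ρ γ ((show C(G, X) from z) 1) = X.ρ γ ((show C(G, X) from z) (γ⁻¹ * γ))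
    rw [inv_mul_cancel]
  · refine congrArg _ (Subtype.ext (Subtype.ext (ContinuousMap.ext fun γ => ?_)))
    exact (hc γ).symm

lemma invariantClass_injective (X : TopRep.{max v w} k G) :
    Function.Injective (invariantClass X) := by
  intro x y hxy
  have h := sub_eq_zero.2 hxy
  unfold invariantClass at h
  rw [← map_sub, cocycleClass_eq_zero_iff _ 0 0 (by simp)] at h
  obtain ⟨w, hw⟩ := h
  rw [HomologicalComplex.shape _ _ _ (by simp)] at hw
  have := congr((show C(G, X) from Subtype.val $hw) 1)
  exact Subtype.ext (sub_eq_zero.1 this.symm)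

lemma map_mem_invariants {X : TopRep.{max v w} k G} {Y : TopRep.{max v w} k H} (φ : H →ₜ* G)
    (f : TopRep.res (φ : H →* G) X ⟶ Y) (x : X.ρ.invariants) : f.hom x.1 ∈ Y.ρ.invariants :=
  fun h => by
    rw [← hom_rho]
    exact congrArg _ (x.2 (φ h))

lemma cohMap_invariantClass {X : TopRep.{max v w} k G} {Y : TopRep.{max v w} k H} (φ : H →ₜ* G)
    (f : TopRep.res (φ : H →* G) X ⟶ Y) (x : X.ρ.invariants) :
    cohMap φ f 0 (invariantClass X x) = invariantClass Y ⟨f.hom x.1, map_mem_invariants φ f x⟩ :=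
  homologyMap_cocycleClass _ _ _

end DegreeZero

section DiscreteRep

variable [DiscreteTopology k]

/-- A representation on a module, considered with the discrete topology. -/
noncomputable def discreteRep {V : Type w} [AddCommGroup V] [Module k V]
    (ρ : Representation k G V) : TopRep.{w} k G :=
  letI : TopologicalSpace V := ⊥
  haveI : DiscreteTopology V := ⟨rfl⟩
  haveI : ContinuousSMul k V := ⟨continuous_of_discreteTopology⟩
  TopRep.of (X := V) (ContRepresentation.ofMonoidHom
    { toFun := fun g => { toLinearMap := ρ g, cont := continuous_of_discreteTopology }
      map_one' := by ext v; exact congr($(map_one ρ) v)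
      map_mul' := fun g h => by ext v; exact congr($(map_mul ρ g h) v) })

instance {V : Type w} [AddCommGroup V] [Module k V] (ρ : Representation k G V) :
    DiscreteTopology (discreteRep ρ) := ⟨rfl⟩

lemma IsSmooth.of_surjective {X Y : TopRep.{w} k G} [IsSmooth X] [DiscreteTopology Y] (f : X ⟶ Y)
    (hf : Function.Surjective f.hom) : IsSmooth Y where
  discrete := inferInstance
  continuous_orbit y := by
    obtain ⟨x, rfl⟩ := hf y
    simp_rw [← hom_rho]
    exact (continuous_of_discreteTopology (f := f.hom)).comp (IsSmooth.continuous_orbit x)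

/-- The subrepresentation of constant functions in `C(G, X)`. -/
noncomputable def constants (X : TopRep.{max v w} k G) : Submodule k X.coind₁ :=
  LinearMap.range (X.ρ.coind₁ι.toContinuousLinearMap.toLinearMap)

lemma constants_le_comap (X : TopRep.{max v w} k G) (g : G) :
    constants X ≤ (constants X).comap (linRep X.coind₁ g) := by
  rintro _ ⟨x, rfl⟩
  exact ⟨X.ρ g x, rfl⟩

/-- The quotient of `C(G, X)` by the constant functions: cohomology of `X` in degree `n + 1` is
governed by that of `cosyzygy X` in degree `n`. -/
noncomputable abbrev cosyzygy (X : TopRep.{max v w} k G) : TopRep.{max v w} k G :=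
  discreteRep (Representation.quotient (linRep X.coind₁) (constants X) (constants_le_comap X))

/-- The embedding of `X` into `C(G, X)` as the constant functions. -/
noncomputable abbrev toCoind₁ (X : TopRep.{max v w} k G) : X ⟶ X.coind₁ :=
  TopRep.ofHom X.ρ.coind₁ι

variable [CompactSpace G]

/-- The projection of `C(G, X)` onto `cosyzygy X`. -/
noncomputable def toCosyzygy (X : TopRep.{max v w} k G) [IsSmooth X] : X.coind₁ ⟶ cosyzygy X :=
  homOf (X := X.coind₁) (Y := cosyzygy X) (constants X).mkQ fun _ _ => rfl

lemma toCosyzygy_surjective (X : TopRep.{max v w} k G) [IsSmooth X] :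
    Function.Surjective (toCosyzygy X).hom := Submodule.mkQ_surjective _

instance (X : TopRep.{max v w} k G) [IsSmooth X] : IsSmooth (cosyzygy X) :=
  IsSmooth.of_surjective (toCosyzygy X) (toCosyzygy_surjective X)

lemma isSES_cosyzygy (X : TopRep.{max v w} k G) [IsSmooth X] :
    IsSES (toCoind₁ X) (toCosyzygy X) where
  injective _ _ h := congr((show C(G, X) from $h) 1)
  surjective := toCosyzygy_surjective X
  zero x := (Submodule.Quotient.mk_eq_zero _).2 ⟨x, rfl⟩
  exact _ hf := (Submodule.Quotient.mk_eq_zero _).1 hf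

/-- Dimension shifting: every class of positive degree comes from `cosyzygy X` in the degree below.
-/
lemma δ_cosyzygy_surjective (X : TopRep.{max v w} k G) [IsSmooth X] (n : ℕ) :
    Function.Surjective ((isSES_cosyzygy X).δ n) := fun x =>
  ((isSES_cosyzygy X).exact₁ n x).1 (coh_coind₁_succ X n _)

section Central

/-- The action of a polynomial in a central group element. -/
noncomputable def polyHom (g : G) (hg : ∀ h, Commute g h) (p : Polynomial k)
    (X : TopRep.{w} k G) [IsSmooth X] : X ⟶ X :=
  homOf (Polynomial.aeval (linRep X g) p) fun h x => by
    have hc : Commute (linRep X h) (Polynomial.aeval (linRep X g) p) := by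
      induction p using Polynomial.induction_on with
      | C a => rw [Polynomial.aeval_C]; exact (Algebra.commutes a _).symm
      | add p q hp hq => simpa using hp.add_right hq
      | monomial n a _ =>
        rw [map_mul, Polynomial.aeval_C, map_pow, Polynomial.aeval_X]
        exact Commute.mul_right (Algebra.commutes a _).symm
          ((((hg h).map (linRep X)).symm).pow_right (n + 1))
    exact (LinearMap.congr_fun hc.eq x).symm

lemma hom_aeval {X Y : TopRep.{w} k G} (f : X ⟶ Y) (g : G) (p : Polynomial k) (x : X) :
    f.hom (Polynomial.aeval (linRep X g) p x) =
      Polynomial.aeval (linRep Y g) p (f.hom x) := by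
  induction p using Polynomial.induction_on generalizing x with
  | C a => simp [Polynomial.aeval_C, Module.algebraMap_end_apply]
  | add p q hp hq =>
    rw [map_add, map_add, LinearMap.add_apply, LinearMap.add_apply, map_add, hp, hq]
  | monomial n a ih =>
    rw [pow_succ, ← mul_assoc]
    simp only [map_mul, Polynomial.aeval_X, Module.End.mul_apply] at ih ⊢
    rw [ih]
    congr 2
    exact hom_rho f g x

/-- The group acts trivially on its cohomology, so a polynomial `p` in a central element acts on
cohomology as `p(1)`. Here: if `p(1) = 0`, it acts as zero. -/
lemma cohHom_polyHom (g : G) (hg : ∀ h, Commute g h) (p : Polynomial k) (hp : p.eval 1 = 0)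
    (n : ℕ) : ∀ (X : TopRep.{max v w} k G) [IsSmooth X] (x : coh X n),
      cohHom (polyHom g hg p X) n x = 0 := by
  induction n with
  | zero =>
    intro X _ x
    obtain ⟨v, rfl⟩ := invariantClass_surjective X x
    refine (cohMap_invariantClass _ _ v).trans ?_
    have h0 : ∀ q : Polynomial k,
        Polynomial.aeval (linRep X g) q v.1 = q.eval 1 • v.1 := by
      intro q
      have hv : linRep X g v.1 = v.1 := v.2 g
      induction q using Polynomial.induction_on with
      | C a => simp [Polynomial.aeval_C, Module.algebraMap_end_apply]
      | add p q hp hq =>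
        rw [map_add, LinearMap.add_apply, hp, hq, Polynomial.eval_add, add_smul]
      | monomial n a ih =>
        rw [pow_succ, ← mul_assoc]
        simp only [map_mul, Polynomial.aeval_X, Module.End.mul_apply] at ih ⊢
        rw [hv, ih]
        simp
    have : (⟨(polyHom g hg p X).hom v.1, map_mem_invariants (.id G) (polyHom g hg p X) v⟩ :
        X.ρ.invariants) = 0 := Subtype.ext ((h0 p).trans (by rw [hp, zero_smul]; rfl))
    refine (congrArg (invariantClass X) this).trans ?_
    refine (congrArg (cocycleClass (cochains X) 0) ?_).trans (map_zero _)
    rfl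
  | succ n ih =>
    intro X _ x
    obtain ⟨z, rfl⟩ := δ_cosyzygy_surjective X n x
    rw [cohMap_δ (isSES_cosyzygy X) (isSES_cosyzygy X) (.id G) (polyHom g hg p X)
      (polyHom g hg p X.coind₁) (polyHom g hg p (cosyzygy X))
      (fun x => (hom_aeval (toCoind₁ X) g p x).symm)
      (fun y => (hom_aeval (toCosyzygy X) g p y).symm), ih, map_zero]

end Central

end DiscreteRep

end DiscreteCohomology

/-! ### Fixed vectors and inflation -/

namespace DiscreteCohomology

universe u v w

variable {k : Type u} [CommRing k] [TopologicalSpace k] [DiscreteTopology k]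
  {G : Type v} [Group G] [TopologicalSpace G] [IsTopologicalGroup G]
  {H : Type v} [Group H] [TopologicalSpace H] [IsTopologicalGroup H]

section Fixed

variable (φ : G →ₜ* H) (hφ : Topology.IsQuotientMap φ)

/-- The vectors fixed by the kernel of `φ`. -/
def fixedVectors (X : TopRep.{w} k G) : Submodule k X where
  carrier := {x | ∀ g, φ g = 1 → X.ρ g x = x}
  zero_mem' := fun g _ => map_zero _
  add_mem' := fun ha hb g hg => by rw [map_add, ha g hg, hb g hg]
  smul_mem' := fun c _ ha g hg => by rw [map_smul, ha g hg]

variable {φ}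

lemma rho_mem_fixedVectors {X : TopRep.{w} k G} {x : X} (hx : x ∈ fixedVectors φ X) (g : G) :
    X.ρ g x ∈ fixedVectors φ X := fun h hh => by
  have : X.ρ (g⁻¹ * h * g) x = x := hx _ (by simp [hh])
  rw [rho_mul, rho_mul] at this
  rw [← rho_rho_inv X g (X.ρ h (X.ρ g x)), this]

lemma rho_congr_fixedVectors {X : TopRep.{w} k G} {x : X} (hx : x ∈ fixedVectors φ X) {g h : G}
    (hgh : φ g = φ h) : X.ρ g x = X.ρ h x := by
  have : X.ρ (h⁻¹ * g) x = x := hx _ (by simp [hgh])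
  rw [rho_mul] at this
  rw [← rho_rho_inv X h (X.ρ g x), this]

/-- The action of `H` on the vectors fixed by the kernel of the surjection `φ : G → H`. -/
noncomputable def fixedAction (hφ : Function.Surjective φ) (X : TopRep.{w} k G) :
    Representation k H (fixedVectors φ X) where
  toFun h := ((linRep X) (Function.surjInv hφ h)).restrict fun _ hx => rho_mem_fixedVectors hx _
  map_one' := by
    ext x
    change X.ρ (Function.surjInv hφ 1) x.1 = x.1
    rw [rho_congr_fixedVectors x.2 (h := 1) (by simp [Function.surjInv_eq]), rho_one]
  map_mul' a b := by
    ext x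
    change X.ρ (Function.surjInv hφ (a * b)) x.1 =
      X.ρ (Function.surjInv hφ a) (X.ρ (Function.surjInv hφ b) x.1)
    rw [← rho_mul]
    exact rho_congr_fixedVectors x.2 (by simp [Function.surjInv_eq])

/-- The representation of `H` on the vectors fixed by the kernel of `φ : G → H`. -/
noncomputable def fixedRep (X : TopRep.{w} k G) : TopRep.{w} k H :=
  discreteRep (fixedAction hφ.surjective X)

lemma fixedRep_rho (X : TopRep.{w} k G) (g : G) (x : fixedVectors φ X) :
    ((fixedRep hφ X).ρ (φ g) x : fixedVectors φ X).1 = X.ρ g x.1 :=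
  rho_congr_fixedVectors x.2 (Function.surjInv_eq _ _)

instance isSmooth_fixedRep (X : TopRep.{w} k G) [IsSmooth X] : IsSmooth (fixedRep hφ X) where
  discrete := inferInstanceAs (DiscreteTopology (discreteRep (fixedAction hφ.surjective X)))
  continuous_orbit x := by
    have : DiscreteTopology (fixedRep hφ X) :=
      inferInstanceAs (DiscreteTopology (discreteRep (fixedAction hφ.surjective X)))
    rw [hφ.continuous_iff]
    have h : IsLocallyConstant fun g : G => X.ρ g (show fixedVectors φ X from x).1 :=
      (IsLocallyConstant.iff_continuous _).2 (IsSmooth.continuous_orbit _)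
    refine ((IsLocallyConstant.iff_eventually_eq _).2 fun g => ?_).continuous
    filter_upwards [(IsLocallyConstant.iff_eventually_eq _).1 h g] with g' hg'
    refine Subtype.ext (((fixedRep_rho hφ X g' x).trans hg').trans (fixedRep_rho hφ X g x).symm)

/-- The inclusion of the fixed vectors, as a map from the inflated representation. -/
noncomputable def fixedRepι (X : TopRep.{w} k G) [IsSmooth X] :
    TopRep.res (φ : G →* H) (fixedRep hφ X) ⟶ X :=
  homOf (X := TopRep.res (φ : G →* H) (fixedRep hφ X)) (fixedVectors φ X).subtype
    fun g x => fixedRep_rho hφ X g x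

lemma fixedRepι_injective (X : TopRep.{w} k G) [IsSmooth X] :
    Function.Injective (fixedRepι hφ X).hom := Subtype.val_injective

lemma hom_mem_fixedVectors {X' : TopRep.{w} k H} {X : TopRep.{w} k G}
    (f : TopRep.res (φ : G →* H) X' ⟶ X) (x : X') : f.hom x ∈ fixedVectors φ X := fun g hg => by
  rw [← hom_rho]
  change f.hom (X'.ρ (φ g) x) = _
  rw [hg, rho_one]

/-- A morphism from an inflated representation factors through the fixed vectors. -/
noncomputable def toFixedRep {X' : TopRep.{w} k H} [IsSmooth X'] {X : TopRep.{w} k G}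
    (f : TopRep.res (φ : G →* H) X' ⟶ X) : X' ⟶ fixedRep hφ X :=
  homOf (Y := fixedRep hφ X) (f.hom.toContinuousLinearMap.toLinearMap.codRestrict
      (fixedVectors φ X) (hom_mem_fixedVectors f)) fun h x => by
    obtain ⟨g, rfl⟩ := hφ.surjective h
    exact Subtype.ext ((hom_rho f g x).trans
      (fixedRep_rho hφ X g ⟨f.hom x, hom_mem_fixedVectors f x⟩).symm)

/-- Passage to fixed vectors is functorial. -/
noncomputable def fixedRepMap {X Y : TopRep.{w} k G} [IsSmooth X] (f : X ⟶ Y) :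
    fixedRep hφ X ⟶ fixedRep hφ Y :=
  toFixedRep hφ (fixedRepι hφ X ≫ f)

/-- The fixed vectors of a coinduced representation have no higher cohomology: they retract onto
functions of a diagonal argument. -/
lemma coh_fixedRep_coind₁ [CompactSpace G] (X : TopRep.{max v w} k G) [IsSmooth X] (n : ℕ)
    [CompactSpace H] (x : coh (fixedRep hφ X.coind₁) (n + 1)) : x = 0 := by
  have : IsSmooth X.coind₁ := isSmooth_coind₁.{u, v, w} X
  have : IsSmooth (fixedRep hφ X.coind₁) := isSmooth_fixedRep hφ X.coind₁
  have : IsSmooth (fixedRep hφ X.coind₁).coind₁ := isSmooth_coind₁.{u, v, w} _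
  let val : fixedRep hφ X.coind₁ → C(G, X) := fun y => (show fixedVectors φ X.coind₁ from y).1
  let μ : (fixedRep hφ X.coind₁).coind₁ → C(G, X) := fun F =>
    ⟨fun γ => val ((show C(H, fixedRep hφ X.coind₁) from F) (φ γ)) γ, by
      have h1 : Continuous fun γ => val ((show C(H, fixedRep hφ X.coind₁) from F) (φ γ)) :=
        (continuous_of_discreteTopology (f := val)).comp
          ((show C(H, fixedRep hφ X.coind₁) from F).continuous.comp φ.continuous)
      exact ContinuousEval.continuous_eval.comp (h1.prodMk continuous_id)⟩
  have hμ : ∀ F, μ F ∈ fixedVectors φ X.coind₁ := fun F g hg => by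
    refine ContinuousMap.ext fun γ => ?_
    have h := congr((show C(G, X) from
      $((show fixedVectors φ X.coind₁ from
        (show C(H, fixedRep hφ X.coind₁) from F) (φ γ)).2 g hg)) γ)
    refine Eq.trans ?_ h
    change X.ρ g (val ((show C(H, fixedRep hφ X.coind₁) from F) (φ (g⁻¹ * γ))) (g⁻¹ * γ)) = _
    have e : φ (g⁻¹ * γ) = φ γ := by rw [map_mul, map_inv, hg, inv_one, one_mul]
    rw [e]
    rfl
  refine coh_succ_eq_zero_of_retraction _ (homOf (X := (fixedRep hφ X.coind₁).coind₁)
    (Y := fixedRep hφ X.coind₁)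
    { toFun := fun F => (⟨μ F, hμ F⟩ : fixedVectors φ X.coind₁)
      map_add' := fun _ _ => rfl
      map_smul' := fun _ _ => rfl } ?_) ?_ n x
  · intro h F
    obtain ⟨g, rfl⟩ := hφ.surjective h
    refine Subtype.ext (Eq.trans ?_ (fixedRep_rho hφ X.coind₁ g _).symm)
    refine ContinuousMap.ext fun γ => ?_
    change val ((fixedRep hφ X.coind₁).ρ (φ g) ((show C(H, fixedRep hφ X.coind₁) from F)
      ((φ g)⁻¹ * φ γ))) γ = X.ρ g (val ((show C(H, fixedRep hφ X.coind₁) from F)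
      (φ (g⁻¹ * γ))) (g⁻¹ * γ))
    have e : φ (g⁻¹ * γ) = (φ g)⁻¹ * φ γ := by rw [map_mul, map_inv]
    rw [e]
    exact congrArg (fun F : C(G, X) => F γ) (fixedRep_rho hφ X.coind₁ g _)
  · intro y
    rfl

end Fixed

section Inflation

variable {φ : G →ₜ* H} (hφ : Topology.IsQuotientMap φ) {E : Type*} [Group E] [Fintype E]
  (ε : E →* G)

/-- `X` is relatively injective for the finite subgroup given by `ε : E → G`: the identity of `X` is
the trace over this subgroup of a linear endomorphism of `X`. -/
def IsTrace (X : TopRep.{w} k G) : Prop :=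
  ∃ θ : X →ₗ[k] X, ∀ x, ∑ e, X.ρ (ε e) (θ (X.ρ (ε e)⁻¹ x)) = x

variable {ε}

variable [CompactSpace G]

/-- The trace property passes to `C(G, X)` by composing functions with `θ`, compatibly with constant
functions. -/
lemma exists_trace_coind₁ {X : TopRep.{max v w} k G} [IsSmooth X] (h : IsTrace ε X) :
    ∃ θ : X.coind₁ →ₗ[k] X.coind₁, (∀ x, ∑ e, X.coind₁.ρ (ε e) (θ (X.coind₁.ρ (ε e)⁻¹ x)) = x) ∧
      constants X ≤ (constants X).comap θ := by
  obtain ⟨θ, hθ⟩ := h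
  refine ⟨{ toFun := fun f => (⟨fun γ => θ ((show C(G, X) from f) γ),
              continuous_of_discreteTopology.comp (show C(G, X) from f).continuous⟩ : C(G, X))
            map_add' := fun _ _ => ContinuousMap.ext fun _ => map_add θ _ _
            map_smul' := fun _ _ => ContinuousMap.ext fun _ => map_smul θ _ _ }, ?_, ?_⟩
  · intro f
    refine ContinuousMap.ext fun γ => ?_
    refine Eq.trans ?_ (hθ ((show C(G, X) from f) γ))
    refine (ContinuousMap.sum_apply _ _ _).trans (Finset.sum_congr rfl fun e _ => ?_)
    change X.ρ (ε e) (θ (X.ρ (ε e)⁻¹ ((show C(G, X) from f) ((ε e)⁻¹⁻¹ * ((ε e)⁻¹ * γ))))) = _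
    rw [inv_inv, mul_inv_cancel_left]
  · rintro _ ⟨x, rfl⟩
    exact ⟨θ x, rfl⟩

lemma IsTrace.coind₁ {X : TopRep.{max v w} k G} [IsSmooth X] (h : IsTrace ε X) :
    IsTrace ε X.coind₁ := by
  obtain ⟨θ, hθ, -⟩ := exists_trace_coind₁ h
  exact ⟨θ, hθ⟩

lemma IsTrace.cosyzygy {X : TopRep.{max v w} k G} [IsSmooth X] (h : IsTrace ε X) :
    IsTrace ε (cosyzygy X) := by
  obtain ⟨θ, hθ, hc⟩ := exists_trace_coind₁ h
  refine ⟨(constants X).mapQ _ θ hc, fun x => ?_⟩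
  obtain ⟨f, rfl⟩ := toCosyzygy_surjective X x
  conv_rhs => rw [← hθ f, map_sum]
  rfl

variable (hε : ∀ g, φ g = 1 ↔ ∃ e, ε e = g)

include hε in
/-- Fixed vectors lift along an equivariant surjection onto a relatively injective
representation. -/
lemma exists_fixed_lift {X Y : TopRep.{w} k G} (h : IsTrace ε Y) (f : X ⟶ Y)
    (hf : Function.Surjective f.hom) (y : Y) (hy : y ∈ fixedVectors φ Y) :
    ∃ x ∈ fixedVectors φ X, f.hom x = y := by
  obtain ⟨θ, hθ⟩ := h
  obtain ⟨x, hx⟩ := hf (θ y)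
  refine ⟨∑ e, X.ρ (ε e) x, fun g hg => ?_, ?_⟩
  · obtain ⟨e, rfl⟩ := (hε g).1 hg
    rw [map_sum]
    refine Fintype.sum_equiv (Equiv.mulLeft e) _ _ fun e' => ?_
    change X.ρ (ε e) (X.ρ (ε e') x) = X.ρ (ε (e * e')) x
    rw [map_mul ε, rho_mul]
  · rw [map_sum]
    conv_rhs => rw [← hθ y]
    refine Finset.sum_congr rfl fun e _ => ?_
    rw [hom_rho, hx, hy (ε e)⁻¹ (by rw [map_inv, (hε _).2 ⟨e, rfl⟩, inv_one])]

include hφ hε in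
/-- If `X` is relatively injective for the kernel of `φ : G → H`, inflation identifies the
cohomology of `H` in the fixed vectors with the cohomology of `G` in `X`. The proof is by dimension
shifting: relative injectivity passes to `cosyzygy X` and makes passage to fixed vectors exact on
the sequence `X → C(G, X) → cosyzygy X`. -/
theorem inflation_bijective [CompactSpace H] (n : ℕ) : ∀ (X : TopRep.{max v w} k G) [IsSmooth X],
    IsTrace ε X → ∀ (X' : TopRep.{max v w} k H) [IsSmooth X']
      (f : TopRep.res (φ : G →* H) X' ⟶ X), Function.Injective f.hom →
      (∀ x ∈ fixedVectors φ X, ∃ x', f.hom x' = x) → Function.Bijective (cohMap φ f n) := by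
  induction n with
  | zero =>
    intro X _ _ X' _ f hf hf'
    constructor
    · intro a b hab
      obtain ⟨a, rfl⟩ := invariantClass_surjective X' a
      obtain ⟨b, rfl⟩ := invariantClass_surjective X' b
      rw [cohMap_invariantClass, cohMap_invariantClass] at hab
      have := congrArg Subtype.val (invariantClass_injective X hab)
      exact congrArg _ (Subtype.ext (hf this))
    · intro x
      obtain ⟨x, rfl⟩ := invariantClass_surjective X x
      obtain ⟨x', hx'⟩ := hf' x.1 fun g _ => x.2 g
      refine ⟨invariantClass X' ⟨x', fun h => ?_⟩, ?_⟩
      · obtain ⟨g, rfl⟩ := hφ.surjective h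
        refine hf ((hom_rho f g x').trans ?_)
        rw [hx']
        exact x.2 g
      · rw [cohMap_invariantClass]
        exact congrArg _ (Subtype.ext hx')
  | succ n ih =>
    intro X _ hX X' _ f hf hf'
    have : IsSmooth X.coind₁ := isSmooth_coind₁.{u, v, w} X
    have : IsSmooth (fixedRep hφ X.coind₁) := isSmooth_fixedRep hφ X.coind₁
    let i' : X' ⟶ fixedRep hφ X.coind₁ := toFixedRep hφ (f ≫ toCoind₁ X)
    let q' : fixedRep hφ X.coind₁ ⟶ fixedRep hφ (cosyzygy X) := fixedRepMap hφ (toCosyzygy X)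
    have hses : IsSES i' q' :=
      { injective := fun a b hab => hf ((isSES_cosyzygy X).injective (congrArg Subtype.val hab))
        surjective := fun y => by
          obtain ⟨x, hx, hxy⟩ := exists_fixed_lift hε hX.cosyzygy (toCosyzygy X)
            (toCosyzygy_surjective X) _ (show fixedVectors φ (cosyzygy X) from y).2
          exact ⟨(⟨x, hx⟩ : fixedVectors φ X.coind₁), Subtype.ext hxy⟩
        zero := fun x => Subtype.ext ((isSES_cosyzygy X).zero (f.hom x))
        exact := fun y hy => by
          obtain ⟨x, hx⟩ := (isSES_cosyzygy X).exact _ (congrArg Subtype.val hy)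
          have hx1 : x ∈ fixedVectors φ X := fun g hg => by
            refine (isSES_cosyzygy X).injective ?_
            rw [hom_rho, hx]
            exact (show fixedVectors φ X.coind₁ from y).2 g hg
          obtain ⟨x', rfl⟩ := hf' x hx1
          exact ⟨x', Subtype.ext hx⟩ }
    have hE := ih X.coind₁ hX.coind₁ (fixedRep hφ X.coind₁) (fixedRepι hφ X.coind₁)
      (fixedRepι_injective hφ _) fun x hx => ⟨(⟨x, hx⟩ : fixedVectors φ X.coind₁), rfl⟩
    have hD := ih (cosyzygy X) hX.cosyzygy (fixedRep hφ (cosyzygy X)) (fixedRepι hφ (cosyzygy X))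
      (fixedRepι_injective hφ _) fun x hx => ⟨(⟨x, hx⟩ : fixedVectors φ (cosyzygy X)), rfl⟩
    have hδ : ∀ z, cohMap φ f (n + 1) (hses.δ n z) =
        (isSES_cosyzygy X).δ n (cohMap φ (fixedRepι hφ (cosyzygy X)) n z) := fun z =>
      cohMap_δ hses (isSES_cosyzygy X) φ f (fixedRepι hφ X.coind₁) (fixedRepι hφ (cosyzygy X))
        (fun _ => rfl) (fun _ => rfl) n z
    have hq : ∀ y, cohMap φ (fixedRepι hφ (cosyzygy X)) n (cohHom q' n y) =
        cohHom (toCosyzygy X) n (cohMap φ (fixedRepι hφ X.coind₁) n y) := fun y =>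
      cohMap_cohHom φ (fixedRepι hφ X.coind₁) (fixedRepι hφ (cosyzygy X)) q' (toCosyzygy X)
        (fun _ => rfl) n y
    have hδs : Function.Surjective (hses.δ n) := fun x =>
      (hses.exact₁ n x).1 (coh_fixedRep_coind₁ hφ X n _)
    constructor
    · rw [injective_iff_map_eq_zero]
      intro x hx
      obtain ⟨z, rfl⟩ := hδs x
      rw [hδ] at hx
      obtain ⟨y, hy⟩ := ((isSES_cosyzygy X).exact₃ n _).1 hx
      obtain ⟨y, rfl⟩ := hE.2 y
      rw [← hq] at hy
      exact (hses.exact₃ n z).2 ⟨y, hD.1 hy⟩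
    · intro x
      obtain ⟨z, rfl⟩ := δ_cosyzygy_surjective X n x
      obtain ⟨z, rfl⟩ := hD.2 z
      exact ⟨_, hδ z⟩

end Inflation

end DiscreteCohomology

/-! ### Bases from exact sequences -/

namespace DiscreteCohomology

universe u v w

section Bases

/-- A basis of an extension, from a basis of the submodule and lifts of a basis of the quotient. -/
lemma exists_basis_of_exact {k M N P ι κ : Type*} [CommRing k] [AddCommGroup M] [AddCommGroup N]
    [AddCommGroup P] [Module k M] [Module k N] [Module k P] {f : M →ₗ[k] N} {g : N →ₗ[k] P}
    (hf : Function.Injective f) (hfg : Function.Exact f g) (b : Module.Basis ι k M)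
    (c : Module.Basis κ k P) (s : κ → N) (hs : ∀ i, g (s i) = c i) :
    ∃ e : Module.Basis (ι ⊕ κ) k N, (∀ i, e (Sum.inl i) = f (b i)) ∧ ∀ i, e (Sum.inr i) = s i := by
  have hgf : ∀ m, g (f m) = 0 := fun m => (hfg (f m)).2 ⟨m, rfl⟩
  let v : ι ⊕ κ → N := Sum.elim (fun i => f (b i)) s
  have hli : LinearIndependent k v := by
    rw [linearIndependent_iff]
    intro l hl
    obtain ⟨⟨l₁, l₂⟩, rfl⟩ := (Finsupp.sumFinsuppLEquivProdFinsupp k).symm.surjective l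
    have hsplit : Finsupp.linearCombination k v
        ((Finsupp.sumFinsuppLEquivProdFinsupp k).symm (l₁, l₂)) =
        f (Finsupp.linearCombination k b l₁) + Finsupp.linearCombination k s l₂ := by
      have : (Finsupp.sumFinsuppLEquivProdFinsupp k).symm (l₁, l₂) =
          l₁.mapDomain Sum.inl + l₂.mapDomain Sum.inr := by
        rw [LinearEquiv.symm_apply_eq]
        ext i
        · simp [Finsupp.mapDomain_apply Sum.inl_injective, Finsupp.mapDomain_of_notMem_range]
        · simp [Finsupp.mapDomain_apply Sum.inr_injective, Finsupp.mapDomain_of_notMem_range]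
      rw [this, map_add, Finsupp.linearCombination_mapDomain, Finsupp.linearCombination_mapDomain,
        Finsupp.apply_linearCombination]
      rfl
    rw [hsplit] at hl
    have h2 : Finsupp.linearCombination k c l₂ = 0 := by
      have := congrArg g hl
      rw [map_add, hgf, zero_add, map_zero] at this
      rw [← this, Finsupp.apply_linearCombination]
      congr 2
      funext i
      exact (hs i).symm
    have hl₂ : l₂ = 0 := linearIndependent_iff.1 c.linearIndependent l₂ h2
    subst hl₂
    rw [map_zero, add_zero] at hl
    have hl₁ : l₁ = 0 := linearIndependent_iff.1 b.linearIndependent l₁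
      (hf (hl.trans (map_zero f).symm))
    subst hl₁
    exact map_zero _
  have hsp : ⊤ ≤ Submodule.span k (Set.range v) := by
    intro y _
    have h1 : ∀ m, f m ∈ Submodule.span k (Set.range v) := fun m => by
      have hm : m ∈ Submodule.span k (Set.range b) := b.mem_span m
      induction hm using Submodule.span_induction with
      | mem x h => obtain ⟨i, rfl⟩ := h; exact Submodule.subset_span ⟨Sum.inl i, rfl⟩
      | zero => simp
      | add x y _ _ hx hy => rw [map_add]; exact add_mem hx hy
      | smul a x _ hx => rw [map_smul]; exact Submodule.smul_mem _ _ hx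
    have h2 : ∃ y' ∈ Submodule.span k (Set.range v), g y' = g y := by
      have hm : g y ∈ Submodule.span k (Set.range c) := c.mem_span _
      generalize g y = z at hm
      induction hm using Submodule.span_induction with
      | mem x h =>
        obtain ⟨i, rfl⟩ := h
        exact ⟨s i, Submodule.subset_span ⟨Sum.inr i, rfl⟩, hs i⟩
      | zero => exact ⟨0, zero_mem _, map_zero g⟩
      | add x y _ _ hx hy =>
        obtain ⟨x', hx', rfl⟩ := hx
        obtain ⟨y', hy', rfl⟩ := hy
        exact ⟨x' + y', add_mem hx' hy', map_add _ _ _⟩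
      | smul a x _ hx =>
        obtain ⟨x', hx', rfl⟩ := hx
        exact ⟨a • x', Submodule.smul_mem _ _ hx', map_smul _ _ _⟩
    obtain ⟨y', hy', hy⟩ := h2
    obtain ⟨m, hm⟩ := (hfg (y - y')).1 (by rw [map_sub, hy, sub_self])
    rw [← sub_add_cancel y y', ← hm]
    exact add_mem (h1 m) hy'
  exact ⟨Module.Basis.mk hli hsp, fun i => Module.Basis.mk_apply hli hsp _,
    fun i => Module.Basis.mk_apply hli hsp _⟩

/-- The part of a graded index set in degrees less than `n`. -/
abbrev Below (I : ℕ → Type*) (n : ℕ) : Type _ := {i : Σ m, I m // i.1 < n}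

instance (I : ℕ → Type*) : IsEmpty (Below I 0) := ⟨fun i => absurd i.2 (Nat.not_lt_zero _)⟩

/-- Splitting off the top degree. -/
noncomputable def belowSucc (I : ℕ → Type*) (n : ℕ) : Below I n ⊕ I n ≃ Below I (n + 1) :=
  Equiv.ofBijective (Sum.elim (fun i => ⟨i.1, i.2.trans n.lt_succ_self⟩)
    fun i => ⟨⟨n, i⟩, n.lt_succ_self⟩) <| by
    constructor
    · rintro (⟨⟨m, i⟩, h⟩ | i) (⟨⟨m', i'⟩, h'⟩ | i') hii
      · have : (⟨m, i⟩ : Σ m, I m) = ⟨m', i'⟩ := congrArg Subtype.val hii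
        exact congrArg Sum.inl (Subtype.ext this)
      · have : m = n := congrArg (fun x : Below I (n + 1) => x.1.1) hii
        exact absurd this (Nat.ne_of_lt h)
      · have : n = m' := congrArg (fun x : Below I (n + 1) => x.1.1) hii
        exact absurd this.symm (Nat.ne_of_lt h')
      · have : (⟨n, i⟩ : Σ m, I m) = ⟨n, i'⟩ := congrArg Subtype.val hii
        exact congrArg Sum.inr (eq_of_heq (Sigma.mk.inj this).2)
    · rintro ⟨⟨m, i⟩, h⟩
      rcases Nat.lt_succ_iff_lt_or_eq.1 h with h | rfl
      · exact ⟨Sum.inl ⟨⟨m, i⟩, h⟩, rfl⟩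
      · exact ⟨Sum.inr i, rfl⟩

end Bases

section Step

variable {k : Type u} [CommRing k] [TopologicalSpace k] [DiscreteTopology k]
  {G : Type v} [Group G] [TopologicalSpace G] [IsTopologicalGroup G] [CompactSpace G]
  {H : Type v} [Group H] [TopologicalSpace H] [IsTopologicalGroup H] [CompactSpace H]

/-- A morphism whose underlying map vanishes induces zero on cohomology: it factors through the zero
polynomial in the identity element. -/
lemma cohHom_eq_zero {X Y : TopRep.{max v w} k G} [IsSmooth X] [IsSmooth Y] (f : X ⟶ Y)
    (hf : ∀ x, f.hom x = 0) (n : ℕ) (x : coh X n) : cohHom f n x = 0 := by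
  have h : f = polyHom (1 : G) (fun h => Commute.one_left h) 0 X ≫ f :=
    hom_ext_apply fun x => by
      rw [hf]
      exact (hf _).symm
  rw [← cohHom_cohHom (polyHom (1 : G) (fun h => Commute.one_left h) 0 X) f f
    (fun x => congr($(h).hom x)) n x, cohHom_polyHom _ _ _ (by simp), map_zero]

variable {X' : TopRep.{max v w} k H} [IsSmooth X'] {X W B U : TopRep.{max v w} k G}
  [IsSmooth X] [IsSmooth W] [IsSmooth B] [IsSmooth U]

/-- The inductive step in terms of exact sequences. Let `W` be relatively injective, with the
cohomology of `X'` by inflation along `ι`. The module `U` is the pushout of `ι : X → W` along an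
endomorphism `π` of `X` that is zero on cohomology, and the cokernel `B` of `ι` is also the kernel
of a surjection `t : W → X` with `t ∘ ι = 0`. Then the long exact sequences of all three short exact
sequences split into short ones, and the bases of the cohomology of `X` and `B`, and from these that
of `U`, are built degree by degree out of a basis of that of `X'`. -/
theorem exists_basis_step {φ : G →ₜ* H} (f₀ : TopRep.res (φ : G →* H) X' ⟶ X)
    {ι : X ⟶ W} {s : W ⟶ B} (ha : IsSES ι s) {j : X ⟶ U} {q : U ⟶ B} (hb : IsSES j q)
    {c : B ⟶ W} {t : W ⟶ X} (hc : IsSES c t) (π : X ⟶ X) (l : W ⟶ U)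
    (hl : ∀ x, l.hom (ι.hom x) = j.hom (π.hom x)) (hq : ∀ x, q.hom (l.hom x) = s.hom x)
    (hπ : ∀ n x, cohHom π n x = 0) (hιt : ∀ x, t.hom (ι.hom x) = 0)
    (hbij : ∀ n, Function.Bijective (cohMap φ (f₀ ≫ ι) n))
    (I : ℕ → Type*) (b' : ∀ n, Module.Basis (I n) k (coh X' n)) :
    ∃ b : ∀ n, Module.Basis ((I n ⊕ Below I n) ⊕ Below I (n + 1)) k (coh U n),
      ∀ n i, b n (Sum.inl (Sum.inl i)) = cohMap φ (f₀ ≫ j) n (b' n i) := by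
  have hcomp : ∀ n x, cohHom ι n (cohMap φ f₀ n x) = cohMap φ (f₀ ≫ ι) n x := fun n x =>
    cohMap_cohMap φ (.id G) φ rfl f₀ ι (f₀ ≫ ι) (fun _ => rfl) n x
  have hcomp' : ∀ n x, cohHom j n (cohMap φ f₀ n x) = cohMap φ (f₀ ≫ j) n x := fun n x =>
    cohMap_cohMap φ (.id G) φ rfl f₀ j (f₀ ≫ j) (fun _ => rfl) n x
  -- a basis of the cohomology of the relatively injective module
  let bW : ∀ n, Module.Basis (I n) k (coh W n) := fun n =>
    (b' n).map (LinearEquiv.ofBijective (cohMap φ (f₀ ≫ ι) n) (hbij n))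
  -- `ι` is onto on cohomology, so `t`, being zero on the image of `ι`, is zero on cohomology; both
  -- long exact sequences involving `W` split into short exact ones
  have hι_surj : ∀ n, Function.Surjective (cohHom ι n) := fun n y => by
    obtain ⟨x, rfl⟩ := (hbij n).2 y
    exact ⟨_, hcomp n x⟩
  have ht_zero : ∀ n y, cohHom t n y = 0 := fun n y => by
    obtain ⟨x, rfl⟩ := hι_surj n y
    rw [cohHom_cohHom ι t (ι ≫ t) (fun _ => rfl)]
    exact cohHom_eq_zero _ hιt n x
  have hδa : ∀ n, Function.Injective (ha.δ n) := fun n => by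
    rw [injective_iff_map_eq_zero]
    intro z hz
    obtain ⟨y, rfl⟩ := (ha.exact₃ n z).1 hz
    obtain ⟨x, rfl⟩ := hι_surj n y
    exact (ha.exact₂ n _).2 ⟨x, rfl⟩
  have hδc : ∀ n, Function.Injective (hc.δ n) := fun n => by
    rw [injective_iff_map_eq_zero]
    intro z hz
    obtain ⟨y, rfl⟩ := (hc.exact₃ n z).1 hz
    exact ht_zero n y
  have hc_surj : ∀ n, Function.Surjective (cohHom c n) := fun n y =>
    (hc.exact₂ n y).1 (ht_zero n y)
  -- `0 → H^n(B) → H^(n+1)(X) → H^(n+1)(W) → 0`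
  have hA_succ : ∀ n, Module.Basis (Below I (n + 1)) k (coh B n) →
      ∃ b : Module.Basis (I (n + 1) ⊕ Below I (n + 1)) k (coh X (n + 1)),
        ∀ i, b (Sum.inl i) = cohMap φ f₀ (n + 1) (b' (n + 1) i) := fun n bB => by
    obtain ⟨e, -, he⟩ := exists_basis_of_exact (hδa n) (ha.exact₁ n) bB (bW (n + 1))
      (fun i => cohMap φ f₀ (n + 1) (b' (n + 1) i)) (fun i => hcomp _ _)
    exact ⟨e.reindex (Equiv.sumComm _ _), fun i => by simpa using he i⟩
  -- `0 → H^n(X) → H^(n+1)(B) → H^(n+1)(W) → 0`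
  have hB_succ : ∀ n, Module.Basis (I n ⊕ Below I n) k (coh X n) →
      Nonempty (Module.Basis (Below I (n + 2)) k (coh B (n + 1))) := fun n bA => by
    choose r hr using fun i => hc_surj (n + 1) (bW (n + 1) i)
    obtain ⟨e, -, -⟩ := exists_basis_of_exact (hδc n) (hc.exact₁ n) bA (bW (n + 1)) r hr
    exact ⟨e.reindex ((Equiv.sumCongr ((Equiv.sumComm _ _).trans (belowSucc I n)) (Equiv.refl _)).trans
      (belowSucc I (n + 1)))⟩
  -- in degree zero `X` and `B` both have the cohomology of `W`
  have hA0 : ∃ b : Module.Basis (I 0 ⊕ Below I 0) k (coh X 0),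
        ∀ i, b (Sum.inl i) = cohMap φ f₀ 0 (b' 0 i) := by
    let e := LinearEquiv.ofBijective (cohHom ι 0) ⟨cohHom_zero_injective ha, hι_surj 0⟩
    refine ⟨((bW 0).map e.symm).reindex (Equiv.sumEmpty _ _).symm, fun i => ?_⟩
    rw [Module.Basis.reindex_apply, Equiv.symm_symm, Equiv.sumEmpty_apply_inl,
      Module.Basis.map_apply, LinearEquiv.symm_apply_eq]
    exact (hcomp _ _).symm
  have hB0 : Nonempty (Module.Basis (Below I 1) k (coh B 0)) := by
    let e := LinearEquiv.ofBijective (cohHom c 0) ⟨cohHom_zero_injective hc, hc_surj 0⟩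
    exact ⟨((bW 0).map e.symm).reindex ((Equiv.emptySum (Below I 0) _).symm.trans (belowSucc I 0))⟩
  have hAB : ∀ n, (∃ b : Module.Basis (I n ⊕ Below I n) k (coh X n),
        ∀ i, b (Sum.inl i) = cohMap φ f₀ n (b' n i)) ∧
      Nonempty (Module.Basis (Below I (n + 1)) k (coh B n)) := fun n => by
    induction n with
    | zero => exact ⟨hA0, hB0⟩
    | succ n ih =>
      obtain ⟨⟨bA, -⟩, ⟨bB⟩⟩ := ih
      exact ⟨hA_succ n bB, hB_succ n bA⟩
  -- the connecting homomorphism of the sequence `X → U → B` factors through `π`, which is zero on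
  -- cohomology, so `0 → H^n(X) → H^n(U) → H^n(B) → 0` is exact
  have hδb : ∀ n z, hb.δ n z = 0 := fun n z => by
    have := cohMap_δ ha hb (.id G) π l (𝟙 B) hl (fun y => (hq y).symm) n z
    rw [cohMap_id] at this
    rw [← this]
    exact hπ _ _
  have hj : ∀ n, Function.Injective (cohHom j n) := fun n => by
    cases n with
    | zero => exact cohHom_zero_injective hb
    | succ n =>
      rw [injective_iff_map_eq_zero]
      intro x hx
      obtain ⟨z, rfl⟩ := (hb.exact₁ n x).1 hx
      exact hδb n z
  have hU : ∀ n, ∃ b : Module.Basis ((I n ⊕ Below I n) ⊕ Below I (n + 1)) k (coh U n),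
      ∀ i, b (Sum.inl (Sum.inl i)) = cohMap φ (f₀ ≫ j) n (b' n i) := fun n => by
    obtain ⟨⟨bA, hbA⟩, ⟨bB⟩⟩ := hAB n
    choose r hr using fun i => (hb.exact₃ n (bB i)).1 (hδb n _)
    obtain ⟨e, he, -⟩ := exists_basis_of_exact (hj n) (hb.exact₂ n) bA bB r hr
    exact ⟨e, fun i => by rw [he, hbA, hcomp']⟩
  choose b hb using hU
  exact ⟨b, hb⟩

end Step

end DiscreteCohomology

/-! ### Points and normal forms -/

/-- A point of the universal norm distribution with groups `C x`: a finite set of primes together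
with an element of `C x` for each `x` in this set. The value `0` means that `x` does not occur. -/
abbrev Point {P : Type*} (C : P → Type*) [∀ x, Group (C x)] : Type _ := Π₀ x, WithZero (C x)

/-- The Euler factors of a distribution: a polynomial `poly x` for each prime `x`, to be evaluated
at the group element `frob x`. Only the action of `frob x` on points not involving `x` enters the
relations, so the component of `frob x` at `x` itself is irrelevant. -/
structure EulerData {P : Type*} (C : P → Type*) (R : Type*) [∀ x, Group (C x)] [CommRing R] where
  frob : P → ∀ x, C x
  poly : P → Polynomial R

namespace Point

variable {P : Type*} [DecidableEq P] {C : P → Type*} [∀ x, Group (C x)]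

/-- The action of `∏ x, C x` on the points. -/
def shift (g : ∀ x, C x) (a : Point C) : Point C :=
  a.mapRange (fun x c => (g x : WithZero (C x)) * c) fun _ => mul_zero _

@[simp] lemma shift_apply (g : ∀ x, C x) (a : Point C) (x : P) :
    shift g a x = g x * a x := rfl

lemma shift_one (a : Point C) : shift 1 a = a := by
  ext x; simp

lemma shift_mul (g h : ∀ x, C x) (a : Point C) :
    shift (g * h) a = shift g (shift h a) := by
  ext x : 1; simp [mul_assoc]

lemma shift_apply_eq_zero {g : ∀ x, C x} {a : Point C} {x : P} :
    shift g a x = 0 ↔ a x = 0 := by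
  simp

lemma shift_update (g : ∀ x, C x) (a : Point C) (x : P) (c : WithZero (C x)) :
    shift g (a.update x c) = (shift g a).update x (g x * c) := by
  ext y : 1
  by_cases h : y = x
  · subst h; simp
  · simp [DFinsupp.coe_update, Function.update_of_ne h]

lemma update_update (a : Point C) (x : P) (c d : WithZero (C x)) :
    (a.update x c).update x d = a.update x d := by
  ext y : 1
  simp

lemma update_comm (a : Point C) {x y : P} (h : x ≠ y) (c : WithZero (C x)) (d : WithZero (C y)) :
    (a.update x c).update y d = (a.update y d).update x c := by
  ext z : 1
  simp [Function.update_comm h]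

lemma update_self (a : Point C) (x : P) : a.update x (a x) = a := by
  ext y : 1
  simp

lemma update_of_eq {a : Point C} {x : P} {c : WithZero (C x)} (h : a x = c) : a.update x c = a := by
  subst h; exact update_self a x

lemma update_apply_of_ne (a : Point C) {x y : P} (h : y ≠ x) (c : WithZero (C x)) :
    a.update x c y = a y := by
  simp [DFinsupp.coe_update, Function.update_of_ne h]

lemma update_apply_same (a : Point C) (x : P) (c : WithZero (C x)) :
    a.update x c x = c := by
  simp [DFinsupp.coe_update]

/-- The number of primes of a point. -/
noncomputable def size (a : Point C) : ℕ := {x | a x ≠ 0}.ncard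

/-- The primes of `Y` at which a point has trivial component. The points without such primes are the
normal forms modulo the relations at `Y`. -/
def bad (Y : Set P) (a : Point C) : Set P := {x | x ∈ Y ∧ a x = 1}

lemma finite_support (a : Point C) : {x | a x ≠ 0}.Finite := DFinsupp.finite_support a

lemma finite_bad (Y : Set P) (a : Point C) : (bad Y a).Finite :=
  (finite_support a).subset fun x hx => by
    change a x ≠ 0
    rw [hx.2]
    exact one_ne_zero

lemma size_shift (g : ∀ x, C x) (a : Point C) : size (shift g a) = size a := by
  simp [size]

lemma size_update_zero_lt {a : Point C} {x : P} (h : a x ≠ 0) : size (a.update x 0) < size a := by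
  refine Set.ncard_lt_ncard ⟨fun y hy => ?_, fun hs => ?_⟩ (finite_support a)
  · by_cases hyx : y = x
    · subst hyx; simp at hy
    · exact (update_apply_of_ne a hyx 0).symm.trans_ne hy
  · exact hs h (update_apply_same a x 0)

lemma size_update {a : Point C} {x : P} {c : WithZero (C x)} (h : a x ≠ 0) (hc : c ≠ 0) :
    size (a.update x c) = size a := by
  unfold size
  congr 1
  ext y
  by_cases hyx : y = x
  · subst hyx; simp [h, hc]
  · simp [hyx]

lemma ncard_bad_update_lt {Y : Set P} {a : Point C} {x : P} (h : x ∈ bad Y a)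
    {c : WithZero (C x)} (hc : c ≠ 1) : (bad Y (a.update x c)).ncard < (bad Y a).ncard := by
  refine Set.ncard_lt_ncard ⟨fun y hy => ?_, fun hs => ?_⟩ (finite_bad Y a)
  · by_cases hyx : y = x
    · subst hyx; exact h
    · exact ⟨hy.1, (update_apply_of_ne a hyx c).symm.trans hy.2⟩
  · exact hc ((update_apply_same a x c).symm.trans (hs h).2)

end Point

open Point

namespace EulerData

variable {P : Type*} [LinearOrder P] {C : P → Type*} [∀ x, CommGroup (C x)] [∀ x, Fintype (C x)]
  {R : Type*} [CommRing R]

variable (C R) in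
/-- The permutation representation of `∏ x, C x` on the free module on the points. -/
noncomputable def pointRep : Representation R (∀ x, C x) (Point C →₀ R) where
  toFun g := Finsupp.lmapDomain R R (shift g)
  map_one' := by ext a : 2; simp [shift_one]
  map_mul' g h := by ext a : 2; simp [shift_mul]

lemma pointRep_single (g : ∀ x, C x) (a : Point C) (r : R) :
    pointRep C R g (Finsupp.single a r) = Finsupp.single (shift g a) r := by
  simp [pointRep]

lemma aeval_pointRep_single (g : ∀ x, C x) (q : Polynomial R) (a : Point C) :
    Polynomial.aeval (pointRep C R g) q (Finsupp.single a 1) =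
      q.sum fun i r => r • Finsupp.single (shift (g ^ i) a) 1 := by
  rw [Polynomial.aeval_def, Polynomial.eval₂_eq_sum, Polynomial.sum, LinearMap.sum_apply]
  refine Finset.sum_congr rfl fun i _ => ?_
  rw [← map_pow, Module.End.mul_apply, pointRep_single, Module.algebraMap_end_apply]

variable (E : EulerData C R) (Y : Set P)

/-- The Euler factor at `x` as an operator. -/
noncomputable def euler (x : P) : Module.End R (Point C →₀ R) :=
  Polynomial.aeval (pointRep C R (E.frob x)) (E.poly x)

lemma euler_single (x : P) (a : Point C) : E.euler x (Finsupp.single a 1) =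
    (E.poly x).sum fun i r => r • Finsupp.single (shift (E.frob x ^ i) a) 1 :=
  aeval_pointRep_single _ _ _

/-- The distribution relation at `x` for the point `a`, which is assumed not to involve `x`. -/
noncomputable def relation (x : P) (a : Point C) : Point C →₀ R :=
  E.euler x (Finsupp.single a 1) - ∑ b : C x, Finsupp.single (a.update x (b : WithZero (C x))) 1

/-- The span of the distribution relations at the primes of `Y`. -/
noncomputable def relations : Submodule R (Point C →₀ R) :=
  Submodule.span R {m | ∃ x ∈ Y, ∃ a : Point C, a x = 0 ∧ E.relation x a = m}

open Classical in
/-- The normal form of a point modulo the relations at `Y`, a combination of points with no trivial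
component at a prime in `Y`: the relation at the least prime with trivial component is used to
rewrite the point in terms of points which have fewer primes or fewer trivial components. -/
noncomputable def normalForm (a : Point C) : Point C →₀ R :=
  if h : ∃ x, IsLeast (bad Y a) x then
    ((E.poly h.choose).sum fun i r =>
      r • normalForm (shift (E.frob h.choose ^ i) (a.update h.choose 0))) -
    ∑ c : {c : C h.choose // c ≠ 1}, normalForm (a.update h.choose (c.1 : WithZero (C h.choose)))
  else Finsupp.single a 1
termination_by (a.size, (bad Y a).ncard)
decreasing_by
  · have hx := h.choose_spec.1.2
    refine Prod.Lex.left _ _ ?_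
    rw [size_shift]
    exact size_update_zero_lt (by rw [hx]; exact one_ne_zero)
  · have hx := h.choose_spec.1
    rw [size_update (by rw [hx.2]; exact one_ne_zero) WithZero.coe_ne_zero]
    refine Prod.Lex.right _ (ncard_bad_update_lt hx ?_)
    exact fun h1 => c.2 (WithZero.coe_inj.1 h1)

/-- The normal form, extended linearly. -/
noncomputable def normalize : (Point C →₀ R) →ₗ[R] (Point C →₀ R) :=
  Finsupp.linearCombination R (E.normalForm Y)

lemma normalize_single (a : Point C) (r : R) :
    E.normalize Y (Finsupp.single a r) = r • E.normalForm Y a := by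
  simp [normalize]

lemma normalForm_of_bad_eq_empty {Y : Set P} {a : Point C} (h : bad Y a = ∅) :
    E.normalForm Y a = Finsupp.single a 1 := by
  rw [normalForm, dif_neg]
  rintro ⟨x, hx⟩
  rw [h] at hx
  exact hx.1

open Classical in
lemma normalForm_of_isLeast {Y : Set P} {a : Point C} {x : P} (h : IsLeast (bad Y a) x) :
    E.normalForm Y a = E.normalize Y (E.euler x (Finsupp.single (a.update x 0) 1)) -
      ∑ c : {c : C x // c ≠ 1}, E.normalForm Y (a.update x (c.1 : WithZero (C x))) := by
  rw [normalForm, dif_pos ⟨x, h⟩]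
  have hx : Exists.choose ⟨x, h⟩ = x := (Exists.choose_spec ⟨x, h⟩ : IsLeast (bad Y a) _).unique h
  rw [hx, euler_single, Polynomial.sum, Polynomial.sum, map_sum]
  simp only [map_smul, normalize_single, one_smul]

lemma exists_isLeast_bad {Y : Set P} {a : Point C} (h : bad Y a ≠ ∅) : ∃ x, IsLeast (bad Y a) x := by
  obtain ⟨x, hx, hx'⟩ := Set.exists_min_image _ id (finite_bad Y a) (Set.nonempty_iff_ne_empty.2 h)
  exact ⟨x, hx, hx'⟩

/-- Induction on points along the rewriting steps of the normal form. -/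
lemma rewriting_induction {Y : Set P} {motive : Point C → Prop}
    (step : ∀ a, (∀ b, b.size < a.size → motive b) →
      (∀ x ∈ bad Y a, ∀ c : C x, c ≠ 1 → motive (a.update x c)) → motive a) (a : Point C) :
    motive a := by
  suffices h : ∀ (s : ℕ ×ₗ ℕ) (a : Point C), toLex (a.size, (bad Y a).ncard) = s → motive a from
    h _ a rfl
  intro s
  induction s using WellFoundedLT.induction with
  | ind s ih =>
    rintro a rfl
    refine step a (fun b hb => ih _ (Prod.Lex.left _ _ hb) b rfl) fun x hx c hc => ih _ ?_ _ rfl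
    have h0 : a x ≠ 0 := by rw [hx.2]; exact one_ne_zero
    rw [size_update h0 WithZero.coe_ne_zero]
    exact Prod.Lex.right _ (ncard_bad_update_lt hx fun h => hc (WithZero.coe_inj.1 h))

/-- The operator that adds `x` to a point in all possible ways. -/
noncomputable def creation (x : P) : Module.End R (Point C →₀ R) :=
  Finsupp.linearCombination R fun a : Point C =>
    ∑ b : C x, Finsupp.single (a.update x (b : WithZero (C x))) 1

lemma creation_single (x : P) (a : Point C) : creation x (Finsupp.single a (1 : R)) =
    ∑ b : C x, Finsupp.single (a.update x (b : WithZero (C x))) 1 := by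
  simp [creation]

/-- The distribution relation at `x` as an operator. -/
noncomputable def relator (x : P) : Module.End R (Point C →₀ R) := E.euler x - creation x

lemma relation_eq (x : P) (a : Point C) :
    E.relation x a = E.relator x (Finsupp.single a 1) := by
  rw [relator, LinearMap.sub_apply, creation_single]; rfl

lemma commute_pointRep (g h : ∀ x, C x) : Commute (pointRep C R g) (pointRep C R h) := by
  change _ * _ = _ * _
  rw [← map_mul, mul_comm, map_mul]

lemma commute_pointRep_creation (g : ∀ x, C x) (x : P) :
    Commute (pointRep C R g) (creation x) := by
  refine Finsupp.lhom_ext' fun a => LinearMap.ext_ring ?_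
  simp only [LinearMap.comp_apply, Finsupp.lsingle_apply, Module.End.mul_apply, creation_single,
    map_sum, pointRep_single, shift_update]
  exact Fintype.sum_equiv (Equiv.mulLeft (g x)) _ _ fun b => rfl

lemma commute_creation {x y : P} (h : x ≠ y) :
    Commute (creation x : Module.End R (Point C →₀ R)) (creation y) := by
  refine Finsupp.lhom_ext' fun a => LinearMap.ext_ring ?_
  simp only [LinearMap.comp_apply, Finsupp.lsingle_apply, Module.End.mul_apply, creation_single,
    map_sum]
  rw [Finset.sum_comm]
  simp only [update_comm _ h]

lemma commute_aeval {A : Type*} [AddCommGroup A] [Module R A] {a b : Module.End R A} (h : Commute a b)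
    (q : Polynomial R) : Commute (Polynomial.aeval a q) b := by
  induction q using Polynomial.induction_on with
  | C r => rw [Polynomial.aeval_C]; exact Algebra.commutes r b
  | add p q hp hq => rw [map_add]; exact hp.add_left hq
  | monomial n r _ =>
    rw [map_mul, Polynomial.aeval_C, map_pow, Polynomial.aeval_X]
    exact Commute.mul_left (Algebra.commutes r b) (h.pow_left _)

lemma commute_euler_pointRep (x : P) (g : ∀ x, C x) : Commute (E.euler x) (pointRep C R g) :=
  commute_aeval (commute_pointRep _ _) _

lemma commute_relator {x y : P} (h : x ≠ y) :
    Commute (E.relator x) (E.relator y) := by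
  unfold relator
  have h1 : ∀ x y, Commute (E.euler x) (E.euler y) := fun x y =>
    commute_aeval (E.commute_euler_pointRep y _).symm _
  have h2 : ∀ x y, Commute (E.euler x) (creation y) := fun x y =>
    commute_aeval (commute_pointRep_creation _ _) _
  have h3 : Commute (creation x : Module.End R (Point C →₀ R)) (creation y) := commute_creation h
  refine LinearMap.ext fun v => ?_
  have e1 : E.euler x (E.euler y v) = E.euler y (E.euler x v) := LinearMap.congr_fun (h1 x y).eq v
  have e2 : E.euler x (creation y v) = creation y (E.euler x v) :=
    LinearMap.congr_fun (h2 x y).eq v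
  have e3 : E.euler y (creation x v) = creation x (E.euler y v) :=
    LinearMap.congr_fun (h2 y x).eq v
  have e4 : creation x (creation y v) = creation y (creation x v) := LinearMap.congr_fun h3.eq v
  simp only [Module.End.mul_apply, LinearMap.sub_apply, map_sub, e1, e2, e3, e4]
  abel

/-- To control the value of a linear map on `E.euler x a`, it suffices to control it on the
shifts of `a`. -/
lemma euler_single_mem {A : Type*} [AddCommGroup A] [Module R A] {N : Submodule R A}
    (f : (Point C →₀ R) →ₗ[R] A) {x : P} {a : Point C}
    (h : ∀ i : ℕ, f (Finsupp.single (shift (E.frob x ^ i) a) 1) ∈ N) :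
    f (E.euler x (Finsupp.single a 1)) ∈ N := by
  rw [euler_single, Polynomial.sum, map_sum]
  exact N.sum_mem fun i _ => by rw [map_smul]; exact N.smul_mem _ (h i)

open Classical in
lemma sum_update_eq {x : P} {a : Point C} (h : a x = 1) {A : Type*} [AddCommMonoid A]
    (f : Point C → A) : ∑ b : C x, f (a.update x (b : WithZero (C x))) =
      f a + ∑ c : {c : C x // c ≠ 1}, f (a.update x (c.1 : WithZero (C x))) := by
  rw [← Finset.add_sum_erase _ _ (Finset.mem_univ 1)]
  congr 1
  · exact congrArg f (update_of_eq h)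
  · exact Finset.sum_subtype _ (by simp) _

open Classical in
/-- The rewriting rule: the relation at `x` for the point without `x` expresses a point with trivial
component at `x` by points with fewer primes and by points with nontrivial component at `x`. -/
lemma single_eq_of_apply_eq_one {x : P} {a : Point C} (h : a x = 1) :
    (Finsupp.single a 1 : Point C →₀ R) = E.euler x (Finsupp.single (a.update x 0) 1) -
      E.relation x (a.update x 0) -
      ∑ c : {c : C x // c ≠ 1}, Finsupp.single (a.update x (c.1 : WithZero (C x))) 1 := by
  have := sum_update_eq h fun b => (Finsupp.single b 1 : Point C →₀ R)
  simp only [relation, update_update, this]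
  abel

/-- A point is congruent to its normal form. -/
lemma single_sub_normalForm_mem (a : Point C) :
    Finsupp.single a 1 - E.normalForm Y a ∈ E.relations Y := by
  classical
  refine rewriting_induction (Y := Y)
    (motive := fun a => Finsupp.single a 1 - E.normalForm Y a ∈ E.relations Y) ?_ a
  intro a ih ih'
  by_cases h : bad Y a = ∅
  · rw [normalForm_of_bad_eq_empty E h, sub_self]
    exact zero_mem _
  · obtain ⟨x, hx⟩ := exists_isLeast_bad h
    have hax : a x ≠ 0 := by rw [hx.1.2]; exact one_ne_zero
    rw [normalForm_of_isLeast E hx, E.single_eq_of_apply_eq_one hx.1.2]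
    have h1 : (LinearMap.id - E.normalize Y : (Point C →₀ R) →ₗ[R] (Point C →₀ R))
        (E.euler x (Finsupp.single (a.update x 0) 1)) ∈ E.relations Y := E.euler_single_mem _ fun i => by
      rw [LinearMap.sub_apply, normalize_single, one_smul]
      exact ih _ ((size_shift _ _).trans_lt (size_update_zero_lt hax))
    have h2 : E.relation x (a.update x 0) ∈ E.relations Y :=
      Submodule.subset_span ⟨x, hx.1.1, _, update_apply_same _ _ _, rfl⟩
    have h3 : ∑ c : {c : C x // c ≠ 1}, (Finsupp.single (a.update x (c.1 : WithZero (C x))) 1 -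
        E.normalForm Y (a.update x (c.1 : WithZero (C x)))) ∈ E.relations Y :=
      Submodule.sum_mem _ fun c _ => ih' x hx.1 c.1 c.2
    rw [Finset.sum_sub_distrib] at h3
    convert sub_mem (sub_mem h1 h2) h3 using 1
    rw [LinearMap.sub_apply, LinearMap.id_apply]
    abel

/-- The normal form of a point in a set stable under the rewriting rules is a combination of points
in that set without bad primes. -/
lemma normalForm_mem_span {T : Set (Point C)} (htr : ∀ a ∈ T, ∀ g, shift g a ∈ T)
    (hz : ∀ a ∈ T, ∀ x ∈ Y, a.update x 0 ∈ T)
    (hu : ∀ a ∈ T, ∀ x ∈ Y, a x ≠ 0 → ∀ c : C x, a.update x (c : WithZero (C x)) ∈ T)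
    (a : Point C) (ha : a ∈ T) : E.normalForm Y a ∈ Submodule.span R
      {m | ∃ b ∈ T, bad Y b = ∅ ∧ Finsupp.single b 1 = m} := by
  classical
  revert ha
  refine rewriting_induction (Y := Y) (motive := fun a => a ∈ T → E.normalForm Y a ∈ Submodule.span R
    {m | ∃ b ∈ T, bad Y b = ∅ ∧ Finsupp.single b 1 = m}) ?_ a
  intro a ih ih' ha
  by_cases h : bad Y a = ∅
  · rw [normalForm_of_bad_eq_empty E h]
    exact Submodule.subset_span ⟨a, ha, h, rfl⟩
  · obtain ⟨x, hx⟩ := exists_isLeast_bad h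
    have hax : a x ≠ 0 := by rw [hx.1.2]; exact one_ne_zero
    rw [normalForm_of_isLeast E hx]
    refine sub_mem (E.euler_single_mem _ fun i => ?_) (Submodule.sum_mem _ fun c _ => ?_)
    · rw [normalize_single, one_smul]
      exact ih _ ((size_shift _ _).trans_lt (size_update_zero_lt hax))
        (htr _ (hz _ ha _ hx.1.1) _)
    · exact ih' x hx.1 c.1 c.2 (hu _ ha _ hx.1.1 hax _)

variable {Y}

/-- A relation at the prime at which the normal form starts to rewrite is sent to zero by the
definition of the normal form. -/
lemma normalize_relation_of_isLeast {x : P} {d : Point C} (hd : d x = 0)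
    (h : IsLeast (bad Y (d.update x 1)) x) : E.normalize Y (E.relation x d) = 0 := by
  classical
  have h1 := E.normalForm_of_isLeast h
  have h2 := sum_update_eq (update_apply_same d x 1) (E.normalForm Y)
  simp only [update_update, update_of_eq hd] at h1 h2
  rw [relation, map_sub, map_sum]
  simp only [normalize_single, one_smul, h2, h1]
  abel

/-- The rewriting rules are confluent: normalization kills the relation at every prime `y ∈ Y`, not
only at the one that the normal form uses. If the normal form of `a` starts at a prime `x < y`, the
point `a` is rewritten by the relation at `x`; since the operators `relator x` and `relator y`
commute, this leads to relations at `y` for smaller points and to relations at `x` which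
`normalize_relation_of_isLeast` covers. -/
lemma normalize_relation (a : Point C) :
    ∀ y ∈ Y, a y = 0 → E.normalize Y (E.relation y a) = 0 := by
  classical
  refine rewriting_induction (Y := Y)
    (motive := fun a => ∀ y ∈ Y, a y = 0 → E.normalize Y (E.relation y a) = 0) ?_ a
  intro a ih ih' y hy hay
  by_cases h : ∃ x, IsLeast (bad Y a) x ∧ x < y
  · obtain ⟨x, hx, hxy⟩ := h
    have hax : a x ≠ 0 := by rw [hx.1.2]; exact one_ne_zero
    have hay' : a.update x 0 y = 0 := (update_apply_of_ne a hxy.ne' 0).trans hay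
    -- an Euler factor at any prime turns `a` without `x` into points with fewer primes than `a`
    have key : ∀ v ∈ Y, ∀ w, a.update x 0 v = 0 →
        E.normalize Y (E.relator v (E.euler w (Finsupp.single (a.update x 0) 1))) =
          0 := fun v hv w hav => by
      refine (Submodule.mem_bot R).1 (E.euler_single_mem
        (E.normalize Y ∘ₗ E.relator v) fun i => (Submodule.mem_bot R).2 ?_)
      rw [LinearMap.comp_apply, ← relation_eq]
      exact ih _ ((size_shift _ _).trans_lt (size_update_zero_lt hax)) v hv
        (shift_apply_eq_zero.2 hav)
    rw [relation_eq, E.single_eq_of_apply_eq_one hx.1.2, map_sub, map_sub, map_sub, map_sub,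
      key y hy x hay', zero_sub, map_sum, map_sum, Finset.sum_eq_zero, sub_zero, neg_eq_zero]
    · -- the two relations are interchanged
      have hcomm : E.relator y (E.relator x (Finsupp.single (a.update x 0) 1)) =
          E.relator x (E.relator y (Finsupp.single (a.update x 0) 1)) :=
        LinearMap.congr_fun (E.commute_relator hxy.ne').eq _
      rw [relation_eq, hcomm, ← relation_eq, relation, map_sub, map_sub,
        key x hx.1.1 y (update_apply_same _ _ _), zero_sub, neg_eq_zero, map_sum, map_sum]
      refine Finset.sum_eq_zero fun b _ => ?_
      rw [← relation_eq]
      have hd : (a.update x 0).update y (b : WithZero (C y)) x = 0 := by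
        rw [update_apply_of_ne _ hxy.ne, update_apply_same]
      refine E.normalize_relation_of_isLeast hd ⟨⟨hx.1.1, update_apply_same _ _ _⟩, ?_⟩
      rintro z ⟨hzY, hz⟩
      by_cases hzx : z = x
      · exact hzx.ge
      rw [update_apply_of_ne _ hzx] at hz
      by_cases hzy : z = y
      · exact hzy ▸ hxy.le
      rw [update_apply_of_ne _ hzy, update_apply_of_ne _ hzx] at hz
      exact hx.2 ⟨hzY, hz⟩
    · intro c _
      rw [← relation_eq]
      exact ih' x hx.1 c.1 c.2 y hy ((update_apply_of_ne a hxy.ne' _).trans hay)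
  · refine E.normalize_relation_of_isLeast hay ⟨⟨hy, update_apply_same _ _ _⟩, ?_⟩
    rintro z ⟨hzY, hz⟩
    by_cases hzy : z = y
    · exact hzy.ge
    rw [update_apply_of_ne _ hzy] at hz
    have hne : bad Y a ≠ ∅ := Set.nonempty_iff_ne_empty.1 ⟨z, hzY, hz⟩
    obtain ⟨x, hx⟩ := exists_isLeast_bad hne
    exact (not_lt.1 fun hxy => h ⟨x, hx, hxy⟩).trans (hx.2 ⟨hzY, hz⟩)

variable (Y)

/-- The free module on the points modulo the relations at the primes of `Y`. -/
abbrev Quot : Type _ := (Point C →₀ R) ⧸ E.relations Y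

/-- The class of a point. -/
noncomputable def cls (a : Point C) : E.Quot Y := (E.relations Y).mkQ (Finsupp.single a 1)

/-- The normal form of an element of the quotient, a section of the projection. It identifies the
quotient with the free module on the points without bad primes. -/
noncomputable def normalLift : E.Quot Y →ₗ[R] (Point C →₀ R) :=
  (E.relations Y).liftQ (E.normalize Y) <| by
    rw [relations, Submodule.span_le]
    rintro _ ⟨x, hx, a, hax, rfl⟩
    exact E.normalize_relation a x hx hax

lemma normalLift_cls (a : Point C) : E.normalLift Y (E.cls Y a) = E.normalForm Y a := by
  rw [cls, normalLift, Submodule.mkQ_apply, Submodule.liftQ_apply, normalize_single, one_smul]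

lemma mkQ_normalForm (a : Point C) : (E.relations Y).mkQ (E.normalForm Y a) = E.cls Y a :=
  ((Submodule.Quotient.eq _).2 (E.single_sub_normalForm_mem Y a)).symm

lemma normalLift_injective : Function.Injective (E.normalLift Y) := by
  refine Function.LeftInverse.injective (g := (E.relations Y).mkQ) fun m => ?_
  obtain ⟨m, rfl⟩ := Submodule.Quotient.mk_surjective _ m
  induction m using Finsupp.induction_linear with
  | zero => simp
  | add m n hm hn => rw [Submodule.Quotient.mk_add, map_add, map_add, hm, hn]
  | single a r =>
    rw [← mul_one r, ← smul_eq_mul, ← Finsupp.smul_single, Submodule.Quotient.mk_smul, map_smul,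
      map_smul]
    congr 1
    exact (congrArg _ (E.normalLift_cls Y a)).trans (E.mkQ_normalForm Y a)

end EulerData

/-! ### Operators on the points modulo relations -/

namespace EulerData

variable {P : Type*} [LinearOrder P] {C : P → Type*} [∀ x, CommGroup (C x)] [∀ x, Fintype (C x)]
  {R : Type*} [CommRing R] (E : EulerData C R) {Y : Set P}

lemma relator_pointRep (x : P) (g : ∀ x, C x) :
    Commute (pointRep C R g) (E.relator x) := by
  refine LinearMap.ext fun v => ?_
  have e1 : E.euler x (pointRep C R g v) = pointRep C R g (E.euler x v) :=
    LinearMap.congr_fun (E.commute_euler_pointRep x g).eq v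
  have e2 : pointRep C R g (creation x v) = creation x (pointRep C R g v) :=
    LinearMap.congr_fun (commute_pointRep_creation g x).eq v
  simp only [Module.End.mul_apply, relator, LinearMap.sub_apply, map_sub, e1, e2]

lemma relation_mem {y : P} (hy : y ∈ Y) {a : Point C} (ha : a y = 0) :
    E.relation y a ∈ E.relations Y :=
  Submodule.subset_span ⟨y, hy, a, ha, rfl⟩

lemma relator_mem {y : P} (hy : y ∈ Y) {m : Point C →₀ R}
    (hm : m ∈ Submodule.span R {m | ∃ a : Point C, a y = 0 ∧ Finsupp.single a 1 = m}) :
    E.relator y m ∈ E.relations Y := by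
  induction hm using Submodule.span_induction with
  | mem m h => obtain ⟨a, ha, rfl⟩ := h; rw [← relation_eq]; exact E.relation_mem hy ha
  | zero => rw [map_zero]; exact zero_mem _
  | add m n _ _ hm hn => rw [map_add]; exact add_mem hm hn
  | smul r m _ hm => rw [map_smul]; exact Submodule.smul_mem _ _ hm

/-- Operators on points which commute with the distribution relations and preserve the absence of
each prime of `Y` descend to the quotient. -/
lemma relations_le_comap {f : Module.End R (Point C →₀ R)}
    (hc : ∀ y ∈ Y, Commute f (E.relator y))
    (hf : ∀ y ∈ Y, ∀ a : Point C, a y = 0 → f (Finsupp.single a 1) ∈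
      Submodule.span R {m | ∃ a : Point C, a y = 0 ∧ Finsupp.single a 1 = m}) :
    E.relations Y ≤ (E.relations Y).comap f := by
  rw [relations, Submodule.span_le]
  rintro _ ⟨y, hy, a, ha, rfl⟩
  have h : f (E.relator y (Finsupp.single a 1)) = E.relator y (f (Finsupp.single a 1)) :=
    LinearMap.congr_fun (hc y hy).eq _
  rw [SetLike.mem_coe, Submodule.mem_comap, relation_eq, h]
  exact E.relator_mem hy (hf y hy a ha)

variable (Y) in
/-- The representation of `∏ x, C x` on the quotient. -/
noncomputable def quotRep : Representation R (∀ x, C x) (E.Quot Y) :=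
  (pointRep C R).quotient (E.relations Y) fun g => E.relations_le_comap
    (fun y _ => E.relator_pointRep y g) fun y _ a ha => by
      rw [pointRep_single]
      exact Submodule.subset_span ⟨_, shift_apply_eq_zero.2 ha, rfl⟩

lemma quotRep_mkQ (g : ∀ x, C x) (m : Point C →₀ R) :
    E.quotRep Y g ((E.relations Y).mkQ m) = (E.relations Y).mkQ (pointRep C R g m) := rfl

lemma quotRep_cls (g : ∀ x, C x) (a : Point C) :
    E.quotRep Y g (E.cls Y a) = E.cls Y (shift g a) := by
  rw [cls, quotRep_mkQ, pointRep_single, cls]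

lemma quotRep_comm (g h : ∀ x, C x) (m : E.Quot Y) :
    E.quotRep Y g (E.quotRep Y h m) = E.quotRep Y h (E.quotRep Y g m) := by
  rw [← Module.End.mul_apply, ← map_mul, mul_comm, map_mul, Module.End.mul_apply]

lemma span_range_cls : Submodule.span R (Set.range (E.cls Y)) = ⊤ := by
  refine eq_top_iff.2 fun m _ => ?_
  obtain ⟨m, rfl⟩ := Submodule.mkQ_surjective _ m
  induction m using Finsupp.induction_linear with
  | zero => rw [map_zero]; exact zero_mem _
  | add m n hm hn => rw [map_add]; exact add_mem (hm trivial) (hn trivial)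
  | single a r =>
    rw [← mul_one r, ← smul_eq_mul, ← Finsupp.smul_single, map_smul]
    exact Submodule.smul_mem _ _ (Submodule.subset_span ⟨a, rfl⟩)

section Operators

variable {x : P} (hx : x ∉ Y)

lemma commute_relator_of_creation {f : Module.End R (Point C →₀ R)} (y : P)
    (h : ∀ g, Commute (pointRep C R g) f) (h' : Commute f (creation y)) :
    Commute f (E.relator y) := by
  refine LinearMap.ext fun v => ?_
  have e1 : E.euler y (f v) = f (E.euler y v) :=
    LinearMap.congr_fun (commute_aeval (h (E.frob y)) (E.poly y)).eq v
  have e2 : f (creation y v) = creation y (f v) := LinearMap.congr_fun h'.eq v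
  simp only [Module.End.mul_apply, relator, LinearMap.sub_apply, map_sub, e1, e2]

/-- The operator adding `x` in all possible ways, on the quotient by relations at other primes. -/
noncomputable def norm : E.Quot Y →ₗ[R] E.Quot Y :=
  (E.relations Y).mapQ (E.relations Y) (creation x) <| E.relations_le_comap
    (fun y hy => E.commute_relator_of_creation y (fun g => commute_pointRep_creation g x)
      (commute_creation (by rintro rfl; exact hx hy)))
    fun y hy a ha => by
      rw [creation_single]
      refine Submodule.sum_mem _ fun b _ => Submodule.subset_span ⟨_, ?_, rfl⟩
      rw [update_apply_of_ne _ (by rintro rfl; exact hx hy), ha]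

lemma norm_cls (a : Point C) : E.norm hx (E.cls Y a) =
    ∑ b : C x, E.cls Y (a.update x (b : WithZero (C x))) := by
  change (E.relations Y).mkQ (creation x (Finsupp.single a 1)) = _
  rw [creation_single, map_sum]
  rfl

open Classical in
/-- The operator keeping the points that involve `x` and killing the others. -/
noncomputable def presence (x : P) : Module.End R (Point C →₀ R) :=
  Finsupp.linearCombination R fun a : Point C => if a x = 0 then 0 else Finsupp.single a 1

open Classical in
lemma presence_single (a : Point C) : presence x (Finsupp.single a (1 : R)) =
    if a x = 0 then 0 else Finsupp.single a 1 := by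
  simp [presence]

/-- The operator removing `x` from the points that involve it and killing the others. -/
noncomputable def removal (x : P) : Module.End R (Point C →₀ R) :=
  Finsupp.lmapDomain R R (fun a : Point C => a.update x 0) * presence x

open Classical in
lemma removal_single (a : Point C) : removal x (Finsupp.single a (1 : R)) =
    if a x = 0 then 0 else Finsupp.single (a.update x 0) 1 := by
  rw [removal, Module.End.mul_apply, presence_single]
  split_ifs <;> simp

lemma commute_pointRep_presence (g : ∀ x, C x) (x : P) :
    Commute (pointRep C R g) (presence x) := by
  classical
  refine Finsupp.lhom_ext' fun a => LinearMap.ext_ring ?_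
  simp only [LinearMap.comp_apply, Finsupp.lsingle_apply, Module.End.mul_apply, presence_single,
    pointRep_single, shift_apply_eq_zero]
  split_ifs
  · rw [map_zero]
  · rw [pointRep_single]

lemma commute_presence_creation {y : P} (h : x ≠ y) :
    Commute (presence x : Module.End R (Point C →₀ R)) (creation y) := by
  classical
  refine Finsupp.lhom_ext' fun a => LinearMap.ext_ring ?_
  simp only [LinearMap.comp_apply, Finsupp.lsingle_apply, Module.End.mul_apply, presence_single,
    creation_single, map_sum, update_apply_of_ne _ h]
  split_ifs
  · simp
  · rw [creation_single]

lemma commute_pointRep_removal (g : ∀ x, C x) (x : P) :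
    Commute (pointRep C R g) (removal x) := by
  classical
  refine Finsupp.lhom_ext' fun a => LinearMap.ext_ring ?_
  simp only [LinearMap.comp_apply, Finsupp.lsingle_apply, Module.End.mul_apply, removal_single,
    pointRep_single, shift_apply_eq_zero]
  split_ifs
  · rw [map_zero]
  · rw [pointRep_single, shift_update, mul_zero]

lemma commute_removal_creation {y : P} (h : x ≠ y) :
    Commute (removal x : Module.End R (Point C →₀ R)) (creation y) := by
  classical
  refine Finsupp.lhom_ext' fun a => LinearMap.ext_ring ?_
  simp only [LinearMap.comp_apply, Finsupp.lsingle_apply, Module.End.mul_apply, removal_single,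
    creation_single, map_sum, update_apply_of_ne _ h]
  split_ifs
  · simp
  · rw [creation_single]
    simp only [update_comm _ h]

/-- The operator `presence` on the quotient by relations at other primes. -/
noncomputable def present : E.Quot Y →ₗ[R] E.Quot Y :=
  (E.relations Y).mapQ (E.relations Y) (presence x) <| E.relations_le_comap
    (fun y hy => E.commute_relator_of_creation y (fun g => commute_pointRep_presence g x)
      (commute_presence_creation (by rintro rfl; exact hx hy)))
    fun y hy a ha => by
      classical
      rw [presence_single]
      split_ifs
      · exact zero_mem _
      · exact Submodule.subset_span ⟨_, ha, rfl⟩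

/-- The operator `removal` on the quotient by relations at other primes. -/
noncomputable def remove : E.Quot Y →ₗ[R] E.Quot Y :=
  (E.relations Y).mapQ (E.relations Y) (removal x) <| E.relations_le_comap
    (fun y hy => E.commute_relator_of_creation y (fun g => commute_pointRep_removal g x)
      (commute_removal_creation (by rintro rfl; exact hx hy)))
    fun y hy a ha => by
      classical
      rw [removal_single]
      split_ifs
      · exact zero_mem _
      · refine Submodule.subset_span ⟨_, ?_, rfl⟩
        rw [update_apply_of_ne _ (by rintro rfl; exact hx hy), ha]

lemma remove_cls {a : Point C} (ha : a x ≠ 0) :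
    E.remove hx (E.cls Y a) = E.cls Y (a.update x 0) := by
  classical
  change (E.relations Y).mkQ (removal x (Finsupp.single a 1)) = _
  rw [removal_single, if_neg ha]
  rfl

lemma present_cls {a : Point C} (ha : a x ≠ 0) : E.present hx (E.cls Y a) = E.cls Y a := by
  classical
  change (E.relations Y).mkQ (presence x (Finsupp.single a 1)) = _
  rw [presence_single, if_neg ha]
  rfl

lemma present_cls_of_eq_zero {a : Point C} (ha : a x = 0) : E.present hx (E.cls Y a) = 0 := by
  classical
  change (E.relations Y).mkQ (presence x (Finsupp.single a 1)) = _
  rw [presence_single, if_pos ha, map_zero]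

lemma norm_quotRep (g : ∀ x, C x) (m : E.Quot Y) :
    E.norm hx (E.quotRep Y g m) = E.quotRep Y g (E.norm hx m) := by
  obtain ⟨m, rfl⟩ := Submodule.mkQ_surjective _ m
  exact congrArg (E.relations Y).mkQ
    (LinearMap.congr_fun (commute_pointRep_creation g x).eq m).symm

lemma remove_quotRep (g : ∀ x, C x) (m : E.Quot Y) :
    E.remove hx (E.quotRep Y g m) = E.quotRep Y g (E.remove hx m) := by
  obtain ⟨m, rfl⟩ := Submodule.mkQ_surjective _ m
  exact congrArg (E.relations Y).mkQ
    (LinearMap.congr_fun (commute_pointRep_removal g x).eq m).symm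

lemma present_quotRep (g : ∀ x, C x) (m : E.Quot Y) :
    E.present hx (E.quotRep Y g m) = E.quotRep Y g (E.present hx m) := by
  obtain ⟨m, rfl⟩ := Submodule.mkQ_surjective _ m
  exact congrArg (E.relations Y).mkQ
    (LinearMap.congr_fun (commute_pointRep_presence g x).eq m).symm

open Classical in
/-- The projection to the points with trivial component at `x`, in the basis of normal forms. As `x
∉ Y` in the applications, having trivial component at `x` does not conflict with being a normal
form. -/
noncomputable def unitPart (Y : Set P) (x : P) : E.Quot Y →ₗ[R] E.Quot Y :=
  (E.relations Y).mkQ ∘ₗ (Finsupp.linearCombination R fun a : Point C =>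
    if a x = 1 then Finsupp.single a 1 else 0) ∘ₗ E.normalLift Y

open Classical in
lemma unitPart_cls {a : Point C} (ha : bad Y a = ∅) :
    E.unitPart Y x (E.cls Y a) = if a x = 1 then E.cls Y a else 0 := by
  rw [unitPart, LinearMap.comp_apply, LinearMap.comp_apply, normalLift_cls,
    normalForm_of_bad_eq_empty E ha, Finsupp.linearCombination_single, one_smul]
  split_ifs
  · rfl
  · rw [map_zero]

/-- The natural map between quotients by more and more relations. -/
noncomputable def quotMap {Y Y' : Set P} (h : Y ⊆ Y') : E.Quot Y →ₗ[R] E.Quot Y' :=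
  Submodule.factor (Submodule.span_mono fun _ ⟨x, hx, ha⟩ => ⟨x, h hx, ha⟩)

lemma quotMap_mkQ {Y Y' : Set P} (h : Y ⊆ Y') (m : Point C →₀ R) :
    E.quotMap h ((E.relations Y).mkQ m) = (E.relations Y').mkQ m := rfl

lemma quotMap_cls {Y Y' : Set P} (h : Y ⊆ Y') (a : Point C) :
    E.quotMap h (E.cls Y a) = E.cls Y' a := rfl

lemma quotMap_quotRep {Y Y' : Set P} (h : Y ⊆ Y') (g : ∀ x, C x) (m : E.Quot Y) :
    E.quotMap h (E.quotRep Y g m) = E.quotRep Y' g (E.quotMap h m) := by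
  obtain ⟨m, rfl⟩ := Submodule.mkQ_surjective _ m
  rfl

end Operators

section Subspaces

/-- A set of points is admissible if it is stable under translation and under the rewriting rules
at the primes of `Y`. -/
structure Admissible (Y : Set P) (T : Set (Point C)) : Prop where
  shift : ∀ a ∈ T, ∀ g, shift g a ∈ T
  update_zero : ∀ a ∈ T, ∀ x ∈ Y, a.update x 0 ∈ T
  update : ∀ a ∈ T, ∀ x ∈ Y, a x ≠ 0 → ∀ c : C x, a.update x (c : WithZero (C x)) ∈ T

variable (Y) in
/-- The span of the classes of the points in `T`. -/
noncomputable def spanOf (T : Set (Point C)) : Submodule R (E.Quot Y) :=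
  Submodule.span R (E.cls Y '' T)

lemma cls_mem_spanOf {T : Set (Point C)} {a : Point C} (ha : a ∈ T) : E.cls Y a ∈ E.spanOf Y T :=
  Submodule.subset_span ⟨a, ha, rfl⟩

lemma spanOf_le {T : Set (Point C)} {N : Submodule R (E.Quot Y)} (h : ∀ a ∈ T, E.cls Y a ∈ N) :
    E.spanOf Y T ≤ N := by
  rw [spanOf, Submodule.span_le]
  rintro _ ⟨a, ha, rfl⟩
  exact h a ha

/-- The span of an admissible set is spanned by its points in normal form. -/
lemma spanOf_eq {T : Set (Point C)} (hT : Admissible Y T) :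
    E.spanOf Y T = E.spanOf Y {a ∈ T | bad Y a = ∅} := by
  refine le_antisymm (E.spanOf_le fun a ha => ?_) (Submodule.span_mono (Set.image_mono fun _ h => h.1))
  rw [← mkQ_normalForm]
  have h := Submodule.mem_map_of_mem (f := (E.relations Y).mkQ)
    (E.normalForm_mem_span Y hT.shift hT.update_zero hT.update a ha)
  rw [Submodule.map_span] at h
  refine Submodule.span_mono ?_ h
  rintro _ ⟨_, ⟨b, hb, hb', rfl⟩, rfl⟩
  exact ⟨b, ⟨hb, hb'⟩, rfl⟩

lemma eqOn_spanOf {A : Type*} [AddCommGroup A] [Module R A] {f g : E.Quot Y →ₗ[R] A}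
    {T : Set (Point C)} (h : ∀ a ∈ T, f (E.cls Y a) = g (E.cls Y a)) {m : E.Quot Y}
    (hm : m ∈ E.spanOf Y T) : f m = g m := by
  refine LinearMap.eqOn_span (s := E.cls Y '' T) ?_ hm
  rintro _ ⟨a, ha, rfl⟩
  exact h a ha

/-- To compare linear maps on the span of an admissible set, it suffices to look at the points in
normal form. -/
lemma eqOn_spanOf_normal {A : Type*} [AddCommGroup A] [Module R A] {f g : E.Quot Y →ₗ[R] A}
    {T : Set (Point C)} (hT : Admissible Y T)
    (h : ∀ a ∈ T, bad Y a = ∅ → f (E.cls Y a) = g (E.cls Y a)) {m : E.Quot Y}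
    (hm : m ∈ E.spanOf Y T) : f m = g m :=
  E.eqOn_spanOf (fun a ha => h a ha.1 ha.2) (E.spanOf_eq hT ▸ hm)

lemma spanOf_le_comap {T : Set (Point C)} (hT : ∀ a ∈ T, ∀ g, shift g a ∈ T) (g : ∀ x, C x) :
    E.spanOf Y T ≤ (E.spanOf Y T).comap (E.quotRep Y g) :=
  E.spanOf_le fun a ha => by
    rw [Submodule.mem_comap, quotRep_cls]
    exact E.cls_mem_spanOf (hT a ha g)

/-- The points that involve primes in `Q` only. -/
def within (Q : Set P) : Set (Point C) := {a | ∀ x, a x ≠ 0 → x ∈ Q}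

lemma update_mem_within {Q : Set P} {a : Point C} (ha : a ∈ within Q) {x : P} (hx : x ∈ Q)
    (c : WithZero (C x)) : a.update x c ∈ within Q := fun y hy => by
  by_cases h : y = x
  · exact h ▸ hx
  · exact ha y (by rwa [update_apply_of_ne _ h] at hy)

lemma shift_mem_within {Q : Set P} {a : Point C} (ha : a ∈ within Q) (g : ∀ x, C x) :
    shift g a ∈ within Q := fun y hy => ha y fun h => hy (shift_apply_eq_zero.2 h)

lemma admissible_within {Q : Set P} (h : Y ⊆ Q) : Admissible (C := C) Y (within Q) where
  shift _ ha g := shift_mem_within ha g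
  update_zero _ ha _ hx := update_mem_within ha (h hx) _
  update _ ha _ hx _ _ := update_mem_within ha (h hx) _

lemma within_mono {Q Q' : Set P} (h : Q ⊆ Q') : within (C := C) Q ⊆ within Q' :=
  fun _ ha x hx => h (ha x hx)

/-- The points that involve `x` and otherwise only primes in `Q`. -/
def throughPoints (Q : Set P) (x : P) : Set (Point C) := {a ∈ within (insert x Q) | a x ≠ 0}

lemma admissible_throughPoints {x : P} (hx : x ∉ Y) :
    Admissible (C := C) Y (throughPoints Y x) where
  shift _ ha g := ⟨shift_mem_within ha.1 g, fun h => ha.2 (shift_apply_eq_zero.1 h)⟩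
  update_zero _ ha y hy := ⟨update_mem_within ha.1 (Or.inr hy) _, by
    rw [update_apply_of_ne _ (by rintro rfl; exact hx hy)]
    exact ha.2⟩
  update _ ha y hy _ _ := ⟨update_mem_within ha.1 (Or.inr hy) _, by
    rw [update_apply_of_ne _ (by rintro rfl; exact hx hy)]
    exact ha.2⟩

end Subspaces

section Step

variable {x : P} (hx : x ∉ Y)

lemma apply_eq_zero_of_within {a : Point C} (ha : a ∈ within Y) (hx : x ∉ Y) : a x = 0 :=
  not_not.1 fun h => hx (ha x h)

lemma update_mem_throughPoints {a : Point C} (ha : a ∈ within Y) (x : P) (c : C x) :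
    a.update x (c : WithZero (C x)) ∈ throughPoints Y x :=
  ⟨update_mem_within (within_mono (Set.subset_insert _ _) ha) (Set.mem_insert _ _) _, by
    rw [update_apply_same]; exact WithZero.coe_ne_zero⟩

lemma update_zero_mem_within {a : Point C} (ha : a ∈ throughPoints Y x) :
    a.update x 0 ∈ within Y := fun y hy => by
  by_cases h : y = x
  · subst h; exact absurd (update_apply_same _ _ _) hy
  · rw [update_apply_of_ne _ h] at hy
    exact (ha.1 y hy).resolve_left h

lemma norm_mem {m : E.Quot Y} (hm : m ∈ E.spanOf Y (within Y)) :
    E.norm hx m ∈ E.spanOf Y (throughPoints Y x) := by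
  refine (E.spanOf_le (N := (E.spanOf Y _).comap (E.norm hx)) fun a ha => ?_) hm
  rw [Submodule.mem_comap, norm_cls]
  exact Submodule.sum_mem _ fun b _ => E.cls_mem_spanOf (update_mem_throughPoints ha x b)

lemma remove_mem {m : E.Quot Y} (hm : m ∈ E.spanOf Y (throughPoints Y x)) :
    E.remove hx m ∈ E.spanOf Y (within Y) := by
  refine (E.spanOf_le (N := (E.spanOf Y _).comap (E.remove hx)) fun a ha => ?_) hm
  rw [Submodule.mem_comap, remove_cls E hx ha.2]
  exact E.cls_mem_spanOf (update_zero_mem_within ha)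

include hx in
lemma unitPart_mem {m : E.Quot Y} (hm : m ∈ E.spanOf Y (throughPoints Y x)) :
    E.unitPart Y x m ∈ E.spanOf Y (throughPoints Y x) := by
  classical
  rw [E.spanOf_eq (admissible_throughPoints hx)] at hm
  refine (E.spanOf_le (N := (E.spanOf Y _).comap (E.unitPart Y x)) fun a ha => ?_) hm
  rw [Submodule.mem_comap, unitPart_cls E ha.2]
  split_ifs
  · exact E.cls_mem_spanOf ha.1
  · exact zero_mem _

lemma shift_mulSingle_of_ne {a : Point C} {b : C x} (h : a x = b) (c : C x) :
    shift (Pi.mulSingle x c) a = a.update x ((c * b : C x) : WithZero (C x)) := by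
  ext y : 1
  by_cases hy : y = x
  · subst hy
    rw [update_apply_same, shift_apply, h, Pi.mulSingle_eq_same, WithZero.coe_mul]
  · rw [update_apply_of_ne _ hy, shift_apply, Pi.mulSingle_eq_of_ne hy, WithZero.coe_one,
      one_mul]

lemma shift_eq_of_forall {a : Point C} {g h : ∀ x, C x} (hgh : ∀ x, a x ≠ 0 → g x = h x) :
    shift g a = shift h a := by
  ext y : 1
  by_cases hy : a y = 0
  · rw [shift_apply, shift_apply, hy, mul_zero, mul_zero]
  · rw [shift_apply, shift_apply, hgh y hy]

/-- The trace over `C x` on the points through `x` is removing `x` and adding it back in all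
possible ways. -/
lemma sum_quotRep_mulSingle {m : E.Quot Y} (hm : m ∈ E.spanOf Y (throughPoints Y x)) :
    ∑ c : C x, E.quotRep Y (Pi.mulSingle x c) m = E.norm hx (E.remove hx m) := by
  have := E.eqOn_spanOf (f := ∑ c : C x, E.quotRep Y (Pi.mulSingle x c))
    (g := E.norm hx ∘ₗ E.remove hx) (fun a ha => ?_) hm
  · rwa [LinearMap.sum_apply] at this
  obtain ⟨b, hb⟩ := WithZero.ne_zero_iff_exists.1 ha.2
  rw [LinearMap.sum_apply, LinearMap.comp_apply, remove_cls E hx ha.2, norm_cls]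
  simp only [quotRep_cls, shift_mulSingle_of_ne hb.symm, update_update]
  exact Fintype.sum_equiv (Equiv.mulRight b) _ _ fun c => rfl

/-- Adding `x` in all possible ways and removing it multiplies by the order of `C x`. -/
lemma remove_norm {m : E.Quot Y} (hm : m ∈ E.spanOf Y (within Y)) :
    E.remove hx (E.norm hx m) = (Fintype.card (C x) : R) • m := by
  refine E.eqOn_spanOf (f := E.remove hx ∘ₗ E.norm hx)
    (g := (Fintype.card (C x) : R) • LinearMap.id) (fun a ha => ?_) hm
  rw [LinearMap.comp_apply, norm_cls, map_sum]
  have h0 := apply_eq_zero_of_within ha hx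
  have : ∀ b : C x, E.remove hx (E.cls Y (a.update x (b : WithZero (C x)))) = E.cls Y a := fun b => by
    rw [remove_cls E hx (by rw [update_apply_same]; exact WithZero.coe_ne_zero), update_update,
      update_of_eq h0]
  simp only [this, Finset.sum_const, Finset.card_univ, LinearMap.smul_apply, LinearMap.id_apply,
    Nat.cast_smul_eq_nsmul]

lemma bad_eq_empty_of_eq {a b : Point C} (h : bad Y a = ∅) (hab : ∀ y ∈ Y, b y = 1 → a y = 1) :
    bad Y b = ∅ :=
  Set.eq_empty_of_forall_notMem fun y hy => (h.le ⟨hy.1, hab y hy.1 hy.2⟩ : y ∈ (∅ : Set P))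

include hx in
/-- The identity is the trace of the projection `unitPart`. -/
lemma sum_unitPart {m : E.Quot Y} (hm : m ∈ E.spanOf Y (throughPoints Y x)) :
    ∑ c : C x, E.quotRep Y (Pi.mulSingle x c)
      (E.unitPart Y x (E.quotRep Y (Pi.mulSingle x c)⁻¹ m)) = m := by
  classical
  have := E.eqOn_spanOf_normal (f := ∑ c : C x, E.quotRep Y (Pi.mulSingle x c) ∘ₗ
    E.unitPart Y x ∘ₗ E.quotRep Y (Pi.mulSingle x c)⁻¹) (g := LinearMap.id)
    (admissible_throughPoints hx) (fun a ha ha' => ?_) hm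
  · simpa only [LinearMap.sum_apply, LinearMap.comp_apply, LinearMap.id_apply] using this
  obtain ⟨b, hb⟩ := WithZero.ne_zero_iff_exists.1 ha.2
  simp only [LinearMap.sum_apply, LinearMap.comp_apply, LinearMap.id_apply]
  have key : ∀ c : C x, E.unitPart Y x (E.quotRep Y (Pi.mulSingle x c)⁻¹ (E.cls Y a)) =
      if c = b then E.quotRep Y (Pi.mulSingle x c)⁻¹ (E.cls Y a) else 0 := fun c => by
    rw [quotRep_cls, unitPart_cls]
    · refine if_congr ?_ rfl rfl
      rw [shift_apply, ← hb, ← WithZero.coe_mul, ← WithZero.coe_one, WithZero.coe_inj,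
        Pi.inv_apply, Pi.mulSingle_eq_same, inv_mul_eq_one]
    · refine bad_eq_empty_of_eq ha' fun y hy h => ?_
      rwa [shift_apply, Pi.inv_apply, Pi.mulSingle_eq_of_ne (by rintro rfl; exact hx hy),
        inv_one, WithZero.coe_one, one_mul] at h
  simp only [key, apply_ite, map_zero, Finset.sum_ite_eq', Finset.mem_univ, if_true]
  rw [quotRep_cls, quotRep_cls, ← shift_mul, mul_inv_cancel, shift_one]

/-- The norm to the points through `x` is injective, with an explicit retraction. -/
lemma remove_unitPart_norm {m : E.Quot Y} (hm : m ∈ E.spanOf Y (within Y)) :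
    E.remove hx (E.unitPart Y x (E.norm hx m)) = m := by
  classical
  refine E.eqOn_spanOf_normal (f := E.remove hx ∘ₗ E.unitPart Y x ∘ₗ E.norm hx)
    (g := LinearMap.id) (admissible_within le_rfl) (fun a ha ha' => ?_) hm
  have h0 := apply_eq_zero_of_within ha hx
  have hb : ∀ b : C x, bad Y (a.update x (b : WithZero (C x))) = ∅ := fun b =>
    bad_eq_empty_of_eq ha' fun y hy h => by
      rwa [update_apply_of_ne _ (by rintro rfl; exact hx hy)] at h
  rw [LinearMap.comp_apply, LinearMap.comp_apply, LinearMap.id_apply, norm_cls, map_sum]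
  simp only [fun b => unitPart_cls E (x := x) (hb b), update_apply_same]
  rw [Finset.sum_eq_single 1, if_pos WithZero.coe_one, remove_cls, update_update, update_of_eq h0]
  · rw [update_apply_same]; exact WithZero.coe_ne_zero
  · intro b _ h
    exact if_neg fun h' => h (WithZero.coe_inj.1 h')
  · simp

/-- Relations at further primes identify no elements supported on the old primes: normal forms of
points within `Y` remain normal forms for `Y'`. -/
lemma quotMap_injOn {Y Y' : Set P} (h : Y ⊆ Y') {m : E.Quot Y} (hm : m ∈ E.spanOf Y (within Y))
    (h0 : E.quotMap h m = 0) : m = 0 := by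
  have := E.eqOn_spanOf_normal (f := E.normalLift Y' ∘ₗ E.quotMap h)
    (g := E.normalLift Y) (admissible_within le_rfl) (fun a ha ha' => ?_) hm
  · refine E.normalLift_injective Y ?_
    rw [← this, LinearMap.comp_apply, h0, map_zero, map_zero]
  · rw [LinearMap.comp_apply, quotMap_cls, normalLift_cls, normalLift_cls,
      normalForm_of_bad_eq_empty E ha', normalForm_of_bad_eq_empty]
    refine Set.eq_empty_of_forall_notMem fun y hy => ?_
    refine (ha'.le ⟨ha y ?_, hy.2⟩ : y ∈ (∅ : Set P))
    rw [hy.2]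
    exact one_ne_zero

end Step

end EulerData

/-! ### Representations of products of groups -/

open DiscreteCohomology

universe a b c

namespace EulerData

section Restriction

variable {P : Type*} {C : P → Type*} [∀ x, Group (C x)]

open Classical in
/-- Extension by `1` of a family of group elements indexed by the primes of `Q`. -/
noncomputable def extend (Q : Set P) : (∀ x : Q, C x) →* ∀ x, C x where
  toFun g x := if h : x ∈ Q then g ⟨x, h⟩ else 1
  map_one' := by ext x; simp
  map_mul' g h := by ext x; by_cases hx : x ∈ Q <;> simp [hx]

lemma extend_apply {Q : Set P} (g : ∀ x : Q, C x) {x : P} (hx : x ∈ Q) :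
    extend Q g x = g ⟨x, hx⟩ := dif_pos hx

lemma extend_apply_of_notMem {Q : Set P} (g : ∀ x : Q, C x) {x : P} (hx : x ∉ Q) :
    extend Q g x = 1 := dif_neg hx

lemma extend_mulSingle [DecidableEq P] {Q : Set P} (x : Q) (c : C x) :
    extend Q (Pi.mulSingle x c) = Pi.mulSingle x.1 c := by
  ext y
  by_cases hy : y ∈ Q
  · rw [extend_apply _ hy]
    by_cases h : y = x.1
    · obtain ⟨x, hx⟩ := x
      obtain rfl := h
      rw [Pi.mulSingle_eq_same, Pi.mulSingle_eq_same]
    · rw [Pi.mulSingle_eq_of_ne h, Pi.mulSingle_eq_of_ne fun h' => h (congrArg Subtype.val h')]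
  · rw [extend_apply_of_notMem _ hy, Pi.mulSingle_eq_of_ne]
    rintro rfl
    exact hy x.2

variable [∀ x, TopologicalSpace (C x)]

/-- The restriction map between products over sets of primes. -/
def restriction {Q Q' : Set P} (h : Q ⊆ Q') : (∀ x : Q', C x) →ₜ* (∀ x : Q, C x) where
  toFun g x := g ⟨x, h x.2⟩
  map_one' := rfl
  map_mul' _ _ := rfl
  continuous_toFun := continuous_pi fun _ => continuous_apply _

lemma restriction_surjective {Q Q' : Set P} (h : Q ⊆ Q') :
    Function.Surjective (restriction (C := C) h) := fun g =>
  ⟨fun x => extend Q g x, funext fun x => extend_apply g x.2⟩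

lemma isQuotientMap_restriction [∀ x, T2Space (C x)] [∀ x, CompactSpace (C x)] {Q Q' : Set P}
    (h : Q ⊆ Q') : Topology.IsQuotientMap (restriction (C := C) h) :=
  .of_surjective_continuous (restriction_surjective h) (restriction h).continuous_toFun

end Restriction

variable {P : Type a} [LinearOrder P] {C : P → Type b} [∀ x, CommGroup (C x)]
  [∀ x, Fintype (C x)] [∀ x, TopologicalSpace (C x)] [∀ x, DiscreteTopology (C x)]
  {R : Type c} [CommRing R] [TopologicalSpace R] [DiscreteTopology R] (E : EulerData C R)
  {Y : Set P}

/-- The orbit maps are continuous for the discrete topology, since a point involves finitely many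
primes only. -/
lemma isLocallyConstant_pointRep (m : Point C →₀ R) (A : Set P) :
    IsLocallyConstant fun g : ∀ x : A, C x => pointRep C R (extend A g) m := by
  induction m using Finsupp.induction_linear with
  | zero => simp_rw [map_zero]; exact IsLocallyConstant.const _
  | add m n hm hn => simp_rw [map_add]; exact hm.add hn
  | single d r =>
    simp_rw [pointRep_single]
    -- the translate of a point depends on finitely many coordinates only
    refine IsLocallyConstant.comp ?_ fun d : Point C => Finsupp.single d r
    refine (IsLocallyConstant.iff_exists_open _).2 fun g => ?_
    refine ⟨⋂ x ∈ {x : A | d x ≠ 0}, {h | h x = g x}, ?_, by simp, fun h hh => ?_⟩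
    · refine Set.Finite.isOpen_biInter
        ((finite_support d).preimage Subtype.val_injective.injOn) fun x _ => ?_
      have hc : Continuous fun h : (∀ x : A, C x) => h x := continuous_apply x
      exact hc.isOpen_preimage {g x} (isOpen_discrete _)
    · refine shift_eq_of_forall fun x hx => ?_
      by_cases hxA : x ∈ A
      · rw [extend_apply _ hxA, extend_apply _ hxA]
        exact Set.mem_iInter₂.1 hh ⟨x, hxA⟩ hx
      · rw [extend_apply_of_notMem _ hxA, extend_apply_of_notMem _ hxA]

/-- A stable submodule of the quotient as a discrete representation of the product of the groups at
the primes of `A`. -/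
noncomputable def subRep (N : Submodule R (E.Quot Y)) (hN : ∀ g, N ≤ N.comap (E.quotRep Y g))
    (A : Set P) : TopRep.{max (max a b) c} R (∀ x : A, C x) :=
  discreteRep (((E.quotRep Y).subrepresentation N hN).comp (extend A))

variable {N : Submodule R (E.Quot Y)} (hN : ∀ g, N ≤ N.comap (E.quotRep Y g)) (A : Set P)

instance : IsSmooth (E.subRep N hN A) where
  discrete := inferInstanceAs (DiscreteTopology (discreteRep _))
  continuous_orbit := fun (m : N) => by
    obtain ⟨m, hm⟩ := m
    obtain ⟨m, rfl⟩ := Submodule.mkQ_surjective _ m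
    -- any extension to a function on the free module will do
    classical
    have h := ((isLocallyConstant_pointRep m A).comp fun n =>
      if hn : (E.relations Y).mkQ n ∈ N then (⟨_, hn⟩ : N) else (0 : N)).continuous
      (Y := E.subRep N hN A)
    refine (congrArg _ (funext fun g => ?_)).mp h
    exact dif_pos (hN (extend A g) hm)

/-- An equivariant map between quotients as a morphism of representations. -/
noncomputable def subHom {Y' : Set P} {N' : Submodule R (E.Quot Y')}
    (hN' : ∀ g, N' ≤ N'.comap (E.quotRep Y' g)) (f : E.Quot Y →ₗ[R] E.Quot Y')
    (hf : ∀ m ∈ N, f m ∈ N') (hc : ∀ g m, f (E.quotRep Y g m) = E.quotRep Y' g (f m)) :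
    E.subRep N hN A ⟶ E.subRep N' hN' A :=
  homOf (X := E.subRep N hN A) (Y := E.subRep N' hN' A) (f.restrict hf)
    fun g m => Subtype.ext (hc (extend A g) (m : N).1)

lemma within_stable (Q : Set P) (g : ∀ x, C x) :
    E.spanOf Y (within Q) ≤ (E.spanOf Y (within Q)).comap (E.quotRep Y g) :=
  E.spanOf_le_comap (fun _ ha g => shift_mem_within ha g) g

lemma through_stable (x : P) (g : ∀ x, C x) :
    E.spanOf Y (throughPoints Y x) ≤ (E.spanOf Y (throughPoints Y x)).comap (E.quotRep Y g) :=
  E.spanOf_le_comap (T := throughPoints Y x)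
    (fun _ ha g => ⟨shift_mem_within ha.1 g, fun h => ha.2 (shift_apply_eq_zero.1 h)⟩) g

/-- The universal norm distribution on the primes in `Q`. -/
noncomputable def distRep (Q : Set P) : TopRep.{max (max a b) c} R (∀ x : Q, C x) :=
  E.subRep (E.spanOf Q (within Q)) (E.within_stable Q) Q

instance (Q : Set P) : IsSmooth (E.distRep Q) :=
  inferInstanceAs (IsSmooth (E.subRep _ (E.within_stable Q) Q))

lemma quotMap_mem {Q Q' : Set P} (h : Q ⊆ Q') {m : E.Quot Q} (hm : m ∈ E.spanOf Q (within Q)) :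
    E.quotMap h m ∈ E.spanOf Q' (within Q') :=
  (E.spanOf_le (N := (E.spanOf Q' (within Q')).comap (E.quotMap h)) fun _ ha =>
    E.cls_mem_spanOf (within_mono h ha)) hm

lemma quotRep_congr {Q : Set P} {g h : ∀ x, C x} (hgh : ∀ x ∈ Q, g x = h x) {m : E.Quot Y}
    (hm : m ∈ E.spanOf Y (within Q)) : E.quotRep Y g m = E.quotRep Y h m :=
  E.eqOn_spanOf (fun a ha => by
    rw [quotRep_cls, quotRep_cls, shift_eq_of_forall fun x hx => hgh x (ha x hx)]) hm

lemma quotRep_extend_restriction {Q Q' : Set P} (h : Q ⊆ Q') (g : ∀ x : Q', C x) {m : E.Quot Y}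
    (hm : m ∈ E.spanOf Y (within Q)) :
    E.quotRep Y (extend Q (restriction h g)) m = E.quotRep Y (extend Q' g) m :=
  E.quotRep_congr (fun x hx => by rw [extend_apply _ hx, extend_apply _ (h hx)]; rfl) hm

/-- The transition map between the universal norm distributions of `Q ⊆ Q'`. -/
noncomputable def transition {Q Q' : Set P} (h : Q ⊆ Q') :
    TopRep.res (restriction (C := C) h : (∀ x : Q', C x) →* ∀ x : Q, C x) (E.distRep Q) ⟶
      E.distRep Q' :=
  homOf (X := TopRep.res (restriction (C := C) h : (∀ x : Q', C x) →* ∀ x : Q, C x) (E.distRep Q))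
    (Y := E.distRep Q') ((E.quotMap h).restrict fun _ hm => E.quotMap_mem h hm)
    fun g (m : E.spanOf Q (within Q)) => Subtype.ext <|
      (congrArg (E.quotMap h) (E.quotRep_extend_restriction h g m.2)).trans
        (E.quotMap_quotRep h _ _)

lemma transition_injective {Q Q' : Set P} (h : Q ⊆ Q') :
    Function.Injective (E.transition h).hom := by
  intro (m : E.spanOf Q (within Q)) (n : E.spanOf Q (within Q)) hmn
  have h1 : E.quotMap h m.1 = E.quotMap h n.1 :=
    congrArg (fun v : E.spanOf Q' (within Q') => v.1) hmn
  refine Subtype.ext (sub_eq_zero.1 (E.quotMap_injOn h (sub_mem m.2 n.2) ?_))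
  rw [map_sub, h1, sub_self]

section Step

variable {x : P} (hx : x ∉ Y)

lemma shift_mulSingle_of_eq_zero {a : Point C} (h : a x = 0) (c : C x) :
    shift (Pi.mulSingle x c) a = a := by
  ext y : 1
  by_cases hy : y = x
  · subst hy
    rw [shift_apply, h, mul_zero]
  · rw [shift_apply, Pi.mulSingle_eq_of_ne hy, WithZero.coe_one, one_mul]

lemma quotRep_mulSingle_of_within (hx : x ∉ Y) (c : C x) {m : E.Quot Y}
    (hm : m ∈ E.spanOf Y (within Y)) : E.quotRep Y (Pi.mulSingle x c) m = m :=
  E.eqOn_spanOf (g := LinearMap.id) (fun a ha => by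
    rw [quotRep_cls, shift_mulSingle_of_eq_zero (apply_eq_zero_of_within ha hx)]; rfl) hm

/-- The operator `c - 1` on the quotient, for `c` in the group at `x`. -/
noncomputable def diff (Y : Set P) (x : P) (c : C x) : E.Quot Y →ₗ[R] E.Quot Y :=
  E.quotRep Y (Pi.mulSingle x c) - LinearMap.id

lemma diff_apply (c : C x) (m : E.Quot Y) :
    E.diff Y x c m = E.quotRep Y (Pi.mulSingle x c) m - m := rfl

lemma diff_quotRep (c : C x) (g : ∀ x, C x) (m : E.Quot Y) :
    E.diff Y x c (E.quotRep Y g m) = E.quotRep Y g (E.diff Y x c m) := by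
  rw [diff_apply, diff_apply, map_sub, quotRep_comm]

lemma diff_norm (c : C x) {m : E.Quot Y} (hm : m ∈ E.spanOf Y (within Y)) :
    E.diff Y x c (E.norm hx m) = 0 := by
  rw [diff_apply, ← norm_quotRep, quotRep_mulSingle_of_within E hx c hm, sub_self]

/-- The image of `c - 1` on the points through `x`. -/
noncomputable def diffSpan (Y : Set P) (x : P) (c : C x) : Submodule R (E.Quot Y) :=
  (E.spanOf Y (throughPoints Y x)).map (E.diff Y x c)

lemma diffSpan_stable (c : C x) (g : ∀ x, C x) :
    E.diffSpan Y x c ≤ (E.diffSpan Y x c).comap (E.quotRep Y g) := by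
  rintro _ ⟨m, hm, rfl⟩
  exact ⟨_, E.through_stable x g hm, E.diff_quotRep c g m⟩

lemma diffSpan_le (c : C x) : E.diffSpan Y x c ≤ E.spanOf Y (throughPoints Y x) := by
  rintro _ ⟨m, hm, rfl⟩
  exact sub_mem (E.through_stable x _ hm) hm

lemma diff_pow_mem (c : C x) (n : ℕ) {m : E.Quot Y} (hm : m ∈ E.spanOf Y (throughPoints Y x)) :
    E.quotRep Y (Pi.mulSingle x (c ^ n)) m - m ∈ E.diffSpan Y x c := by
  induction n with
  | zero =>
    rw [pow_zero, Pi.mulSingle_one, map_one, Module.End.one_apply, sub_self]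
    exact zero_mem _
  | succ n ih =>
    have h := add_mem (⟨_, E.through_stable x _ hm, rfl⟩ :
      E.diff Y x c (E.quotRep Y (Pi.mulSingle x (c ^ n)) m) ∈ E.diffSpan Y x c) ih
    rwa [diff_apply, sub_add_sub_cancel, ← Module.End.mul_apply, ← map_mul, ← Pi.mulSingle_mul,
      ← pow_succ'] at h

/-- An element of the through span fixed by all of `C x` is in the image of the norm. -/
lemma eq_norm_of_fixed {m : E.Quot Y} (hm : m ∈ E.spanOf Y (throughPoints Y x))
    (h : ∀ c : C x, E.quotRep Y (Pi.mulSingle x c) m = m) :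
    E.norm hx (E.remove hx (E.unitPart Y x m)) = m := by
  rw [← sum_quotRep_mulSingle E hx (E.unitPart_mem hx hm)]
  conv_rhs => rw [← E.sum_unitPart hx hm]
  refine Finset.sum_congr rfl fun c _ => ?_
  rw [← Pi.mulSingle_inv, h]

lemma fixed_of_diff_eq_zero {c : C x} (hc : ∀ d, ∃ n : ℕ, c ^ n = d) {m : E.Quot Y}
    (h : E.diff Y x c m = 0) (d : C x) : E.quotRep Y (Pi.mulSingle x d) m = m := by
  obtain ⟨n, rfl⟩ := hc d
  rw [diff_apply, sub_eq_zero] at h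
  induction n with
  | zero => rw [pow_zero, Pi.mulSingle_one, map_one, Module.End.one_apply]
  | succ n ih => rw [pow_succ, Pi.mulSingle_mul, map_mul, Module.End.mul_apply, h, ih]

lemma remove_diff (c : C x) {m : E.Quot Y} (hm : m ∈ E.spanOf Y (throughPoints Y x)) :
    E.remove hx (E.diff Y x c m) = 0 := by
  rw [diff_apply, map_sub, remove_quotRep,
    quotRep_mulSingle_of_within E hx c (E.remove_mem hx hm), sub_self]

/-- Elements killed by `remove` are in the image of `c - 1` for a generator `c`: subtracting from `m
= ∑ d, d • u (d⁻¹ • m)`, with `u` the projection `unitPart`, the vanishing sum `∑ d, u (d⁻¹ • m)`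
leaves a sum of terms `(d - 1) • n`. -/
lemma mem_diffSpan_of_remove_eq_zero {c : C x} (hc : ∀ d, ∃ n : ℕ, c ^ n = d) {m : E.Quot Y}
    (hm : m ∈ E.spanOf Y (throughPoints Y x)) (h : E.remove hx m = 0) :
    m ∈ E.diffSpan Y x c := by
  have h1 : ∑ d : C x, E.unitPart Y x (E.quotRep Y (Pi.mulSingle x d)⁻¹ m) = 0 := by
    have h2 : ∑ d : C x, E.quotRep Y (Pi.mulSingle x d)⁻¹ m = 0 := by
      rw [← map_zero (E.norm hx), ← h, ← sum_quotRep_mulSingle E hx hm]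
      exact Fintype.sum_equiv (Equiv.inv (C x)) _ _ fun d => by
        rw [Equiv.inv_apply, Pi.mulSingle_inv]
    rw [← map_sum, h2, map_zero]
  have h3 := Finset.sum_sub_distrib
    (fun d : C x => E.quotRep Y (Pi.mulSingle x d)
      (E.unitPart Y x (E.quotRep Y (Pi.mulSingle x d)⁻¹ m)))
    (fun d => E.unitPart Y x (E.quotRep Y (Pi.mulSingle x d)⁻¹ m)) (s := Finset.univ)
  rw [h1, E.sum_unitPart hx hm, sub_zero] at h3
  rw [← h3]
  refine Submodule.sum_mem _ fun d _ => ?_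
  obtain ⟨n, rfl⟩ := hc d
  exact E.diff_pow_mem c n (E.unitPart_mem hx (E.through_stable x _ hm))

/-- On the quotient by the relations at `x` as well, `c - 1` makes sense if the points not
involving `x` are sent to `0`. -/
noncomputable def quotDiff (c : C x) : E.Quot (insert x Y) →ₗ[R] E.Quot Y :=
  (E.relations (insert x Y)).liftQ (E.diff Y x c ∘ₗ E.present hx ∘ₗ (E.relations Y).mkQ) <| by
    rw [relations, Submodule.span_le]
    rintro _ ⟨y, hy, a, ha, rfl⟩
    rw [SetLike.mem_coe, LinearMap.mem_ker, LinearMap.comp_apply, LinearMap.comp_apply]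
    rcases hy with rfl | hy
    · have h1 : E.present hx ((E.relations Y).mkQ (E.euler y (Finsupp.single a 1))) = 0 :=
        (Submodule.mem_bot R).1 (E.euler_single_mem (E.present hx ∘ₗ (E.relations Y).mkQ) fun i =>
          (Submodule.mem_bot R).2 (E.present_cls_of_eq_zero hx (shift_apply_eq_zero.2 ha)))
      have h2 : ∑ b : C y, E.present hx (E.cls Y (a.update y (b : WithZero (C y)))) =
          E.norm hx (E.cls Y a) := by
        rw [norm_cls]
        refine Finset.sum_congr rfl fun b _ => E.present_cls hx ?_
        rw [update_apply_same]
        exact WithZero.coe_ne_zero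
      rw [relation, map_sub, map_sub, h1, zero_sub, map_sum, map_sum, map_neg, neg_eq_zero]
      change E.diff Y y c (∑ b : C y, E.present hx (E.cls Y (a.update y (b : WithZero (C y))))) = 0
      rw [h2, diff_apply, ← norm_quotRep, quotRep_cls, shift_mulSingle_of_eq_zero ha, sub_self]
    · rw [(Submodule.Quotient.mk_eq_zero _ (x := E.relation y a)).2 (E.relation_mem hy ha) |>
        (fun h => (h : (E.relations Y).mkQ (E.relation y a) = 0)), map_zero, map_zero]

lemma quotDiff_mkQ (c : C x) (m : Point C →₀ R) :
    E.quotDiff hx c ((E.relations (insert x Y)).mkQ m) =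
      E.diff Y x c (E.present hx ((E.relations Y).mkQ m)) := rfl

lemma quotDiff_quotRep (c : C x) (g : ∀ x, C x) (m : E.Quot (insert x Y)) :
    E.quotDiff hx c (E.quotRep _ g m) = E.quotRep Y g (E.quotDiff hx c m) := by
  obtain ⟨m, rfl⟩ := Submodule.mkQ_surjective _ m
  rw [quotRep_mkQ, quotDiff_mkQ, ← quotRep_mkQ, present_quotRep, diff_quotRep, quotDiff_mkQ]

lemma quotDiff_quotMap (c : C x) {m : E.Quot Y} (hm : m ∈ E.spanOf Y (throughPoints Y x)) :
    E.quotDiff hx c (E.quotMap (Set.subset_insert x Y) m) = E.diff Y x c m :=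
  E.eqOn_spanOf (f := E.quotDiff hx c ∘ₗ E.quotMap (Set.subset_insert x Y)) (fun a ha => by
    rw [LinearMap.comp_apply]
    change E.diff Y x c (E.present hx (E.cls Y a)) = _
    rw [present_cls E hx ha.2]) hm

lemma quotDiff_quotMap_of_within (c : C x) {m : E.Quot Y} (hm : m ∈ E.spanOf Y (within Y)) :
    E.quotDiff hx c (E.quotMap (Set.subset_insert x Y) m) = 0 :=
  E.eqOn_spanOf (f := E.quotDiff hx c ∘ₗ E.quotMap (Set.subset_insert x Y)) (g := 0) (fun a ha => by
    rw [LinearMap.comp_apply]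
    change E.diff Y x c (E.present hx (E.cls Y a)) = _
    rw [present_cls_of_eq_zero E hx (apply_eq_zero_of_within ha hx), map_zero]; rfl) hm

lemma spanOf_insert_le : E.spanOf (insert x Y) (within (insert x Y)) ≤
    (E.spanOf Y (within Y)).map (E.quotMap (Set.subset_insert x Y)) ⊔
      (E.spanOf Y (throughPoints Y x)).map (E.quotMap (Set.subset_insert x Y)) := by
  refine E.spanOf_le fun a ha => ?_
  by_cases h : a x = 0
  · refine Submodule.mem_sup_left ⟨_, E.cls_mem_spanOf fun y hy => ?_, rfl⟩
    refine (ha y hy).resolve_left ?_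
    rintro rfl
    exact hy h
  · exact Submodule.mem_sup_right ⟨_, E.cls_mem_spanOf ⟨ha, h⟩, rfl⟩

lemma map_aeval_end {V W : Type*} [AddCommGroup V] [Module R V] [AddCommGroup W] [Module R W]
    (f : V →ₗ[R] W) (α : Module.End R V) (β : Module.End R W) (h : ∀ v, f (α v) = β (f v))
    (q : Polynomial R) (v : V) : f (Polynomial.aeval α q v) = Polynomial.aeval β q (f v) := by
  induction q using Polynomial.induction_on generalizing v with
  | C a => simp [Polynomial.aeval_C, Module.algebraMap_end_apply]
  | add p q hp hq => rw [map_add, map_add, LinearMap.add_apply, LinearMap.add_apply, map_add, hp, hq]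
  | monomial n a ih =>
    rw [pow_succ, ← mul_assoc, map_mul (Polynomial.aeval α) _ Polynomial.X,
      map_mul (Polynomial.aeval β) _ Polynomial.X, Module.End.mul_apply, Module.End.mul_apply, ih,
      Polynomial.aeval_X, Polynomial.aeval_X, h]

/-- The distribution relation at `x`: modulo the relations at `x`, the norm is the Euler factor. -/
lemma quotMap_norm {m : E.Quot Y} (hm : m ∈ E.spanOf Y (within Y)) :
    E.quotMap (Set.subset_insert x Y) (E.norm hx m) = E.quotMap (Set.subset_insert x Y)
      (Polynomial.aeval (E.quotRep Y (E.frob x)) (E.poly x) m) := by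
  refine E.eqOn_spanOf (f := E.quotMap (Set.subset_insert x Y) ∘ₗ E.norm hx)
    (g := E.quotMap (Set.subset_insert x Y) ∘ₗ
      Polynomial.aeval (E.quotRep Y (E.frob x)) (E.poly x)) (fun a ha => ?_) hm
  have h1 : Polynomial.aeval (E.quotRep Y (E.frob x)) (E.poly x) (E.cls Y a) =
      (E.relations Y).mkQ (E.euler x (Finsupp.single a 1)) :=
    (map_aeval_end (E.relations Y).mkQ _ _ (fun m => (E.quotRep_mkQ _ m).symm) _ _).symm
  have h2 : E.norm hx (E.cls Y a) = (E.relations Y).mkQ (creation x (Finsupp.single a 1)) := rfl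
  rw [LinearMap.comp_apply, LinearMap.comp_apply, h1, h2, quotMap_mkQ, quotMap_mkQ]
  refine ((Submodule.Quotient.eq _).2 ?_).symm
  rw [creation_single]
  exact E.relation_mem (Set.mem_insert _ _) (apply_eq_zero_of_within ha hx)

end Step

end EulerData

/-! ### Adding one prime -/

namespace EulerData

variable {P : Type a} [LinearOrder P] {C : P → Type b} [∀ x, CommGroup (C x)]
  [∀ x, Fintype (C x)] [∀ x, TopologicalSpace (C x)] [∀ x, DiscreteTopology (C x)]
  {R : Type c} [CommRing R] [TopologicalSpace R] [DiscreteTopology R] (E : EulerData C R)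
  {Q : Set P} {x : P}

lemma mem_diffSpan {g : C x} {m : E.Quot Q} : m ∈ E.diffSpan Q x g ↔
    ∃ n ∈ E.spanOf Q (throughPoints Q x), E.diff Q x g n = m := Submodule.mem_map

lemma exists_of_mem_insert {m : E.Quot (insert x Q)}
    (hm : m ∈ E.spanOf (insert x Q) (within (insert x Q))) :
    ∃ v ∈ E.spanOf Q (within Q), ∃ w ∈ E.spanOf Q (throughPoints Q x),
      E.quotMap (Set.subset_insert x Q) v + E.quotMap (Set.subset_insert x Q) w = m := by
  obtain ⟨v, hv, w, hw, h⟩ := Submodule.mem_sup.1 (E.spanOf_insert_le hm)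
  obtain ⟨v, hv', rfl⟩ := Submodule.mem_map.1 hv
  obtain ⟨w, hw', rfl⟩ := Submodule.mem_map.1 hw
  exact ⟨v, hv', w, hw', h⟩

lemma quotDiff_mem (hx : x ∉ Q) (g : C x) {m : E.Quot (insert x Q)}
    (hm : m ∈ E.spanOf (insert x Q) (within (insert x Q))) :
    E.quotDiff hx g m ∈ E.diffSpan Q x g := by
  obtain ⟨v, hv, w, hw, h⟩ := E.exists_of_mem_insert hm
  have h1 := E.quotDiff_quotMap_of_within hx g hv
  have h2 := E.quotDiff_quotMap hx g hw
  have h3 : E.quotDiff hx g m = E.diff Q x g w := by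
    rw [← h, map_add, h1, h2, zero_add]
  exact E.mem_diffSpan.2 ⟨w, hw, h3.symm⟩

lemma quotMap_mem_of_through {m : E.Quot Q} (hm : m ∈ E.spanOf Q (throughPoints Q x)) :
    E.quotMap (Set.subset_insert x Q) m ∈ E.spanOf (insert x Q) (within (insert x Q)) :=
  (E.spanOf_le (N := (E.spanOf (insert x Q) (within (insert x Q))).comap (E.quotMap _)) fun _ ha =>
    E.cls_mem_spanOf ha.1) hm

variable (Q) in
/-- The universal norm distribution of `Q`, inflated to the group of a larger set of primes. -/
noncomputable abbrev inflated (Q' : Set P) : TopRep.{max (max a b) c} R (∀ x : Q', C x) :=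
  E.subRep (E.spanOf Q (within Q)) (E.within_stable Q) Q'

/-- The points through `x`, modulo the relations at the primes in `Q`. -/
noncomputable abbrev through (Q : Set P) (x : P) :
    TopRep.{max (max a b) c} R (∀ y : (insert x Q : Set P), C y) :=
  E.subRep (E.spanOf Q (throughPoints Q x)) (E.through_stable x) (insert x Q)

/-- The image of `g - 1` on the points through `x`, as a representation. -/
noncomputable abbrev diffRep (Q : Set P) (x : P) (g : C x) :
    TopRep.{max (max a b) c} R (∀ y : (insert x Q : Set P), C y) :=
  E.subRep (E.diffSpan Q x g) (E.diffSpan_stable g) (insert x Q)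

section

variable (hx : x ∉ Q) (g : C x)

/-- Adding `x` in all possible ways. -/
noncomputable def normHom : E.inflated Q (insert x Q) ⟶ E.through Q x :=
  E.subHom _ _ _ (E.norm hx) (fun _ hm => E.norm_mem hx hm) (E.norm_quotRep hx)

lemma normHom_injective (hx : x ∉ Q) : Function.Injective (E.normHom hx).hom :=
  fun (m : E.spanOf Q (within Q)) (n : E.spanOf Q (within Q)) hmn => by
    have h1 : E.norm hx m.1 = E.norm hx n.1 :=
      congrArg (fun v : E.spanOf Q (throughPoints Q x) => v.1) hmn
    refine Subtype.ext ?_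
    rw [← E.remove_unitPart_norm hx m.2, h1, E.remove_unitPart_norm hx n.2]

/-- The map `g - 1` onto its image. -/
noncomputable def diffHom : E.through Q x ⟶ E.diffRep Q x g :=
  E.subHom _ _ _ (E.diff Q x g) (fun m hm => E.mem_diffSpan.2 ⟨m, hm, rfl⟩) (E.diff_quotRep g)

/-- The universal norm distribution of `Q` as a subrepresentation of that of `insert x Q`. -/
noncomputable def insertHom (Q : Set P) (x : P) :
    E.inflated Q (insert x Q) ⟶ E.distRep (insert x Q) :=
  E.subHom _ _ (E.within_stable (insert x Q)) (E.quotMap (Set.subset_insert x Q))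
    (fun _ hm => E.quotMap_mem _ hm) (E.quotMap_quotRep _)

/-- The map `quotDiff` from the distribution of `insert x Q` to the image of `g - 1`. -/
noncomputable def quotDiffHom : E.distRep (insert x Q) ⟶ E.diffRep Q x g :=
  E.subHom (E.within_stable (insert x Q)) _ _ (E.quotDiff hx g) (fun _ hm => E.quotDiff_mem hx g hm)
    (E.quotDiff_quotRep hx g)

/-- The inclusion of the image of `g - 1` in the points through `x`. -/
noncomputable def diffIncl : E.diffRep Q x g ⟶ E.through Q x :=
  E.subHom _ _ _ LinearMap.id (fun _ hm => E.diffSpan_le g hm) (fun _ _ => rfl)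

/-- Removing `x` from the points through `x`. -/
noncomputable def removeHom : E.through Q x ⟶ E.inflated Q (insert x Q) :=
  E.subHom _ _ _ (E.remove hx) (fun _ hm => E.remove_mem hx hm) (E.remove_quotRep hx)

/-- The points through `x`, taken modulo the relations at `x` as well. -/
noncomputable def throughHom (Q : Set P) (x : P) : E.through Q x ⟶ E.distRep (insert x Q) :=
  E.subHom _ _ (E.within_stable (insert x Q)) (E.quotMap (Set.subset_insert x Q))
    (fun _ hm => E.quotMap_mem_of_through hm) (E.quotMap_quotRep _)

/-- The identity from the inflation of `distRep Q` to `inflated Q (insert x Q)`, which are the same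
module with the group acting through two a priori different formulas. -/
noncomputable def inflHom (Q : Set P) (x : P) :
    TopRep.res (restriction (C := C) (Set.subset_insert x Q) :
      (∀ y : (insert x Q : Set P), C y) →* ∀ y : Q, C y) (E.distRep Q) ⟶
      E.inflated Q (insert x Q) :=
  homOf (X := TopRep.res (restriction (C := C) (Set.subset_insert x Q) :
      (∀ y : (insert x Q : Set P), C y) →* ∀ y : Q, C y) (E.distRep Q))
    (Y := E.inflated Q (insert x Q)) (LinearMap.id : E.spanOf Q (within Q) →ₗ[R] _)
    fun g (m : E.spanOf Q (within Q)) =>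
      Subtype.ext (E.quotRep_extend_restriction (Set.subset_insert x Q) g m.2)

variable {g} (hg : ∀ d, ∃ n : ℕ, g ^ n = d)
include hg

/-- `U_Q → W → B`, where `U_Q` is the distribution of `Q`, `W` the points through `x` and `B` the
image of `g - 1` on `W`: the elements of `W` fixed by the generator `g` are the norms. -/
lemma isSES_norm_diff : IsSES (E.normHom hx) (E.diffHom g) where
  injective := E.normHom_injective hx
  surjective := by
    rintro ⟨y, hy⟩
    obtain ⟨m, hm, rfl⟩ := E.mem_diffSpan.1 hy
    exact ⟨(⟨m, hm⟩ : E.spanOf Q (throughPoints Q x)), rfl⟩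
  zero := fun (m : E.spanOf Q (within Q)) => Subtype.ext (E.diff_norm hx g m.2)
  exact := fun (m : E.spanOf Q (throughPoints Q x)) hm => by
    have h1 : E.diff Q x g m.1 = 0 := congrArg (fun v : E.diffSpan Q x g => v.1) hm
    exact ⟨(⟨_, E.remove_mem hx (E.unitPart_mem hx m.2)⟩ : E.spanOf Q (within Q)),
      Subtype.ext (E.eq_norm_of_fixed hx m.2 (E.fixed_of_diff_eq_zero hg h1))⟩

/-- `U_Q → U_{Q ∪ {x}} → B`: an element `v + w`, with `v` not involving `x` and `w` through `x`, is
killed if and only if `w` is a norm, and norms are in `U_Q` by the relation at `x`. -/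
lemma isSES_insert_quotDiff : IsSES (E.insertHom Q x) (E.quotDiffHom hx g) where
  injective := fun (m : E.spanOf Q (within Q)) (n : E.spanOf Q (within Q)) hmn => by
    have h1 : E.quotMap (Set.subset_insert x Q) m.1 = E.quotMap (Set.subset_insert x Q) n.1 :=
      congrArg (fun v : E.spanOf (insert x Q) (within (insert x Q)) => v.1) hmn
    refine Subtype.ext (sub_eq_zero.1 (E.quotMap_injOn (Set.subset_insert x Q)
      (sub_mem m.2 n.2) ?_))
    rw [map_sub, h1, sub_self]
  surjective := by
    rintro ⟨y, hy⟩
    obtain ⟨m, hm, rfl⟩ := E.mem_diffSpan.1 hy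
    exact ⟨(⟨_, E.quotMap_mem_of_through hm⟩ : E.spanOf (insert x Q) (within (insert x Q))),
      Subtype.ext (E.quotDiff_quotMap hx g hm)⟩
  zero := fun (m : E.spanOf Q (within Q)) => Subtype.ext (E.quotDiff_quotMap_of_within hx g m.2)
  exact := by
    rintro ⟨y, hy⟩ h
    have h1 : E.quotDiff hx g y = 0 := congrArg (fun v : E.diffSpan Q x g => v.1) h
    obtain ⟨m, hm, n, hn, rfl⟩ := E.exists_of_mem_insert hy
    rw [map_add, quotDiff_quotMap_of_within E hx g hm, quotDiff_quotMap E hx g hn, zero_add] at h1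
    have h2 := E.eq_norm_of_fixed hx hn (E.fixed_of_diff_eq_zero hg h1)
    have h3 := E.remove_mem hx (E.unitPart_mem hx hn)
    have h4 : Polynomial.aeval (E.quotRep Q (E.frob x)) (E.poly x)
        (E.remove hx (E.unitPart Q x n)) ∈ E.spanOf Q (within Q) := by
      have h5 := map_aeval_end (E.spanOf Q (within Q)).subtype
        (LinearMap.restrict (E.quotRep Q (E.frob x)) (E.within_stable Q (E.frob x)))
        (E.quotRep Q (E.frob x)) (fun _ => rfl) (E.poly x) ⟨_, h3⟩
      exact h5 ▸ Subtype.prop _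
    refine ⟨(⟨_, add_mem hm h4⟩ : E.spanOf Q (within Q)), Subtype.ext ?_⟩
    have h5 := E.quotMap_norm hx h3
    rw [h2] at h5
    exact ((E.quotMap (Set.subset_insert x Q)).map_add _ _).trans (congrArg _ h5.symm)

/-- `B → W → U_Q`, the second map removing `x`. -/
lemma isSES_incl_remove : IsSES (E.diffIncl (Q := Q) g) (E.removeHom hx) where
  injective := fun (m : E.diffSpan Q x g) (n : E.diffSpan Q x g) hmn =>
    Subtype.ext (congrArg (fun v : E.spanOf Q (throughPoints Q x) => v.1) hmn)
  surjective := fun (m : E.spanOf Q (within Q)) =>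
    ⟨(⟨_, E.unitPart_mem hx (E.norm_mem hx m.2)⟩ : E.spanOf Q (throughPoints Q x)),
      Subtype.ext (E.remove_unitPart_norm hx m.2)⟩
  zero := by
    rintro ⟨y, hy⟩
    obtain ⟨m, hm, rfl⟩ := E.mem_diffSpan.1 hy
    exact Subtype.ext (E.remove_diff hx g hm)
  exact := fun (m : E.spanOf Q (throughPoints Q x)) hm => by
    have h1 : E.remove hx m.1 = 0 := congrArg (fun v : E.spanOf Q (within Q) => v.1) hm
    exact ⟨(⟨_, E.mem_diffSpan_of_remove_eq_zero hx hg m.2 h1⟩ : E.diffSpan Q x g), rfl⟩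

end

/-- The inclusion of the group at `x`. -/
def inclusionAt (Q : Set P) (x : P) : C x →* ∀ y : (insert x Q : Set P), C y :=
  MonoidHom.mulSingle (fun y : (insert x Q : Set P) => C y) ⟨x, Set.mem_insert x Q⟩

lemma extend_inclusionAt (g : C x) : extend (insert x Q) (inclusionAt Q x g) = Pi.mulSingle x g :=
  extend_mulSingle (⟨x, Set.mem_insert x Q⟩ : (insert x Q : Set P)) g

/-- The kernel of the restriction from `insert x Q` to `Q` is the group at `x`. -/
lemma restriction_eq_one_iff (hx : x ∉ Q) (g : ∀ y : (insert x Q : Set P), C y) :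
    restriction (Set.subset_insert x Q) g = 1 ↔ ∃ e, inclusionAt Q x e = g := by
  constructor
  · refine fun h => ⟨g ⟨x, Set.mem_insert x Q⟩, funext fun y => ?_⟩
    by_cases hy : y = ⟨x, Set.mem_insert x Q⟩
    · subst hy; exact Pi.mulSingle_eq_same _ _
    · refine (Pi.mulSingle_eq_of_ne hy _).trans ?_
      exact (congrFun h ⟨y, y.2.resolve_left fun h => hy (Subtype.ext h)⟩).symm
  · rintro ⟨e, rfl⟩
    refine funext fun y => Pi.mulSingle_eq_of_ne ?_ _
    rintro h
    have h' : y.1 = x := congrArg Subtype.val h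
    exact hx (h' ▸ y.2)

/-- The points through `x` are relatively injective for the group at `x`, as the group permutes
freely the components at `x`. -/
lemma isTrace_through (hx : x ∉ Q) : IsTrace (inclusionAt Q x) (E.through Q x) := by
  refine ⟨(E.unitPart Q x).restrict fun _ hm => E.unitPart_mem hx hm,
    fun (m : E.spanOf Q (throughPoints Q x)) => ?_⟩
  refine Subtype.ext (Eq.trans ?_ (E.sum_unitPart hx m.2))
  refine (map_sum (E.spanOf Q (throughPoints Q x)).subtype _ _).trans ?_
  refine Finset.sum_congr rfl fun e _ => ?_
  change E.quotRep Q (extend _ (inclusionAt Q x e))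
    (E.unitPart Q x (E.quotRep Q (extend _ (inclusionAt Q x e)⁻¹) m.1)) = _
  rw [map_inv, extend_inclusionAt]

lemma exists_normHom_eq (hx : x ∉ Q) {m : E.through Q x}
    (hm : m ∈ fixedVectors (restriction (Set.subset_insert x Q)) (E.through Q x)) :
    ∃ m', (E.normHom hx).hom m' = m := by
  revert hm
  revert m
  intro (m : E.spanOf Q (throughPoints Q x)) hm
  have h : ∀ d : C x, E.quotRep Q (Pi.mulSingle x d) m.1 = m.1 := fun d => by
    rw [← extend_inclusionAt (Q := Q)]
    exact congrArg (fun v : E.spanOf Q (throughPoints Q x) => v.1)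
      (hm (inclusionAt Q x d) ((restriction_eq_one_iff hx _).2 ⟨d, rfl⟩))
  exact ⟨(⟨_, E.remove_mem hx (E.unitPart_mem hx m.2)⟩ : E.spanOf Q (within Q)),
    Subtype.ext (E.eq_norm_of_fixed hx m.2 h)⟩

lemma inflHom_bijective : Function.Bijective (E.inflHom Q x).hom :=
  ⟨fun (_ : E.spanOf Q (within Q)) (_ : E.spanOf Q (within Q)) h => h,
    fun (m : E.spanOf Q (within Q)) => ⟨m, rfl⟩⟩

/-- The cohomology of the points through `x` is that of the distribution of `Q`. -/
lemma inflation_norm_bijective (hx : x ∉ Q) (n : ℕ) :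
    Function.Bijective (cohMap.{c, max a b, c} (restriction (C := C) (Set.subset_insert x Q))
      (E.inflHom Q x ≫ E.normHom hx) n) := by
  have h1 : Function.Injective (E.inflHom Q x ≫ E.normHom hx).hom := fun v w hvw =>
    E.inflHom_bijective.1 (E.normHom_injective hx hvw)
  have h2 : ∀ m ∈ fixedVectors (restriction (C := C) (Set.subset_insert x Q)) (E.through Q x),
      ∃ m', (E.inflHom Q x ≫ E.normHom hx).hom m' = m := fun m hm => by
    obtain ⟨v, rfl⟩ := E.exists_normHom_eq hx hm
    obtain ⟨w, rfl⟩ := E.inflHom_bijective.2 v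
    exact ⟨w, rfl⟩
  have h3 := isQuotientMap_restriction (C := C) (Set.subset_insert x Q)
  have h4 := inflation_bijective.{c, max a b, c} (k := R) h3
    (ε := inclusionAt Q x) (restriction_eq_one_iff hx) n (E.through Q x) (E.isTrace_through hx)
  have h5 := h4 (E.distRep Q) (E.inflHom Q x ≫ E.normHom hx) h1 h2
  exact h5

/-- The Euler factor at `x` as an endomorphism of the inflated distribution. -/
noncomputable def eulerHom (Q : Set P) (x : P) :
    E.inflated Q (insert x Q) ⟶ E.inflated Q (insert x Q) :=
  polyHom (fun y : (insert x Q : Set P) => E.frob x y) (fun h => mul_comm _ h) (E.poly x) _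

/-- The distribution relation at `x` as an identity of morphisms: `U_{Q ∪ {x}}` is the pushout of
the norm along the Euler factor. -/
lemma throughHom_normHom (hx : x ∉ Q) (m : E.inflated Q (insert x Q)) :
    (E.throughHom Q x).hom ((E.normHom hx).hom m) =
      (E.insertHom Q x).hom ((E.eulerHom Q x).hom m) := by
  revert m
  intro (m : E.spanOf Q (within Q))
  have h1 : ∀ v : E.spanOf Q (within Q),
      (linRep (E.inflated Q (insert x Q)) (fun y => E.frob x y) v : E.spanOf Q (within Q)).1 =
        E.quotRep Q (E.frob x) v.1 := fun v =>
    E.quotRep_congr (fun y hy => extend_apply _ (Set.mem_insert_of_mem x hy)) v.2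
  refine Subtype.ext ((E.quotMap_norm hx m.2).trans (congrArg (E.quotMap _) ?_))
  exact (map_aeval_end (E.spanOf Q (within Q)).subtype
    (linRep (E.inflated Q (insert x Q)) fun y => E.frob x y) (E.quotRep Q (E.frob x)) h1
    (E.poly x) m).symm

lemma quotDiffHom_throughHom (hx : x ∉ Q) (g : C x) (m : E.through Q x) :
    (E.quotDiffHom hx g).hom ((E.throughHom Q x).hom m) = (E.diffHom g).hom m := by
  revert m
  exact fun (m : E.spanOf Q (throughPoints Q x)) => Subtype.ext (E.quotDiff_quotMap hx g m.2)

lemma removeHom_normHom (hx : x ∉ Q) (hcard : (Fintype.card (C x) : R) = 0)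
    (m : E.inflated Q (insert x Q)) : (E.removeHom hx).hom ((E.normHom hx).hom m) = 0 := by
  revert m
  intro (m : E.spanOf Q (within Q))
  refine Subtype.ext ((E.remove_norm hx m.2).trans ?_)
  rw [hcard, zero_smul]
  rfl

/-- A basis of the cohomology of the universal norm distribution of `Q` extends to one for `insert x
Q`, with new elements in degree `n` for the old ones of degrees less than `n` and of degrees at most
`n`. The Euler factor vanishes on cohomology because its value at `1` does, and removing `x` kills
norms because the order of `C x` is zero in `R`. -/
theorem exists_basis_insert (hx : x ∉ Q) (hcyc : IsCyclic (C x))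
    (hcard : (Fintype.card (C x) : R) = 0) (hp : (E.poly x).eval 1 = 0) (I : ℕ → Type*)
    (b' : ∀ n, Module.Basis (I n) R (coh.{c, max a b, c} (E.distRep Q) n)) :
    ∃ b : ∀ n, Module.Basis ((I n ⊕ Below I n) ⊕ Below I (n + 1)) R
        (coh.{c, max a b, c} (E.distRep (insert x Q)) n),
      ∀ n i, b n (Sum.inl (Sum.inl i)) =
        cohMap.{c, max a b, c} (restriction (C := C) (Set.subset_insert x Q))
          (E.transition (Set.subset_insert x Q)) n (b' n i) := by
  obtain ⟨g, hg⟩ := IsCyclic.exists_monoid_generator (α := C x)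
  have hg' : ∀ d, ∃ n : ℕ, g ^ n = d := hg
  exact exists_basis_step.{c, max a b, c} (E.inflHom Q x) (E.isSES_norm_diff hx hg')
    (E.isSES_insert_quotDiff hx hg') (E.isSES_incl_remove hx hg') (E.eulerHom Q x)
    (E.throughHom Q x) (E.throughHom_normHom hx) (E.quotDiffHom_throughHom hx g)
    (fun n y => cohHom_polyHom _ _ _ hp n _ y) (E.removeHom_normHom hx hcard)
    (E.inflation_norm_bijective hx) I b'

end EulerData

/-! ### Directed unions of sets of primes -/

namespace DiscreteCohomology

universe u v w

variable {k : Type u} [CommRing k] [TopologicalSpace k]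
  {G : Type v} [Group G] [TopologicalSpace G] [IsTopologicalGroup G]
  {H : Type v} [Group H] [TopologicalSpace H] [IsTopologicalGroup H]
  {H' : Type v} [Group H'] [TopologicalSpace H'] [IsTopologicalGroup H']

/-- Cochains of a quotient group with values in a submodule inject. -/
lemma resolutionMap_injective {X : TopRep.{max v w} k G} {Y : TopRep.{max v w} k H} {φ : H →ₜ* G}
    (hφ : Function.Surjective φ) {f : TopRep.res (φ : H →* G) X ⟶ Y}
    (hf : Function.Injective f.hom) : ∀ n,
    Function.Injective (ContinuousCohomology.resolutionMap.{u, v, w} φ f n).hom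
  | 0 => hf
  | n + 1 => fun F F' h => ContinuousMap.ext fun g => by
    obtain ⟨g, rfl⟩ := hφ g
    exact resolutionMap_injective hφ hf n congr((show C(H, resolutionX Y n) from $h) g)

lemma resolutionMap_resolutionMap {X : TopRep.{max v w} k G} {Y : TopRep.{max v w} k H}
    {Z : TopRep.{max v w} k H'} (φ : H →ₜ* G) (ψ : H' →ₜ* H) (χ : H' →ₜ* G)
    (hχ : ∀ g, χ g = φ (ψ g))
    (f : TopRep.res (φ : H →* G) X ⟶ Y) (g : TopRep.res (ψ : H' →* H) Y ⟶ Z)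
    (h : TopRep.res (χ : H' →* G) X ⟶ Z) (hh : ∀ x, h.hom x = g.hom (f.hom x)) : ∀ (n : ℕ)
    (x : resolutionX X n),
    (ContinuousCohomology.resolutionMap.{u, v, w} ψ g n).hom
      ((ContinuousCohomology.resolutionMap.{u, v, w} φ f n).hom x) =
      (ContinuousCohomology.resolutionMap.{u, v, w} χ h n).hom x
  | 0, x => (hh x).symm
  | n + 1, F => ContinuousMap.ext fun γ => by
    change (ContinuousCohomology.resolutionMap.{u, v, w} ψ g n).hom
      ((ContinuousCohomology.resolutionMap.{u, v, w} φ f n).hom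
        ((show C(G, resolutionX X n) from F) (φ (ψ γ)))) =
      (ContinuousCohomology.resolutionMap.{u, v, w} χ h n).hom
        ((show C(G, resolutionX X n) from F) (χ γ))
    rw [hχ]
    exact resolutionMap_resolutionMap φ ψ χ hχ f g h hh n _

lemma resolutionMap_rho {X : TopRep.{max v w} k G} {Y : TopRep.{max v w} k H} (φ : H →ₜ* G)
    (f : TopRep.res (φ : H →* G) X ⟶ Y) (n : ℕ) (h : H) (x : resolutionX X n) :
    (ContinuousCohomology.resolutionMap.{u, v, w} φ f n).hom ((resolutionX X n).ρ (φ h) x) =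
      (resolutionX Y n).ρ h ((ContinuousCohomology.resolutionMap.{u, v, w} φ f n).hom x) :=
  hom_rho (ContinuousCohomology.resolutionMap.{u, v, w} φ f n) h x

/-- Invariance can be tested after an injective map. -/
lemma mem_invariants_of_resolutionMap {X : TopRep.{max v w} k G} {Y : TopRep.{max v w} k H}
    {φ : H →ₜ* G} (hφ : Function.Surjective φ) {f : TopRep.res (φ : H →* G) X ⟶ Y}
    (hf : Function.Injective f.hom) (n : ℕ) {x : resolutionX X n}
    (hx : (ContinuousCohomology.resolutionMap.{u, v, w} φ f n).hom x ∈
      (resolutionX Y n).ρ.invariants) : x ∈ (resolutionX X n).ρ.invariants := fun g => by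
  obtain ⟨h, rfl⟩ := hφ g
  refine resolutionMap_injective hφ hf n ?_
  rw [resolutionMap_rho]
  exact hx h

lemma cochainMap_injective {X : TopRep.{max v w} k G} {Y : TopRep.{max v w} k H} {φ : H →ₜ* G}
    (hφ : Function.Surjective φ) {f : TopRep.res (φ : H →* G) X ⟶ Y}
    (hf : Function.Injective f.hom) (n : ℕ) :
    Function.Injective ((cochainMap.{u, v, w} φ f).f n).hom := fun _ _ h =>
  Subtype.ext (resolutionMap_injective hφ hf (n + 1) (congrArg Subtype.val h))

end DiscreteCohomology

namespace EulerData

/-- A locally constant function on a product of finite groups depends on finitely many coordinates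
only. -/
lemma exists_finite_dependsOn {ι D : Type*} {C : ι → Type*} [∀ i, TopologicalSpace (C i)]
    [∀ i, DiscreteTopology (C i)] [CompactSpace (∀ i, C i)] [TopologicalSpace D]
    [DiscreteTopology D] (F : C(∀ i, C i, D)) :
    ∃ s : Set ι, s.Finite ∧ ∀ g h : ∀ i, C i, (∀ i ∈ s, g i = h i) → F g = F h := by
  classical
  have h1 : ∀ g : ∀ i, C i, ∃ s : Finset ι, ∀ h : ∀ i, C i, (∀ i ∈ s, h i = g i) → F h = F g := by
    intro g
    obtain ⟨s, u, hu, hs⟩ := isOpen_pi_iff.1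
      (F.continuous.isOpen_preimage {F g} (isOpen_discrete _)) g rfl
    exact ⟨s, fun h hh => hs fun i hi => by rw [hh i hi]; exact (hu i hi).2⟩
  choose s hs using h1
  have hopen : ∀ g, IsOpen {h : ∀ i, C i | ∀ i ∈ s g, h i = g i} := fun g => by
    have : {h : ∀ i, C i | ∀ i ∈ s g, h i = g i} = ⋂ i ∈ s g, (fun h => h i) ⁻¹' {g i} := by
      ext; simp
    rw [this]
    exact isOpen_biInter_finset fun i _ =>
      (continuous_apply (A := C) i).isOpen_preimage {g i} (isOpen_discrete _)
  obtain ⟨t, ht⟩ := isCompact_univ.elim_finite_subcover _ hopen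
    (fun g _ => Set.mem_iUnion.2 ⟨g, fun _ _ => rfl⟩)
  refine ⟨t.biUnion s, Finset.finite_toSet _, fun g h hgh => ?_⟩
  obtain ⟨e, he, hg⟩ := Set.mem_iUnion₂.1 (ht (Set.mem_univ g))
  rw [hs e g hg, hs e h fun i hi => ?_]
  rw [← hgh i (Finset.mem_coe.2 (Finset.mem_biUnion.2 ⟨e, he, hi⟩)), hg i hi]

variable {P : Type a} [LinearOrder P] {C : P → Type b} [∀ x, CommGroup (C x)]
  [∀ x, Fintype (C x)] [∀ x, TopologicalSpace (C x)] [∀ x, DiscreteTopology (C x)]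
  {R : Type c} [CommRing R] [TopologicalSpace R] [DiscreteTopology R] (E : EulerData C R)

/-- The map on cohomology induced by `transition`. -/
noncomputable def trans {Q Q' : Set P} (h : Q ⊆ Q') (n : ℕ) :
    coh.{c, max a b, c} (E.distRep Q) n →ₗ[R] coh.{c, max a b, c} (E.distRep Q') n :=
  cohMap.{c, max a b, c} (restriction (C := C) h) (E.transition h) n

lemma transition_transition {Q Q' Q'' : Set P} (h : Q ⊆ Q') (h' : Q' ⊆ Q'')
    (m : E.distRep Q) : (E.transition h').hom ((E.transition h).hom m) =
      (E.transition (h.trans h')).hom m := by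
  revert m
  intro (m : E.spanOf Q (within Q))
  refine Subtype.ext ?_
  change E.quotMap h' (E.quotMap h m.1) = E.quotMap (h.trans h') m.1
  obtain ⟨n, hn⟩ := Submodule.mkQ_surjective _ m.1
  rw [← hn]
  rfl

lemma trans_trans {Q Q' Q'' : Set P} (h : Q ⊆ Q') (h' : Q' ⊆ Q'') (n : ℕ)
    (ξ : coh.{c, max a b, c} (E.distRep Q) n) :
    E.trans h' n (E.trans h n ξ) = E.trans (h.trans h') n ξ :=
  cohMap_cohMap.{c, max a b, c} (restriction (C := C) h) (restriction (C := C) h')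
    (restriction (C := C) (h.trans h')) rfl (E.transition h) (E.transition h')
    (E.transition (h.trans h')) (fun m => (E.transition_transition h h' m).symm) n ξ

lemma trans_refl {Q : Set P} (h : Q ⊆ Q) (n : ℕ) (ξ : coh.{c, max a b, c} (E.distRep Q) n) :
    E.trans h n ξ = ξ := by
  have : E.transition h = 𝟙 (E.distRep Q) := hom_ext_apply <| by
    intro (m : E.spanOf Q (within Q))
    refine Subtype.ext ?_
    change E.quotMap h m.1 = m.1
    obtain ⟨n, hn⟩ := Submodule.mkQ_surjective _ m.1
    rw [← hn]
    rfl
  refine Eq.trans ?_ (cohMap_id.{c, max a b, c} (E.distRep Q) n ξ)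
  unfold trans
  rw [this]
  rfl

section Union

variable {c : Set (Set P)} (hne : c.Nonempty) (hc : DirectedOn (· ⊆ ·) c) {Q : Set P}
  (hQ : ⋃₀ c = Q)

/-- The map on the modules of the standard resolution induced by `transition`. -/
noncomputable def resTrans {Q Q' : Set P} (h : Q ⊆ Q') (n : ℕ) :
    resolutionX.{c, max a b, c} (E.distRep Q) n → resolutionX.{c, max a b, c} (E.distRep Q') n :=
  (ContinuousCohomology.resolutionMap.{c, max a b, c} (restriction (C := C) h)
    (E.transition h) n).hom

lemma resTrans_resTrans {Q Q' Q'' : Set P} (h : Q ⊆ Q') (h' : Q' ⊆ Q'') (n : ℕ)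
    (x : resolutionX.{c, max a b, c} (E.distRep Q) n) :
    E.resTrans h' n (E.resTrans h n x) = E.resTrans (h.trans h') n x :=
  resolutionMap_resolutionMap.{c, max a b, c} (restriction (C := C) h) (restriction (C := C) h')
    (restriction (C := C) (h.trans h')) (fun _ => rfl) (E.transition h) (E.transition h')
    (E.transition (h.trans h')) (fun m => (E.transition_transition h h' m).symm) n x

include hQ in
lemma subset_of_mem {Q₀ : Set P} (h : Q₀ ∈ c) : Q₀ ⊆ Q := hQ ▸ Set.subset_sUnion_of_mem h

include hne hc hQ

lemma exists_subset_of_finite {s : Set P} (hs : s.Finite) (hsQ : s ⊆ Q) : ∃ Q₀ ∈ c, s ⊆ Q₀ :=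
  hc.exists_mem_subset_of_finite_of_subset_sUnion hne hs (hQ.symm ▸ hsQ)

/-- Every element of the distribution of a directed union comes from a member of the union. -/
lemma exists_mem_quotMap_eq {m : E.Quot Q} (hm : m ∈ E.spanOf Q (within Q)) :
    ∃ Q₀, ∃ h : Q₀ ∈ c, ∃ m₀ ∈ E.spanOf Q₀ (within Q₀), E.quotMap (subset_of_mem hQ h) m₀ = m := by
  rw [spanOf] at hm
  induction hm using Submodule.span_induction with
  | mem m h =>
    obtain ⟨d, hd, rfl⟩ := h
    obtain ⟨Q₀, h, hQ₀⟩ := exists_subset_of_finite hne hc hQ (finite_support d) hd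
    exact ⟨Q₀, h, _, E.cls_mem_spanOf hQ₀, E.quotMap_cls _ d⟩
  | zero =>
    obtain ⟨Q₀, h⟩ := hne
    exact ⟨Q₀, h, 0, zero_mem _, map_zero _⟩
  | add m m' _ _ hm hm' =>
    obtain ⟨Q₁, h₁, m₁, hm₁, rfl⟩ := hm
    obtain ⟨Q₂, h₂, m₂, hm₂, rfl⟩ := hm'
    obtain ⟨Q₀, h, h₁₀, h₂₀⟩ := hc Q₁ h₁ Q₂ h₂
    refine ⟨Q₀, h, _, add_mem (E.quotMap_mem h₁₀ hm₁) (E.quotMap_mem h₂₀ hm₂), ?_⟩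
    obtain ⟨m₁, rfl⟩ := Submodule.mkQ_surjective _ m₁
    obtain ⟨m₂, rfl⟩ := Submodule.mkQ_surjective _ m₂
    rw [map_add]
    rfl
  | smul r m _ hm =>
    obtain ⟨Q₁, h₁, m₁, hm₁, rfl⟩ := hm
    exact ⟨Q₁, h₁, _, Submodule.smul_mem _ r hm₁, map_smul _ _ _⟩

/-- Every cochain with values in the distribution of a directed union comes from a member of the
union. -/
lemma exists_resTrans_eq (n : ℕ) : ∀ x : resolutionX.{c, max a b, c} (E.distRep Q) n,
    ∃ Q₀, ∃ h : Q₀ ∈ c, ∃ x₀, E.resTrans (subset_of_mem hQ h) n x₀ = x := by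
  induction n with
  | zero =>
    intro (m : E.spanOf Q (within Q))
    obtain ⟨Q₀, h, m₀, hm₀, hm⟩ := E.exists_mem_quotMap_eq hne hc hQ m.2
    exact ⟨Q₀, h, (⟨m₀, hm₀⟩ : E.spanOf Q₀ (within Q₀)), Subtype.ext hm⟩
  | succ n ih =>
    intro (F : C(∀ x : Q, C x, resolutionX.{c, max a b, c} (E.distRep Q) n))
    -- the values of `F` come from a common member of the union
    choose q hq v hv using ih
    have hfin : (Set.range F).Finite := (isCompact_range F.continuous).finite_of_discrete
    obtain ⟨Q₁, h₁, hQ₁⟩ : ∃ Q₁ ∈ c, ∀ y ∈ Set.range F, q y ⊆ Q₁ := by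
      generalize Set.range F = s at hfin
      induction s, hfin using Set.Finite.induction_on with
      | empty =>
        obtain ⟨Q₀, h⟩ := hne
        exact ⟨Q₀, h, fun y hy => hy.elim⟩
      | @insert y s _ _ ih =>
        obtain ⟨Q₁, h₁, hQ₁⟩ := ih
        obtain ⟨Q₂, h₂, h₁₂, hy⟩ := hc Q₁ h₁ (q y) (hq y)
        refine ⟨Q₂, h₂, fun y' hy' => ?_⟩
        rcases hy' with rfl | hy'
        · exact hy
        · exact (hQ₁ y' hy').trans h₁₂
    -- `F` depends only on the coordinates in a member of the union
    obtain ⟨s, hs, hF⟩ := exists_finite_dependsOn F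
    obtain ⟨Q₂, h₂, hQ₂⟩ := exists_subset_of_finite hne hc hQ (hs.image Subtype.val)
      (by rintro _ ⟨y, _, rfl⟩; exact y.2)
    obtain ⟨Q₀, h₀, h₁₀, h₂₀⟩ := hc Q₁ h₁ Q₂ h₂
    have h₀Q := subset_of_mem hQ h₀
    classical
    let lift : resolutionX.{c, max a b, c} (E.distRep Q) n →
        resolutionX.{c, max a b, c} (E.distRep Q₀) n := fun y =>
      if hy : y ∈ Set.range F then E.resTrans ((hQ₁ y hy).trans h₁₀) n (v y) else 0
    have hlift : ∀ g, E.resTrans h₀Q n (lift (F g)) = F g := fun g => by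
      have hg : F g ∈ Set.range F := ⟨g, rfl⟩
      rw [show lift (F g) = _ from dif_pos hg, resTrans_resTrans]
      exact hv (F g)
    let ext : C(∀ x : Q₀, C x, ∀ x : Q, C x) :=
      ⟨fun g x => extend Q₀ g x, continuous_pi fun x => by
        by_cases hx : x.1 ∈ Q₀
        · simp_rw [extend_apply _ hx]
          exact continuous_apply _
        · simp_rw [extend_apply_of_notMem _ hx]
          exact continuous_const⟩
    refine ⟨Q₀, h₀, (⟨fun g => lift (F (ext g)), (continuous_of_discreteTopology (f := lift)).comp
      (F.continuous.comp ext.continuous)⟩ :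
        C(∀ x : Q₀, C x, resolutionX.{c, max a b, c} (E.distRep Q₀) n)), ?_⟩
    refine ContinuousMap.ext fun g => ?_
    refine (hlift (ext (restriction h₀Q g))).trans (hF _ _ fun x hx => ?_)
    exact extend_apply _ (h₂₀ (hQ₂ ⟨x, hx, rfl⟩))

/-- Every cohomology class of a directed union comes from a member of the union. -/
lemma exists_trans_eq (n : ℕ) (ξ : coh.{c, max a b, c} (E.distRep Q) n) :
    ∃ Q₀, ∃ h : Q₀ ∈ c, ∃ ξ₀, E.trans (subset_of_mem hQ h) n ξ₀ = ξ := by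
  obtain ⟨⟨⟨z, hz⟩, hz'⟩, rfl⟩ := cocycleClass_surjective _ _ ξ
  obtain ⟨Q₀, h, z₀, rfl⟩ := E.exists_resTrans_eq hne hc hQ (n + 1) z
  have h₀Q := subset_of_mem hQ h
  have hz₀ : z₀ ∈ (resolutionX.{c, max a b, c} (E.distRep Q₀) (n + 1)).ρ.invariants :=
    mem_invariants_of_resolutionMap.{c, max a b, c} (restriction_surjective h₀Q)
      (E.transition_injective h₀Q) (n + 1) hz
  have hz₀' : (⟨z₀, hz₀⟩ : (resolutionX.{c, max a b, c} (E.distRep Q₀) (n + 1)).ρ.invariants) ∈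
      LinearMap.ker ((cochains.{c, max a b, c} (E.distRep Q₀)).d n (n + 1)).hom := by
    refine cochainMap_injective.{c, max a b, c} (restriction_surjective h₀Q)
      (E.transition_injective h₀Q) (n + 1) ?_
    have h1 := congr($((cochainMap.{c, max a b, c} (restriction (C := C) h₀Q)
      (E.transition h₀Q)).comm n (n + 1)).hom ⟨z₀, hz₀⟩)
    simp only [ModuleCat.hom_comp] at h1
    rw [map_zero]
    exact h1.symm.trans hz'
  exact ⟨Q₀, h, cocycleClass _ n ⟨_, hz₀'⟩, homologyMap_cocycleClass _ _ _⟩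

/-- A class that vanishes in the cohomology of a directed union vanishes in that of a member. -/
lemma exists_trans_eq_zero (n : ℕ) {Q₀ : Set P} (h₀ : Q₀ ∈ c)
    (ξ : coh.{c, max a b, c} (E.distRep Q₀) n) (hξ : E.trans (subset_of_mem hQ h₀) n ξ = 0) :
    ∃ Q₁ ∈ c, ∃ h : Q₀ ⊆ Q₁, E.trans h n ξ = 0 := by
  obtain ⟨z, rfl⟩ := cocycleClass_surjective _ _ ξ
  have hξ' := (homologyMap_cocycleClass _ _ z).symm.trans hξ
  rw [cocycleClass_eq_zero_iff _ _ n rfl] at hξ'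
  obtain ⟨⟨w, hw⟩, hwz⟩ := hξ'
  obtain ⟨Q₁, h₁, w₁, hw₁⟩ := E.exists_resTrans_eq hne hc hQ _ w
  obtain ⟨Q₂, h₂, h₀₂, h₁₂⟩ := hc Q₀ h₀ Q₁ h₁
  have h₂Q := subset_of_mem hQ h₂
  refine ⟨Q₂, h₂, h₀₂, (homologyMap_cocycleClass _ _ z).trans ?_⟩
  rw [cocycleClass_eq_zero_iff _ _ n rfl]
  rw [← E.resTrans_resTrans h₁₂ h₂Q] at hw₁
  have hw₂ : E.resTrans h₁₂ _ w₁ ∈ (resolutionX.{c, max a b, c} (E.distRep Q₂) _).ρ.invariants :=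
    mem_invariants_of_resolutionMap.{c, max a b, c} (restriction_surjective h₂Q)
      (E.transition_injective h₂Q) _ (x := E.resTrans h₁₂ _ w₁) (by
        change E.resTrans h₂Q _ (E.resTrans h₁₂ _ w₁) ∈ _
        rw [hw₁]
        exact hw)
  refine ⟨⟨_, hw₂⟩, cochainMap_injective.{c, max a b, c} (restriction_surjective h₂Q)
      (E.transition_injective h₂Q) n ?_⟩
  have h1 := congr($((cochainMap.{c, max a b, c} (restriction (C := C) h₂Q)
      (E.transition h₂Q)).comm ((ComplexShape.up ℕ).prev n) n).hom ⟨_, hw₂⟩)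
  simp only [ModuleCat.hom_comp] at h1
  refine h1.symm.trans (Eq.trans ?_ (hwz.trans ?_))
  · exact congrArg ((cochains.{c, max a b, c} (E.distRep Q)).d _ n).hom
      (Subtype.ext hw₁ : (⟨_, _⟩ : (resolutionX.{c, max a b, c} (E.distRep Q) _).ρ.invariants) = ⟨w, hw⟩)
  · refine Subtype.ext ?_
    exact (E.resTrans_resTrans h₀₂ h₂Q (n + 1) z.1.1).symm

end Union

end EulerData

/-! ### The index set and the basis over all primes -/

/-- The pairs `(y, w)` indexing the basis elements of degree `n` for the primes in `Q`. The
squarefree element `y` is encoded as a finite set of primes, and the degree condition `deg w - deg y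
= n` is stated without subtraction. -/
@[ext] structure GradedIndex {P : Type*} (Q : Set P) (n : ℕ) where
  y : Finset P
  w : P →₀ ℕ
  y_subset : y ⊆ w.support
  support_subset : ∀ x, w x ≠ 0 → x ∈ Q
  degree : n + y.card = w.degree

namespace GradedIndex

variable {P : Type*} {Q : Set P} {n : ℕ}

/-- The inclusion of index sets. -/
def incl {Q' : Set P} (h : Q ⊆ Q') (i : GradedIndex Q n) : GradedIndex Q' n :=
  ⟨i.y, i.w, i.y_subset, fun x hx => h (i.support_subset x hx), i.degree⟩

lemma incl_injective {Q' : Set P} (h : Q ⊆ Q') : Function.Injective (incl (n := n) h) :=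
  fun _ _ hij => GradedIndex.ext congr(($hij).y) congr(($hij).w)

lemma sigma_ext {m m' : ℕ} {i : GradedIndex Q m} {i' : GradedIndex Q m'} (hy : i.y = i'.y)
    (hw : i.w = i'.w) : (⟨m, i⟩ : Σ m, GradedIndex Q m) = ⟨m', i'⟩ := by
  have h : m = m' := by
    have := i.degree
    have := i'.degree
    rw [← hy, ← hw] at this
    omega
  subst h
  rw [GradedIndex.ext hy hw]

variable [DecidableEq P] {x : P}

lemma add_single_apply_of_ne (w : P →₀ ℕ) {y : P} (h : y ≠ x) (k : ℕ) :
    (w + Finsupp.single x k) y = w y := by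
  rw [Finsupp.add_apply, Finsupp.single_eq_of_ne h, add_zero]

/-- The index obtained by removing `x` from `y` and `w`, in the degree that results. -/
noncomputable def lower (i : GradedIndex (insert x Q) n) :
    GradedIndex Q ((i.w.erase x).degree - (i.y.erase x).card) where
  y := i.y.erase x
  w := i.w.erase x
  y_subset y hy := by
    rw [Finsupp.support_erase]
    exact Finset.erase_subset_erase x i.y_subset hy
  support_subset y hy := by
    by_cases hyx : y = x
    · subst hyx
      exact absurd Finsupp.erase_same hy
    · rw [Finsupp.erase_ne hyx] at hy
      exact (i.support_subset y hy).resolve_left hyx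
  degree := by
    refine Nat.sub_add_cancel ?_
    rw [Finsupp.degree_apply, Finsupp.support_erase]
    refine (Finset.card_le_card (Finset.erase_subset_erase x i.y_subset)).trans ?_
    rw [Finset.card_eq_sum_ones]
    refine Finset.sum_le_sum fun y hy => ?_
    rw [Finsupp.erase_ne (Finset.ne_of_mem_erase hy)]
    exact Nat.one_le_iff_ne_zero.2 (Finsupp.mem_support_iff.1 (Finset.mem_of_mem_erase hy))

lemma lower_degree (i : GradedIndex (insert x Q) n) :
    (i.w.erase x).degree - (i.y.erase x).card + (i.y.erase x).card + i.w x = n + i.y.card := by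
  have h1 := (lower i).degree
  have h2 : i.w.degree = (i.w.erase x).degree + i.w x := by
    conv_lhs => rw [← Finsupp.erase_add_single x i.w]
    rw [map_add, Finsupp.degree_single]
  have h3 := i.degree
  change _ + (i.y.erase x).card = (i.w.erase x).degree at h1
  omega

variable (hx : x ∉ Q)
include hx

lemma w_apply_eq_zero (i : GradedIndex Q n) : i.w x = 0 :=
  not_not.1 fun h => hx (i.support_subset x h)

lemma notMem_y (i : GradedIndex Q n) : x ∉ i.y := fun h =>
  Finsupp.mem_support_iff.1 (i.y_subset h) (w_apply_eq_zero hx i)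

lemma add_single_apply_same (i : GradedIndex Q n) (k : ℕ) : (i.w + Finsupp.single x k) x = k := by
  rw [Finsupp.add_apply, Finsupp.single_eq_same, w_apply_eq_zero hx, zero_add]

/-- The index obtained by multiplying `w` by the positive power of `x` that raises the degree to
`n`. -/
noncomputable def raise (i : Below (GradedIndex Q) n) : GradedIndex (insert x Q) n where
  y := i.1.2.y
  w := i.1.2.w + Finsupp.single x (n - i.1.1)
  y_subset y hy := by
    have hyx : y ≠ x := by rintro rfl; exact notMem_y hx _ hy
    rw [Finsupp.mem_support_iff, add_single_apply_of_ne _ hyx]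
    exact Finsupp.mem_support_iff.1 (i.1.2.y_subset hy)
  support_subset y hy := by
    by_cases hyx : y = x
    · exact Or.inl hyx
    · rw [add_single_apply_of_ne _ hyx] at hy
      exact Or.inr (i.1.2.support_subset y hy)
  degree := by
    have h1 := i.1.2.degree
    have h2 := i.2
    rw [map_add, Finsupp.degree_single]
    omega

/-- The index obtained by multiplying `y` by `x`, and `w` by the positive power of `x` for which the
degree becomes `n`. -/
noncomputable def raise' (i : Below (GradedIndex Q) (n + 1)) : GradedIndex (insert x Q) n where
  y := insert x i.1.2.y
  w := i.1.2.w + Finsupp.single x (n + 1 - i.1.1)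
  y_subset y hy := by
    rw [Finsupp.mem_support_iff]
    by_cases hyx : y = x
    · subst hyx
      rw [add_single_apply_same hx]
      have := i.2
      omega
    · rw [add_single_apply_of_ne _ hyx]
      exact Finsupp.mem_support_iff.1 (i.1.2.y_subset (Finset.mem_of_mem_insert_of_ne hy hyx))
  support_subset y hy := by
    by_cases hyx : y = x
    · exact Or.inl hyx
    · rw [add_single_apply_of_ne _ hyx] at hy
      exact Or.inr (i.1.2.support_subset y hy)
  degree := by
    have h1 := i.1.2.degree
    have h2 := i.2
    rw [map_add, Finsupp.degree_single, Finset.card_insert_of_notMem (notMem_y hx _)]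
    omega

/-- The indices for `insert x Q`, sorted by whether `x` divides `w` and `y`: not dividing `w`,
dividing `w` but not `y`, or dividing both. -/
noncomputable def insertEquiv : (GradedIndex Q n ⊕ Below (GradedIndex Q) n) ⊕
    Below (GradedIndex Q) (n + 1) ≃ GradedIndex (insert x Q) n :=
  Equiv.ofBijective (Sum.elim (Sum.elim (incl (Set.subset_insert x Q)) (raise hx)) (raise' hx)) <| by
    have hwx : ∀ i : Below (GradedIndex Q) n, (raise hx i).w x ≠ 0 := fun i => by
      change (i.1.2.w + Finsupp.single x (n - i.1.1)) x ≠ 0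
      rw [add_single_apply_same hx]
      have := i.2
      omega
    have hw : ∀ {m m' k k' : ℕ} (i : GradedIndex Q m) (i' : GradedIndex Q m'),
        i.w + Finsupp.single x k = i'.w + Finsupp.single x k' → i.w = i'.w := fun i i' h => by
      ext y
      by_cases hy : y = x
      · subst hy; rw [w_apply_eq_zero hx, w_apply_eq_zero hx]
      · have := DFunLike.congr_fun h y
        rwa [add_single_apply_of_ne _ hy, add_single_apply_of_ne _ hy] at this
    constructor
    · rintro ((i | i) | i) ((i' | i') | i') h
      · exact congrArg _ (congrArg _ (incl_injective (Set.subset_insert x Q) h))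
      · refine absurd ?_ (hwx i')
        exact (DFunLike.congr_fun (congrArg GradedIndex.w h) x).symm.trans (w_apply_eq_zero hx i)
      · refine absurd ?_ (notMem_y hx i)
        exact (congrArg GradedIndex.y h : i.y = insert x i'.1.2.y) ▸ Finset.mem_insert_self x _
      · refine absurd ?_ (hwx i)
        exact (DFunLike.congr_fun (congrArg GradedIndex.w h) x).trans (w_apply_eq_zero hx i')
      · exact congrArg _ (congrArg _ (Subtype.ext (sigma_ext (congrArg GradedIndex.y h :)
          (hw _ _ (congrArg GradedIndex.w h)))))
      · refine absurd ?_ (notMem_y hx i.1.2)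
        exact (congrArg GradedIndex.y h : i.1.2.y = insert x i'.1.2.y) ▸ Finset.mem_insert_self x _
      · refine absurd ?_ (notMem_y hx i')
        exact (congrArg GradedIndex.y h : insert x i.1.2.y = i'.y) ▸ Finset.mem_insert_self x _
      · refine absurd ?_ (notMem_y hx i'.1.2)
        exact (congrArg GradedIndex.y h : insert x i.1.2.y = i'.1.2.y) ▸ Finset.mem_insert_self x _
      · refine congrArg _ (Subtype.ext (sigma_ext ?_ (hw _ _ (congrArg GradedIndex.w h))))
        have h1 : insert x i.1.2.y = insert x i'.1.2.y := congrArg GradedIndex.y h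
        rw [← Finset.erase_insert (notMem_y hx i.1.2), h1, Finset.erase_insert (notMem_y hx i'.1.2)]
    · intro i
      have hd := lower_degree i
      have hwi : ∀ k, k = i.w x → i.w.erase x + Finsupp.single x k = i.w := fun k hk => by
        rw [hk, Finsupp.erase_add_single]
      by_cases hy : x ∈ i.y
      · have hw0 : i.w x ≠ 0 := Finsupp.mem_support_iff.1 (i.y_subset hy)
        have hcard := Finset.card_erase_add_one hy
        refine ⟨Sum.inr ⟨⟨_, lower i⟩, ?_⟩, GradedIndex.ext (Finset.insert_erase hy) (hwi _ ?_)⟩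
        · change (i.w.erase x).degree - (i.y.erase x).card < n + 1
          omega
        · change n + 1 - ((i.w.erase x).degree - (i.y.erase x).card) = _
          omega
      · have hcard : (i.y.erase x).card = i.y.card := by rw [Finset.erase_eq_of_notMem hy]
        by_cases hw0 : i.w x = 0
        · refine ⟨Sum.inl (Sum.inl ⟨i.y, i.w, i.y_subset, fun y hy' => ?_, i.degree⟩), rfl⟩
          refine (i.support_subset y hy').resolve_left ?_
          rintro rfl
          exact hy' hw0
        · refine ⟨Sum.inl (Sum.inr ⟨⟨_, lower i⟩, ?_⟩),
            GradedIndex.ext (Finset.erase_eq_of_notMem hy) (hwi _ ?_)⟩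
          · change (i.w.erase x).degree - (i.y.erase x).card < n
            omega
          · change n - ((i.w.erase x).degree - (i.y.erase x).card) = _
            omega

lemma insertEquiv_inl_inl (i : GradedIndex Q n) :
    insertEquiv hx (Sum.inl (Sum.inl i)) = incl (Set.subset_insert x Q) i := rfl

end GradedIndex

/-- Compatible bases of the members of a directed union form a basis of the union. -/
lemma exists_basis_of_levels {R N J ι : Type*} [CommRing R] [AddCommGroup N] [Module R N]
    {L : ι → Type*} [∀ a, AddCommGroup (L a)] [∀ a, Module R (L a)] (f : ∀ a, L a →ₗ[R] N)
    (hinj : ∀ a, Function.Injective (f a)) (hsurj : ∀ ξ, ∃ a x, f a x = ξ) {K : ι → Type*}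
    (b : ∀ a, Module.Basis (K a) R (L a)) (e : ∀ a, K a → J)
    (he : ∀ a, Function.Injective (e a)) (hfin : ∀ s : Finset J, ∃ a, (s : Set J) ⊆ Set.range (e a))
    (v : J → N) (hv : ∀ a k, v (e a k) = f a (b a k)) :
    ∃ B : Module.Basis J R N, ∀ j, B j = v j := by
  have hli : LinearIndependent R v := by
    rw [linearIndependent_iff_finset_linearIndependent]
    intro s
    obtain ⟨a, ha⟩ := hfin s
    have h1 : LinearIndependent R fun k => v (e a k) := by
      simp_rw [hv]
      exact (b a).linearIndependent.map' (f a) (LinearMap.ker_eq_bot.2 (hinj a))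
    exact ((linearIndepOn_range_iff (he a) v).2 h1).mono ha
  have hsp : ⊤ ≤ Submodule.span R (Set.range v) := by
    intro ξ _
    obtain ⟨a, x, rfl⟩ := hsurj ξ
    have h := Submodule.mem_map_of_mem (f := f a) ((b a).mem_span x)
    rw [Submodule.map_span] at h
    refine Submodule.span_mono ?_ h
    rintro _ ⟨_, ⟨k, rfl⟩, rfl⟩
    exact ⟨e a k, hv a k⟩
  exact ⟨Module.Basis.mk hli hsp, Module.Basis.mk_apply hli hsp⟩

namespace EulerData

variable {P : Type a} [LinearOrder P] {C : P → Type b} [∀ x, CommGroup (C x)]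
  [∀ x, Fintype (C x)] [∀ x, TopologicalSpace (C x)] [∀ x, DiscreteTopology (C x)]
  {R : Type c} [CommRing R] [TopologicalSpace R] [DiscreteTopology R] (E : EulerData C R)

section Empty

lemma quotRep_extend_empty (g : ∀ x : (∅ : Set P), C x) (m : E.distRep ∅) :
    (E.distRep ∅).ρ g m = m := by
  rw [Subsingleton.elim g 1, rho_one]

/-- Evaluation at `1`, which is equivariant because the group at the empty set of primes is trivial.
-/
noncomputable def evalOne : (E.distRep ∅).coind₁ ⟶ E.distRep ∅ :=
  have : IsSmooth (E.distRep ∅).coind₁ := isSmooth_coind₁.{c, max a b, c} _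
  homOf (X := (E.distRep ∅).coind₁) (Y := E.distRep ∅)
    { toFun := fun F => (show C(∀ x : (∅ : Set P), C x, E.distRep ∅) from F) 1
      map_add' := fun _ _ => rfl
      map_smul' := fun _ _ => rfl } fun g F => by
    obtain rfl : g = 1 := Subsingleton.elim _ _
    rw [rho_one, rho_one]

lemma coh_empty_succ (n : ℕ) (ξ : coh.{c, max a b, c} (E.distRep ∅) (n + 1)) : ξ = 0 :=
  coh_succ_eq_zero_of_retraction.{c, max a b, c} (E.distRep ∅) E.evalOne (fun _ => rfl) n ξ

/-- The empty point, as an element of the distribution for the empty set of primes. -/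
noncomputable def emptyPoint : E.spanOf ∅ (within ∅) :=
  ⟨E.cls ∅ 0, E.cls_mem_spanOf fun _ hx => (hx rfl).elim⟩

/-- The distribution for the empty set of primes is free of rank one on the empty point. -/
lemma smul_emptyPoint_bijective :
    Function.Bijective fun r : R => r • E.emptyPoint := by
  constructor
  · intro r s h
    have h1 : r • E.cls ∅ 0 = s • E.cls ∅ 0 := congrArg Subtype.val h
    have h2 := congrArg (E.normalLift ∅) h1
    have h3 : bad (∅ : Set P) (0 : Point C) = ∅ :=
      Set.eq_empty_of_forall_notMem fun x hx => hx.1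
    rw [map_smul, map_smul, normalLift_cls, normalForm_of_bad_eq_empty E h3] at h2
    simpa using DFunLike.congr_fun h2 0
  · rintro ⟨m, hm⟩
    rw [spanOf] at hm
    have : E.cls ∅ '' within ∅ = {E.cls ∅ 0} := by
      refine Set.Subset.antisymm ?_ (Set.singleton_subset_iff.2 ⟨0, fun x hx => (hx rfl).elim, rfl⟩)
      rintro _ ⟨d, hd, rfl⟩
      rw [Set.mem_singleton_iff]
      congr 1
      ext x : 1
      exact not_not.1 fun h => hd x h
    rw [this] at hm
    obtain ⟨r, hr⟩ := Submodule.mem_span_singleton.1 hm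
    exact ⟨r, Subtype.ext hr⟩

lemma exists_basis_empty (n : ℕ) :
    Nonempty (Module.Basis (GradedIndex (∅ : Set P) n) R (coh.{c, max a b, c} (E.distRep ∅) n)) := by
  have hw : ∀ {m} (i : GradedIndex (∅ : Set P) m), i.w = 0 := fun i => by
    ext; exact not_not.1 fun h => i.support_subset _ h
  have hy : ∀ {m} (i : GradedIndex (∅ : Set P) m), i.y = ∅ := fun i => by
    have := i.y_subset
    rwa [hw i, Finsupp.support_zero, Finset.subset_empty] at this
  cases n with
  | zero =>
    let e₁ : R →ₗ[R] (E.distRep ∅).ρ.invariants :=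
      { toFun := fun r => ⟨(r • E.emptyPoint : E.spanOf ∅ (within ∅)),
          fun g => E.quotRep_extend_empty g _⟩
        map_add' := fun r s => Subtype.ext (add_smul r s E.emptyPoint)
        map_smul' := fun r s => Subtype.ext (mul_smul r s E.emptyPoint) }
    have he₁ : Function.Bijective e₁ := by
      constructor
      · exact fun r s h => E.smul_emptyPoint_bijective.1 (congrArg Subtype.val h)
      · intro m
        obtain ⟨r, hr⟩ := E.smul_emptyPoint_bijective.2 m.1
        exact ⟨r, Subtype.ext hr⟩
    let e₂ : (E.distRep ∅).ρ.invariants →ₗ[R] coh.{c, max a b, c} (E.distRep ∅) 0 :=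
      { toFun := invariantClass.{c, max a b, c} (E.distRep ∅)
        map_add' := fun x y => (cocycleClass (cochains (E.distRep ∅)) 0).map_add
          ⟨_, const_mem_ker (E.distRep ∅) x⟩ ⟨_, const_mem_ker (E.distRep ∅) y⟩
        map_smul' := fun r x => (cocycleClass (cochains (E.distRep ∅)) 0).map_smul r
          ⟨_, const_mem_ker (E.distRep ∅) x⟩ }
    have he₂ : Function.Bijective e₂ :=
      ⟨invariantClass_injective.{c, max a b, c} (E.distRep ∅),
        invariantClass_surjective.{c, max a b, c} (E.distRep ∅)⟩
    let _ : Unique (GradedIndex (∅ : Set P) 0) :=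
      { default := ⟨∅, 0, by simp, fun x hx => (hx rfl).elim, by simp⟩
        uniq := fun i => GradedIndex.ext (hy i) (hw i) }
    exact ⟨(Module.Basis.singleton _ R).map ((LinearEquiv.ofBijective e₁ he₁).trans
      (LinearEquiv.ofBijective e₂ he₂))⟩
  | succ n =>
    have : Subsingleton (coh.{c, max a b, c} (E.distRep ∅) (n + 1)) :=
      ⟨fun ξ η => by rw [E.coh_empty_succ n ξ, E.coh_empty_succ n η]⟩
    have : IsEmpty (GradedIndex (∅ : Set P) (n + 1)) :=
      ⟨fun i => by
        have := i.degree
        rw [hy i, hw i] at this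
        simp at this⟩
    exact ⟨Module.Basis.empty _⟩

end Empty

/-- A set of primes together with bases of the cohomology of its universal norm distribution. These
are the objects to which Zorn's lemma is applied. -/
structure PartialBasis where
  primes : Set P
  basis : ∀ n, Module.Basis (GradedIndex primes n) R (coh.{c, max a b, c} (E.distRep primes) n)

/-- A partial basis extends another one if its basis elements for the old indices are the images of
the old basis elements. The bases are part of the data because compatible bases are what passes to
unions. -/
def PartialBasis.Extends (s t : E.PartialBasis) : Prop :=
  ∃ h : s.primes ⊆ t.primes, ∀ n i, t.basis n (i.incl h) = E.trans h n (s.basis n i)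

variable {E}

lemma PartialBasis.Extends.trans {s t u : E.PartialBasis} (h : s.Extends E t) (h' : t.Extends E u) :
    s.Extends E u := by
  obtain ⟨h, hb⟩ := h
  obtain ⟨h', hb'⟩ := h'
  refine ⟨h.trans h', fun n i => ?_⟩
  rw [← E.trans_trans h h', ← hb, ← hb']
  rfl

lemma PartialBasis.Extends.refl (s : E.PartialBasis) : s.Extends E s :=
  ⟨subset_rfl, fun n _ => (E.trans_refl _ n _).symm⟩

/-- Along an extension of partial bases the transition map is injective, as it sends a basis to part
of a basis. -/
lemma PartialBasis.Extends.trans_injective {s t : E.PartialBasis} (h : s.Extends E t)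
    (hst : s.primes ⊆ t.primes) (n : ℕ) : Function.Injective (E.trans hst n) := by
  obtain ⟨h, hb⟩ := h
  rw [injective_iff_map_eq_zero]
  intro ξ hξ
  have hli : LinearIndependent R fun i => E.trans hst n (s.basis n i) := by
    have : (fun i => E.trans hst n (s.basis n i)) = t.basis n ∘ GradedIndex.incl h :=
      funext fun i => (hb n i).symm
    rw [this]
    exact (t.basis n).linearIndependent.comp _ (GradedIndex.incl_injective h)
  rw [← (s.basis n).linearCombination_repr ξ] at hξ ⊢
  rw [Finsupp.apply_linearCombination] at hξ
  rw [linearIndependent_iff.1 hli _ hξ, map_zero]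

lemma PartialBasis.trans_injective_of_subset {s t : E.PartialBasis} (h : t.Extends E s)
    (hst : s.primes ⊆ t.primes) (n : ℕ) : Function.Injective (E.trans hst n) := by
  obtain ⟨h, -⟩ := h
  refine Function.LeftInverse.injective (g := E.trans h n) fun ξ => ?_
  rw [E.trans_trans hst h, E.trans_refl]

/-- A chain of partial bases has an upper bound on the union of the sets of primes. -/
lemma PartialBasis.exists_extends_of_isChain {c : Set E.PartialBasis}
    (hc : IsChain (PartialBasis.Extends E) c) (hne : c.Nonempty) :
    ∃ t, ∀ s ∈ c, PartialBasis.Extends E s t := by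
  let Q : Set P := ⋃₀ (PartialBasis.primes '' c)
  have hne' := hne.image PartialBasis.primes
  have htotal : ∀ s ∈ c, ∀ t ∈ c, s.Extends E t ∨ t.Extends E s := fun s hs t ht => by
    by_cases h : s = t
    · subst h; exact Or.inl (.refl s)
    · exact hc hs ht h
  have hdir : DirectedOn (· ⊆ ·) (PartialBasis.primes '' c) := by
    rintro _ ⟨s, hs, rfl⟩ _ ⟨t, ht, rfl⟩
    rcases htotal s hs t ht with h | h
    · exact ⟨_, ⟨t, ht, rfl⟩, h.1, subset_rfl⟩
    · exact ⟨_, ⟨s, hs, rfl⟩, subset_rfl, h.1⟩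
  have hsub : ∀ s : c, s.1.primes ⊆ Q := fun s => subset_of_mem rfl ⟨s.1, s.2, rfl⟩
  -- two members of the chain give the same class for an index which both of them have
  have hcomp : ∀ n (s t : c) (i : GradedIndex s.1.primes n) (j : GradedIndex t.1.primes n),
      i.incl (hsub s) = j.incl (hsub t) →
      E.trans (hsub s) n (s.1.basis n i) = E.trans (hsub t) n (t.1.basis n j) := by
    have key : ∀ n (s t : c) (i : GradedIndex s.1.primes n) (j : GradedIndex t.1.primes n),
        i.incl (hsub s) = j.incl (hsub t) → s.1.Extends E t.1 →
        E.trans (hsub s) n (s.1.basis n i) = E.trans (hsub t) n (t.1.basis n j) := by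
      rintro n s t i j hij ⟨h, hb⟩
      have : i.incl h = j := GradedIndex.incl_injective (hsub t) hij
      rw [← this, hb, E.trans_trans]
    intro n s t i j hij
    rcases htotal s.1 s.2 t.1 t.2 with h | h
    · exact key n s t i j hij h
    · exact (key n t s j i hij.symm h).symm
  -- a class that dies in the union dies in some member of the chain, where transition maps are
  -- injective because the member extends, or is extended by, the given one
  have hinj : ∀ n (s : c), Function.Injective (E.trans (hsub s) n) := fun n s => by
    rw [injective_iff_map_eq_zero]
    intro ξ hξ
    obtain ⟨_, ⟨t, ht, rfl⟩, hst, h0⟩ :=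
      E.exists_trans_eq_zero hne' hdir (rfl : _ = Q) n ⟨s.1, s.2, rfl⟩ ξ hξ
    rw [← map_zero (E.trans hst n)] at h0
    rcases htotal s.1 s.2 t ht with h | h
    · exact h.trans_injective hst n h0
    · exact trans_injective_of_subset h hst n h0
  have hlevel : ∀ s : Set P, s.Finite → s ⊆ Q → ∃ t : c, s ⊆ t.1.primes := fun s hs hsQ => by
    obtain ⟨_, ⟨t, ht, rfl⟩, hst⟩ := exists_subset_of_finite hne' hdir (rfl : _ = Q) hs hsQ
    exact ⟨⟨t, ht⟩, hst⟩
  have hindex : ∀ n (i : GradedIndex Q n), ∃ t : c, ∃ j : GradedIndex t.1.primes n,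
      j.incl (hsub t) = i := fun n i => by
    obtain ⟨t, ht⟩ := hlevel i.w.support i.w.support.finite_toSet fun x hx =>
      i.support_subset x (Finsupp.mem_support_iff.1 hx)
    exact ⟨t, ⟨i.y, i.w, i.y_subset, fun x hx => ht (Finsupp.mem_support_iff.2 hx), i.degree⟩, rfl⟩
  choose τ κ hκ using hindex
  have hB : ∀ n, ∃ B : Module.Basis (GradedIndex Q n) R (coh.{c, max a b, c} (E.distRep Q) n),
      ∀ i, B i = E.trans (hsub (τ n i)) n ((τ n i).1.basis n (κ n i)) := fun n => by
    refine exists_basis_of_levels (fun s : c => E.trans (hsub s) n) (hinj n) (fun ξ => ?_)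
      (fun s : c => s.1.basis n) (fun s => GradedIndex.incl (hsub s))
      (fun s => GradedIndex.incl_injective _) (fun s => ?_)
      (fun i => E.trans (hsub (τ n i)) n ((τ n i).1.basis n (κ n i)))
      fun s i => hcomp n _ _ _ _ (hκ n _)
    · obtain ⟨_, ⟨t, ht, rfl⟩, ξ₀, h⟩ := E.exists_trans_eq hne' hdir (rfl : _ = Q) n ξ
      exact ⟨⟨t, ht⟩, ξ₀, h⟩
    · classical
      obtain ⟨t, ht⟩ := hlevel (s.biUnion fun i => i.w.support) (Finset.finite_toSet _) fun x hx => by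
        obtain ⟨i, -, hi⟩ := Finset.mem_biUnion.1 (Finset.mem_coe.1 hx)
        exact i.support_subset x (Finsupp.mem_support_iff.1 hi)
      refine ⟨t, fun i hi => ⟨⟨i.y, i.w, i.y_subset, fun x hx => ht ?_, i.degree⟩, rfl⟩⟩
      exact Finset.mem_coe.2 (Finset.mem_biUnion.2 ⟨i, hi, Finsupp.mem_support_iff.2 hx⟩)
  choose B hB using hB
  refine ⟨⟨Q, B⟩, fun s hs => ⟨hsub ⟨s, hs⟩, fun n i => ?_⟩⟩
  rw [hB]
  exact hcomp n _ ⟨s, hs⟩ _ _ (hκ n _)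

variable (E)

/-- The cohomology of the universal norm distribution on all primes has a basis indexed by the pairs
`(y, w)`: by Zorn's lemma there is a maximal partial basis, and by `exists_basis_insert` its set of
primes contains every prime. -/
theorem exists_basis_univ (hcyc : ∀ x, IsCyclic (C x))
    (hcard : ∀ x, (Fintype.card (C x) : R) = 0) (hp : ∀ x, (E.poly x).eval 1 = 0) (n : ℕ) :
    Nonempty (Module.Basis (GradedIndex (Set.univ : Set P) n) R
      (coh.{c, max a b, c} (E.distRep Set.univ) n)) := by
  obtain ⟨t, ht⟩ := exists_maximal_of_chains_bounded (r := PartialBasis.Extends E) (fun c hc => by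
    rcases c.eq_empty_or_nonempty with rfl | hne
    · exact ⟨⟨∅, fun n => (E.exists_basis_empty n).some⟩, fun s hs => hs.elim⟩
    · exact PartialBasis.exists_extends_of_isChain hc hne) PartialBasis.Extends.trans
  have huniv : t.primes = Set.univ := by
    refine Set.eq_univ_of_forall fun x => not_not.1 fun hx => hx ?_
    obtain ⟨b, hb⟩ := E.exists_basis_insert hx (hcyc x) (hcard x) (hp x) _ t.basis
    have h : t.Extends E
        ⟨insert x t.primes, fun n => (b n).reindex (GradedIndex.insertEquiv hx)⟩ := by
      refine ⟨Set.subset_insert x _, fun n i => ?_⟩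
      rw [← GradedIndex.insertEquiv_inl_inl hx]
      refine ((b n).reindex_apply _ _).trans ?_
      rw [Equiv.symm_apply_apply, hb]
      rfl
    exact (ht _ h).1 (Set.mem_insert x _)
  exact ⟨huniv ▸ t.basis n⟩

end EulerData

/-! ### The group `G_z` as a product -/

namespace NormSystem

variable {X G : Type*} [Group G] [TopologicalSpace G] (S : NormSystem X G) (z : X → ℕ)

instance commGroupGfin (w : X →₀ ℕ) : CommGroup (S.Gfin w) where
  mul_comm := S.Gfin_comm w

/-- The group `G_{z(x)}` at a prime `x` dividing `z`. -/
abbrev Comp (x : Primes z) : Type _ := S.Gfin (stalk z {x})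

/-- The component at `x` of an element of `G_{z'}`, where `z'` is a stalk of `z` divisible by `x`. -/
noncomputable def comp {s : Finset (Primes z)} {x : Primes z} (hx : x ∈ s) :
    S.Gfin (stalk z s) →* S.Comp z x :=
  S.proj z (Finset.singleton_subset_iff.2 hx)

lemma comp_proj {s t : Finset (Primes z)} (h : s ⊆ t) {x : Primes z} (hx : x ∈ s)
    (a : S.Gfin (stalk z t)) : S.comp z hx (S.proj z h a) = S.comp z (h hx) a := by
  obtain ⟨g, rfl⟩ := QuotientGroup.mk_surjective a
  rfl

/-- The condition `G = H_z H_{z'}` for coprime elements, applied to `z = z' = 1`. -/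
lemma H_zero : S.H 0 = ⊤ := by
  refine eq_top_iff.2 fun g _ => ?_
  obtain ⟨a, ha, b, hb, rfl⟩ := (S.H_mul 0 0 (by simp)).ge (Set.mem_univ g)
  exact mul_mem ha hb

lemma stalk_empty : stalk z ∅ = 0 := Finset.sum_empty

lemma stalk_singleton (x : Primes z) : stalk z {x} = primePart z x.1 := Finset.sum_singleton _ _

section

variable [DecidableEq (Primes z)] {s : Finset (Primes z)} {x : Primes z} (hx : x ∉ s)
include hx

lemma stalk_insert : stalk z (insert x s) = stalk z {x} + stalk z s := by
  rw [stalk_singleton, stalk, Finset.sum_insert hx]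
  rfl

lemma disjoint_support_stalk : Disjoint (stalk z {x}).support (stalk z s).support := by
  rw [Finset.disjoint_left]
  intro y hy hys
  rw [stalk_singleton] at hy
  have hyx : y = x.1 := Finset.mem_singleton.1 (Finsupp.support_single_subset hy)
  subst hyx
  rw [Finsupp.mem_support_iff, stalk, Finsupp.finsetSum_apply] at hys
  refine hys (Finset.sum_eq_zero fun y hy => Finsupp.single_eq_of_ne fun h => hx ?_)
  rwa [Subtype.ext h]

end

/-- An element of `G` belongs to `H_{z'}` if and only if it does so locally at each prime. -/
lemma mem_H_stalk {s : Finset (Primes z)} {g : G} :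
    g ∈ S.H (stalk z s) ↔ ∀ x ∈ s, g ∈ S.H (stalk z {x}) := by
  classical
  induction s using Finset.induction_on with
  | empty => simp [stalk_empty, H_zero]
  | insert x s hx ih =>
    rw [stalk_insert z hx, S.H_add _ _ (disjoint_support_stalk z hx), Subgroup.mem_inf, ih,
      Finset.forall_mem_insert]

lemma eq_of_comp_eq {s : Finset (Primes z)} {a b : S.Gfin (stalk z s)}
    (h : ∀ x (hx : x ∈ s), S.comp z hx a = S.comp z hx b) : a = b := by
  obtain ⟨g, rfl⟩ := QuotientGroup.mk_surjective a
  obtain ⟨k, rfl⟩ := QuotientGroup.mk_surjective b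
  refine QuotientGroup.eq.2 ((S.mem_H_stalk z).2 fun x hx => ?_)
  exact QuotientGroup.eq.1 (h x hx)

/-- Local elements at finitely many primes can be prescribed by an element of `G`. -/
lemma exists_forall_mk_eq (s : Finset (Primes z)) (f : ∀ x, S.Comp z x) :
    ∃ g : G, ∀ x ∈ s, (g : S.Comp z x) = f x := by
  classical
  induction s using Finset.induction_on with
  | empty => exact ⟨1, by simp⟩
  | insert x s hx ih =>
    obtain ⟨g, hg⟩ := ih
    obtain ⟨k, hk⟩ := QuotientGroup.mk_surjective (f x)
    obtain ⟨a, ha, b, hb, hab⟩ := (S.H_mul _ _ (disjoint_support_stalk z hx)).ge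
      (Set.mem_univ (k⁻¹ * g))
    refine ⟨k * a, Finset.forall_mem_insert _ _ _ |>.2 ⟨?_, fun y hy => ?_⟩⟩
    · rw [← hk]
      exact QuotientGroup.mk_mul_of_mem k ha
    · have h : k * a = g * b⁻¹ := by
        rw [eq_mul_inv_iff_mul_eq, mul_assoc, show a * b = k⁻¹ * g from hab, mul_inv_cancel_left]
      rw [h, ← hg y hy]
      exact QuotientGroup.mk_mul_of_mem g (inv_mem ((S.mem_H_stalk z).1 hb y hy))

lemma exists_comp_eq (s : Finset (Primes z)) (f : ∀ x, S.Comp z x) :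
    ∃ a : S.Gfin (stalk z s), ∀ x (hx : x ∈ s), S.comp z hx a = f x := by
  obtain ⟨g, hg⟩ := S.exists_forall_mk_eq z s f
  exact ⟨g, hg⟩

/-- The components of an element of `G_z`. -/
noncomputable def comps : S.Glim z →* ∀ x : Primes z, S.Comp z x where
  toFun g x := g.1 {x}
  map_one' := rfl
  map_mul' _ _ := rfl

lemma comp_glim (g : S.Glim z) {s : Finset (Primes z)} {x : Primes z} (hx : x ∈ s) :
    S.comp z hx (g.1 s) = S.comps z g x := g.2 _ _ _

/-- The Chinese remainder theorem, in the limit over the finite stalks. -/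
lemma comps_bijective : Function.Bijective (S.comps z) := by
  constructor
  · intro g g' h
    refine Subtype.ext (funext fun s => S.eq_of_comp_eq z fun x hx => ?_)
    rw [comp_glim, comp_glim, h]
  · intro f
    choose a ha using fun s => S.exists_comp_eq z s f
    refine ⟨⟨a, fun s t h => S.eq_of_comp_eq z fun x hx => ?_⟩, funext fun x => ?_⟩
    · rw [comp_proj, ha, ha]
    · rw [← comp_glim S z _ (Finset.mem_singleton_self x)]
      exact ha _ _ _

section Topology

variable [IsTopologicalGroup G]

instance discreteTopology_Gfin (w : X →₀ ℕ) : DiscreteTopology (S.Gfin w) :=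
  QuotientGroup.discreteTopology (S.isOpen_H w)

variable [CompactSpace G]

lemma isClosed_glim : IsClosed (S.Glim z : Set (∀ s : Finset (Primes z), S.Gfin (stalk z s))) := by
  have h : (S.Glim z : Set (∀ s : Finset (Primes z), S.Gfin (stalk z s))) =
      ⋂ (s : Finset (Primes z)) (t : Finset (Primes z)) (h : s ⊆ t),
        {g : ∀ s : Finset (Primes z), S.Gfin (stalk z s) | S.proj z h (g t) = g s} :=
    Set.ext fun g => ⟨fun hg => Set.mem_iInter₂.2 fun s t => Set.mem_iInter.2 fun h => hg s t h,
      fun hg s t h => Set.mem_iInter.1 (Set.mem_iInter₂.1 hg s t) h⟩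
  rw [h]
  refine isClosed_iInter fun s => isClosed_iInter fun t => isClosed_iInter fun h => ?_
  have h1 : Continuous (S.proj z h) := continuous_of_discreteTopology
  exact isClosed_eq (h1.comp (continuous_apply t)) (continuous_apply s)

/-- By the Chinese remainder theorem, `G_z` is the product of its components. -/
noncomputable def glimEquiv : S.Glim z ≃ₜ* ∀ x : (Set.univ : Set (Primes z)), S.Comp z x := by
  let e : S.Glim z ≃ ∀ x : (Set.univ : Set (Primes z)), S.Comp z x :=
    (Equiv.ofBijective _ (S.comps_bijective z)).trans
      ((Equiv.Set.univ (Primes z)).piCongrLeft (S.Comp z)).symm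
  have hc : Continuous e := continuous_pi fun x =>
    (continuous_apply ({x.1} : Finset (Primes z))).comp continuous_subtype_val
  have : CompactSpace (S.Glim z) := isCompact_iff_compactSpace.1 (S.isClosed_glim z).isCompact
  exact
    { e with
      map_mul' := fun _ _ => rfl
      continuous_toFun := hc
      continuous_invFun := (hc.homeoOfEquivCompactToT2).symm.continuous }

end Topology

end NormSystem

/-! ### The module `𝒜_z` in terms of points -/

namespace NormSystem

variable {X G : Type*} [LinearOrder X] [Group G] [TopologicalSpace G] (S : NormSystem X G)

section Points

variable (z : X → ℕ)

/-- The element `[g z']` as a point: its component at `x ∣ z'` is that of `g`. -/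
noncomputable def toPoint (a : S.Apts z) : Point (S.Comp z) :=
  DFinsupp.mk a.supp fun x => ((S.comp z x.2 a.val : S.Comp z x.1) : WithZero (S.Comp z x.1))

variable {z}

lemma toPoint_apply (a : S.Apts z) {x : Primes z} (hx : x ∈ a.supp) :
    S.toPoint z a x = (S.comp z hx a.val : S.Comp z x) := by
  rw [toPoint, DFinsupp.mk_apply]
  exact dif_pos hx

lemma toPoint_apply_of_notMem (a : S.Apts z) {x : Primes z} (hx : x ∉ a.supp) :
    S.toPoint z a x = 0 := by
  rw [toPoint, DFinsupp.mk_apply]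
  exact dif_neg hx

lemma toPoint_apply_eq_zero (a : S.Apts z) {x : Primes z} :
    S.toPoint z a x = 0 ↔ x ∉ a.supp := by
  refine ⟨fun h hx => ?_, S.toPoint_apply_of_notMem a⟩
  rw [S.toPoint_apply a hx] at h
  exact WithZero.coe_ne_zero h

lemma toPoint_injective : Function.Injective (S.toPoint z) := by
  rintro ⟨s, a⟩ ⟨t, b⟩ h
  obtain rfl : s = t := by
    ext x
    have := (S.toPoint_apply_eq_zero ⟨s, a⟩ (x := x)).symm.trans
      (h ▸ S.toPoint_apply_eq_zero ⟨t, b⟩ (x := x))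
    exact not_iff_not.1 this
  refine congrArg _ (S.eq_of_comp_eq z fun x hx => ?_)
  have := DFunLike.congr_fun h x
  rwa [S.toPoint_apply _ hx, S.toPoint_apply _ hx, WithZero.coe_inj] at this

/-- Every point with set of primes `s` comes from an element of the group at the stalk `s`. -/
lemma exists_toPoint_eq (s : Finset (Primes z)) (d : Point (S.Comp z))
    (hd : ∀ x, d x = 0 ↔ x ∉ s) : ∃ a, S.toPoint z ⟨s, a⟩ = d := by
  have hf : ∀ x, ∃ f : S.Comp z x, x ∈ s → d x = f := fun x => by
    by_cases hx : d x = 0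
    · exact ⟨1, fun h => ((hd x).1 hx h).elim⟩
    · obtain ⟨f, hf⟩ := WithZero.ne_zero_iff_exists.1 hx
      exact ⟨f, fun _ => hf.symm⟩
  choose f hf using hf
  obtain ⟨a, ha⟩ := S.exists_comp_eq z s f
  refine ⟨a, DFinsupp.ext fun x => ?_⟩
  by_cases hx : x ∈ s
  · rw [S.toPoint_apply ⟨s, a⟩ hx, hf x hx, ha]
  · rw [S.toPoint_apply_of_notMem ⟨s, a⟩ hx, (hd x).2 hx]

lemma toPoint_surjective : Function.Surjective (S.toPoint z) := fun d => by
  obtain ⟨a, ha⟩ := S.exists_toPoint_eq (finite_support d).toFinset d (by simp)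
  exact ⟨_, ha⟩

/-- The action on the symbols `[g z']` is the action by translation on points. -/
lemma toPoint_smul (g : S.Glim z) (a : S.Apts z) :
    S.toPoint z (g • a) = shift (S.comps z g) (S.toPoint z a) := by
  refine DFinsupp.ext fun x => ?_
  rw [shift_apply]
  by_cases hx : x ∈ a.supp
  · rw [S.toPoint_apply a hx, S.toPoint_apply (g • a) hx, ← WithZero.coe_mul, ← comp_glim S z g hx,
      ← map_mul]
    rfl
  · rw [S.toPoint_apply_of_notMem a hx, S.toPoint_apply_of_notMem (g • a) hx, mul_zero]

end Points

section Linear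

variable [IsTopologicalGroup G] [CompactSpace G]
  {T R : Type*} [CommRing T] [CommRing R] (σ : T →+* R) (z : X → ℕ)

/-- The semilinear map `𝒜_z → R[points]` given by a change of coefficients. -/
noncomputable def toPoints : S.Amod T z →ₛₗ[σ] (Point (S.Comp z) →₀ R) where
  toFun v := (v.mapRange σ (map_zero σ)).mapDomain (S.toPoint z)
  map_add' v w := by rw [Finsupp.mapRange_add (map_add σ), Finsupp.mapDomain_add]
  map_smul' t v := by
    rw [← Finsupp.mapDomain_smul]
    congr 1
    ext a
    simp

lemma toPoints_single (a : S.Apts z) (t : T) :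
    S.toPoints σ z (Finsupp.single a t) = Finsupp.single (S.toPoint z a) (σ t) := by
  change Finsupp.mapDomain _ (Finsupp.mapRange _ _ _) = _
  rw [Finsupp.mapRange_single, Finsupp.mapDomain_single]

lemma toPoints_rhoA (g : S.Glim z) (v : S.Amod T z) :
    S.toPoints σ z (S.rhoA T z g v) =
      EulerData.pointRep (S.Comp z) R (S.comps z g) (S.toPoints σ z v) := by
  induction v using Finsupp.induction_linear with
  | zero => simp
  | add v w hv hw => simp only [map_add, hv, hw]
  | single a t =>
    rw [rhoA_single, toPoints_single, toPoints_single, EulerData.pointRep_single, toPoint_smul]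

variable (p : X → Polynomial T)

/-- The Euler factors `p(x; Fr_x⁻¹)`, with coefficients mapped to `R`. -/
noncomputable def eulerData : EulerData (S.Comp z) R where
  frob x := S.comps z (S.toGlim z (S.Fr x.1)⁻¹)
  poly x := (p x.1).map σ

lemma toPoints_aeval (x : Primes z) (q : Polynomial T) (v : S.Amod T z) :
    S.toPoints σ z (Polynomial.aeval (S.frobInv T z x.1) q v) =
      Polynomial.aeval (EulerData.pointRep (S.Comp z) R ((S.eulerData σ z p).frob x)) (q.map σ)
        (S.toPoints σ z v) := by
  induction q using Polynomial.induction_on' with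
  | add q r hq hr =>
    rw [map_add, Polynomial.map_add, map_add, LinearMap.add_apply, LinearMap.add_apply, map_add, hq, hr]
  | monomial n t =>
    rw [Polynomial.map_monomial, Polynomial.aeval_monomial, Polynomial.aeval_monomial,
      Module.End.mul_apply, Module.End.mul_apply, Module.algebraMap_end_apply,
      Module.algebraMap_end_apply, map_smulₛₗ, frobInv, ← map_pow, toPoints_rhoA, map_pow,
      map_pow]
    rfl

/-- The lifts of an element of `G_{z'}` to `G_{z(x) z'}` correspond to the components at `x` that
can be added to a point. -/
lemma toPoints_sum_fiber {x : Primes z} {s t : Finset (Primes z)} (hst : s ⊆ t)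
    (ht : ∀ y, y ∈ t ↔ y = x ∨ y ∈ s) (hx : x ∉ s) (a : S.Gfin (stalk z s))
    {_ : DecidablePred fun b : S.Gfin (stalk z t) => S.proj z hst b = a} :
    S.toPoints σ z (∑ b : S.Gfin (stalk z t) with S.proj z hst b = a, Finsupp.single ⟨t, b⟩ 1) =
      ∑ b : S.Comp z x, Finsupp.single ((S.toPoint z ⟨s, a⟩).update x (b : WithZero _)) 1 := by
  have hxt : x ∈ t := (ht x).2 (Or.inl rfl)
  have hval : ∀ b : S.Gfin (stalk z t), S.proj z hst b = a →
      S.toPoint z ⟨t, b⟩ = (S.toPoint z ⟨s, a⟩).update x (S.comp z hxt b : S.Comp z x) :=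
    fun b hb => by
      refine DFinsupp.ext fun y => ?_
      by_cases hy : y = x
      · subst hy
        rw [update_apply_same, S.toPoint_apply ⟨t, b⟩ hxt]
      rw [update_apply_of_ne _ hy]
      by_cases hys : y ∈ s
      · rw [S.toPoint_apply ⟨s, a⟩ hys, S.toPoint_apply ⟨t, b⟩ (hst hys), ← hb, comp_proj]
      · rw [S.toPoint_apply_of_notMem ⟨s, a⟩ hys, S.toPoint_apply_of_notMem ⟨t, b⟩]
        exact fun h => ((ht y).1 h).elim hy hys
  rw [map_sum]
  refine Finset.sum_bij (fun b _ => S.comp z hxt b)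
    (fun _ _ => Finset.mem_univ _) (fun b hb b' hb' h => ?_) (fun c _ => ?_) (fun b hb => ?_)
  · have h1 := hval b (Finset.mem_filter.1 hb).2
    rw [h, ← hval b' (Finset.mem_filter.1 hb').2] at h1
    simpa using S.toPoint_injective h1
  · obtain ⟨b, hb⟩ := S.exists_toPoint_eq t ((S.toPoint z ⟨s, a⟩).update x (c : WithZero _))
      fun y => by
        by_cases hy : y = x
        · subst hy; simp [hxt]
        · rw [update_apply_of_ne _ hy, S.toPoint_apply_eq_zero]
          simp [ht, hy]
    refine ⟨b, Finset.mem_filter.2 ⟨Finset.mem_univ _, S.eq_of_comp_eq z fun y hy => ?_⟩, ?_⟩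
    · have hyx : y ≠ x := by rintro rfl; exact hx hy
      have := DFunLike.congr_fun hb y
      rw [update_apply_of_ne _ hyx, S.toPoint_apply ⟨s, a⟩ hy,
        S.toPoint_apply ⟨t, b⟩ (hst hy), WithZero.coe_inj] at this
      rw [comp_proj, this]
    · have := DFunLike.congr_fun hb x
      rwa [update_apply_same, S.toPoint_apply ⟨t, b⟩ hxt, WithZero.coe_inj] at this
  · rw [toPoints_single, map_one, hval b (Finset.mem_filter.1 hb).2]

lemma toPoints_normLift (x : Primes z) (s : Finset (Primes z)) (hx : x ∉ s)
    (a : S.Gfin (stalk z s)) :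
    S.toPoints σ z (S.normLift T z x s a) =
      ∑ b : S.Comp z x, Finsupp.single ((S.toPoint z ⟨s, a⟩).update x (b : WithZero _)) 1 := by
  unfold normLift
  rw [S.toPoints_sum_fiber σ z _ ?_ hx a]
  exact fun _ => by convert Finset.mem_insert

/-- The endomorphism `λ_{z(x)}` produces the distribution relations. -/
lemma toPoints_lam_single (x : Primes z) (a : S.Apts z) (t : T) (hx : x ∉ a.supp) :
    S.toPoints σ z (S.lam T p z x (Finsupp.single a t)) =
      σ t • (S.eulerData σ z p).relation x (S.toPoint z a) := by
  classical
  rw [lam, Finsupp.linearCombination_single, if_neg hx, map_smulₛₗ, map_sub, S.toPoints_aeval σ z p,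
    S.toPoints_normLift σ z x a.supp hx, toPoints_single, map_one]
  rfl

lemma lam_single_of_mem (x : Primes z) (a : S.Apts z) (t : T) (hx : x ∈ a.supp) :
    S.lam T p z x (Finsupp.single a t) = 0 := by
  classical
  rw [lam, Finsupp.linearCombination_single, if_pos hx, smul_zero]

lemma toPoints_mem_relations {v : S.Amod T z} (hv : v ∈ S.Dmod T p z) :
    S.toPoints σ z v ∈ (S.eulerData σ z p).relations Set.univ := by
  suffices S.Dmod T p z ≤ ((S.eulerData σ z p).relations Set.univ).comap (S.toPoints σ z) from this hv
  refine iSup_le fun x => ?_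
  rintro _ ⟨v, rfl⟩
  induction v using Finsupp.induction_linear with
  | zero => simp
  | add v w hv hw => rw [map_add]; exact add_mem hv hw
  | single a t =>
    by_cases hx : x ∈ a.supp
    · rw [lam_single_of_mem S z p x a t hx]; exact zero_mem _
    · rw [Submodule.mem_comap, S.toPoints_lam_single σ z p x a t hx]
      exact Submodule.smul_mem _ _
        (EulerData.relation_mem _ (Set.mem_univ x) ((S.toPoint_apply_eq_zero a).2 hx))

end Linear

end NormSystem

/-! ### Reduction modulo `M` -/

namespace DiscreteCohomology

universe u v w

variable {k : Type u} [CommRing k] [TopologicalSpace k] [DiscreteTopology k]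
  {G : Type v} [Group G] [TopologicalSpace G] [IsTopologicalGroup G]
  {H : Type v} [Group H] [TopologicalSpace H] [IsTopologicalGroup H]

/-- An isomorphism of groups and a compatible isomorphism of modules induce an isomorphism on
cohomology. -/
lemma cohMap_bijective (e : H ≃ₜ* G) {X : TopRep.{max v w} k G} {Y : TopRep.{max v w} k H}
    [IsSmooth X] [DiscreteTopology Y] (f : TopRep.res ((e : H →ₜ* G) : H →* G) X ⟶ Y)
    (hf : Function.Bijective f.hom) (n : ℕ) :
    Function.Bijective (cohMap (e : H →ₜ* G) f n) := by
  have : IsSmooth Y := IsSmooth.of_surjective f hf.2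
  let f₁ : X ≃ₗ[k] Y := LinearEquiv.ofBijective f.hom.toLinearMap hf
  have hf₁ : ∀ x, f.hom x = f₁ x := fun _ => rfl
  let g : TopRep.res ((e.symm : G →ₜ* H) : G →* H) Y ⟶ X :=
    homOf (X := TopRep.res ((e.symm : G →ₜ* H) : G →* H) Y) (Y := X) f₁.symm.toLinearMap
      fun a y => by
        obtain ⟨x, rfl⟩ := f₁.surjective y
        have h : f₁ (X.ρ (e (e.symm a)) x) = Y.ρ (e.symm a) (f₁ x) := hom_rho f (e.symm a) x
        rw [e.apply_symm_apply] at h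
        change f₁.symm (Y.ρ (e.symm a) (f₁ x)) = X.ρ a (f₁.symm (f₁ x))
        rw [← h, LinearEquiv.symm_apply_apply, LinearEquiv.symm_apply_apply]
  refine Function.bijective_iff_has_inverse.2 ⟨cohMap (e.symm : G →ₜ* H) g n, fun x => ?_, fun y => ?_⟩
  · refine (cohMap_cohMap _ _ (.id G) ?_ f g (𝟙 X) (fun x => ?_) n x).trans (cohMap_id X n x)
    · ext a; exact (e.apply_symm_apply a).symm
    · exact (f₁.symm_apply_apply x).symm
  · refine (cohMap_cohMap _ _ (.id H) ?_ g f (𝟙 Y) (fun y => ?_) n y).trans (cohMap_id Y n y)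
    · ext a; exact (e.symm_apply_apply a).symm
    · exact (f₁.apply_symm_apply y).symm

end DiscreteCohomology

namespace NormSystem

universe uX uG uT

variable {O : Type*} [CommRing O] (T : Type uT) [CommRing T] [Algebra O T] (M : O)

/-- The reduction map `T → T / M T`. -/
noncomputable def redMap : T →+* Tred T M := Ideal.Quotient.mk (Ideal.span {algebraMap O T M})

lemma redMap_surjective : Function.Surjective (redMap T M) := Ideal.Quotient.mk_surjective

lemma redMap_eq_zero_iff {t : T} : redMap T M t = 0 ↔ algebraMap O T M ∣ t :=
  Ideal.Quotient.eq_zero_iff_mem.trans Ideal.mem_span_singleton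

variable {X : Type uX} [LinearOrder X] {G : Type uG} [Group G] [TopologicalSpace G]
  (S : NormSystem X G) [IsTopologicalGroup G] [CompactSpace G] (p : X → Polynomial T) (z : X → ℕ)

/-- The class in `𝒰_z / M 𝒰_z` of an element of `𝒜_z`. -/
noncomputable def redClass : S.Amod T z →ₛₗ[redMap T M] S.Ured T M p z where
  toFun v := Submodule.Quotient.mk ((S.Dmod T p z).mkQ v)
  map_add' _ _ := rfl
  map_smul' _ _ := rfl

lemma redClass_surjective : Function.Surjective (S.redClass T M p z) := fun u => by
  obtain ⟨u, rfl⟩ := Submodule.Quotient.mk_surjective _ u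
  obtain ⟨v, rfl⟩ := Submodule.Quotient.mk_surjective _ u
  exact ⟨v, rfl⟩

lemma redClass_eq_zero {v : S.Amod T z} (hv : v ∈ S.Dmod T p z) : S.redClass T M p z v = 0 := by
  have h : (S.Dmod T p z).mkQ v = 0 := (Submodule.Quotient.mk_eq_zero _).2 hv
  exact (congrArg _ h).trans (Submodule.Quotient.mk_zero _)

lemma actUred_redClass (g : S.Glim z) (v : S.Amod T z) :
    S.actUred T M p z g (S.redClass T M p z v) = S.redClass T M p z (S.rhoA T z g v) := rfl

/-- The Euler factors with coefficients in `T / M T`. -/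
noncomputable abbrev redData : EulerData (S.Comp z) (Tred T M) := S.eulerData (redMap T M) z p

/-- The element of `𝒰_z / M 𝒰_z` given by a combination of points. Points correspond bijectively to
the symbols `[g z']`, so the choice of a preimage is immaterial. -/
noncomputable def ofPoints : (Point (S.Comp z) →₀ Tred T M) →ₗ[Tred T M] S.Ured T M p z :=
  Finsupp.linearCombination _ fun d =>
    S.redClass T M p z (Finsupp.single (Function.surjInv S.toPoint_surjective d) 1)

lemma ofPoints_single (a : S.Apts z) : S.ofPoints T M p z (Finsupp.single (S.toPoint z a) 1) =
    S.redClass T M p z (Finsupp.single a 1) := by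
  rw [ofPoints, Finsupp.linearCombination_single, one_smul,
    Function.leftInverse_surjInv ⟨S.toPoint_injective, S.toPoint_surjective⟩]

lemma ofPoints_toPoints (v : S.Amod T z) :
    S.ofPoints T M p z (S.toPoints (redMap T M) z v) = S.redClass T M p z v := by
  induction v using Finsupp.induction_linear with
  | zero => simp
  | add v w hv hw => simp only [map_add, hv, hw]
  | single a t =>
    rw [← mul_one t, ← smul_eq_mul, ← Finsupp.smul_single, map_smulₛₗ, map_smulₛₗ, map_smulₛₗ,
      toPoints_single, map_one, ofPoints_single, RingHom.id_apply]

lemma relations_le_ker_ofPoints :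
    (S.redData T M p z).relations Set.univ ≤ LinearMap.ker (S.ofPoints T M p z) := by
  refine Submodule.span_le.2 ?_
  rintro _ ⟨x, -, d, hd, rfl⟩
  obtain ⟨a, rfl⟩ := S.toPoint_surjective d
  have h := S.toPoints_lam_single (redMap T M) z p x a 1 ((S.toPoint_apply_eq_zero a).1 hd)
  rw [map_one, one_smul] at h
  rw [SetLike.mem_coe, LinearMap.mem_ker, ← h, ofPoints_toPoints]
  exact S.redClass_eq_zero T M p z (Submodule.mem_iSup_of_mem x ⟨_, rfl⟩)

/-- The map from the model of the universal norm distribution with coefficients in `T / M T` to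
`𝒰_z / M 𝒰_z`. -/
noncomputable def ofQuot : (S.redData T M p z).Quot Set.univ →ₗ[Tred T M] S.Ured T M p z :=
  Submodule.liftQ _ (S.ofPoints T M p z) (S.relations_le_ker_ofPoints T M p z)

lemma ofQuot_mkQ (m : Point (S.Comp z) →₀ Tred T M) :
    S.ofQuot T M p z (((S.redData T M p z).relations Set.univ).mkQ m) = S.ofPoints T M p z m := rfl

lemma exists_toPoints_eq (m : Point (S.Comp z) →₀ Tred T M) :
    ∃ v, S.toPoints (redMap T M) z v = m := by
  induction m using Finsupp.induction_linear with
  | zero => exact ⟨0, map_zero _⟩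
  | add m n hm hn =>
    obtain ⟨v, rfl⟩ := hm
    obtain ⟨w, rfl⟩ := hn
    exact ⟨v + w, map_add _ v w⟩
  | single d r =>
    obtain ⟨a, rfl⟩ := S.toPoint_surjective d
    obtain ⟨t, rfl⟩ := redMap_surjective T M r
    exact ⟨Finsupp.single a t, S.toPoints_single _ z a t⟩

lemma ofQuot_bijective : Function.Bijective (S.ofQuot T M p z) := by
  constructor
  · -- the change of coefficients is inverse to `ofQuot`
    let f : S.Umod T p z →ₛₗ[redMap T M] (S.redData T M p z).Quot Set.univ :=
      (S.Dmod T p z).liftQ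
        ((((S.redData T M p z).relations Set.univ).mkQ).comp (S.toPoints (redMap T M) z))
        fun v hv => (Submodule.Quotient.mk_eq_zero _).2 (S.toPoints_mem_relations _ z p hv)
    have hf : Ideal.span {algebraMap O T M} • (⊤ : Submodule T (S.Umod T p z)) ≤ LinearMap.ker f := by
      refine Submodule.smul_le.2 fun t ht u _ => ?_
      rw [LinearMap.mem_ker, map_smulₛₗ,
        (redMap_eq_zero_iff T M).2 (Ideal.mem_span_singleton.1 ht), zero_smul]
    let f' := Submodule.liftQ _ f hf
    refine Function.LeftInverse.injective (g := f') fun m => ?_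
    obtain ⟨m, rfl⟩ := Submodule.mkQ_surjective _ m
    obtain ⟨v, rfl⟩ := S.exists_toPoints_eq T M z m
    rw [ofQuot_mkQ, ofPoints_toPoints]
    rfl
  · intro u
    obtain ⟨v, rfl⟩ := S.redClass_surjective T M p z u
    exact ⟨((S.redData T M p z).relations Set.univ).mkQ (S.toPoints (redMap T M) z v),
      S.ofPoints_toPoints T M p z v⟩

lemma ofQuot_quotRep (g : S.Glim z) (m : (S.redData T M p z).Quot Set.univ) :
    S.ofQuot T M p z ((S.redData T M p z).quotRep Set.univ (S.comps z g) m) =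
      S.actUred T M p z g (S.ofQuot T M p z m) := by
  obtain ⟨m, rfl⟩ := Submodule.mkQ_surjective _ m
  obtain ⟨v, rfl⟩ := S.exists_toPoints_eq T M z m
  rw [EulerData.quotRep_mkQ, ← toPoints_rhoA, ofQuot_mkQ, ofQuot_mkQ, ofPoints_toPoints,
    ofPoints_toPoints, actUred_redClass]

lemma extend_glimEquiv (g : S.Glim z) :
    EulerData.extend Set.univ (S.glimEquiv z g) = S.comps z g :=
  funext fun x => EulerData.extend_apply _ (Set.mem_univ x)

lemma spanOf_univ : (S.redData T M p z).spanOf Set.univ (EulerData.within Set.univ) = ⊤ := by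
  rw [← EulerData.span_range_cls, EulerData.spanOf, ← Set.image_univ]
  congr 2
  exact Set.eq_univ_of_forall fun d x _ => Set.mem_univ x

/-- The isomorphism between the model of the universal norm distribution and `𝒰_z / M 𝒰_z`. -/
noncomputable def distHom :
    TopRep.res ((S.glimEquiv z : S.Glim z →ₜ* ∀ x : (Set.univ : Set (Primes z)), S.Comp z x) :
      S.Glim z →* ∀ x : (Set.univ : Set (Primes z)), S.Comp z x)
      ((S.redData T M p z).distRep Set.univ) ⟶ S.repUred T M p z :=
  homOf (X := TopRep.res _ ((S.redData T M p z).distRep Set.univ)) (Y := S.repUred T M p z)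
    ((S.ofQuot T M p z).comp
      ((S.redData T M p z).spanOf Set.univ (EulerData.within Set.univ)).subtype)
    fun g m => by
      refine Eq.trans ?_ (S.ofQuot_quotRep T M p z g _)
      rw [← extend_glimEquiv]
      rfl

lemma distHom_bijective : Function.Bijective (S.distHom T M p z).hom := by
  refine (S.ofQuot_bijective T M p z).comp (?_ : Function.Bijective (Subtype.val))
  refine ⟨Subtype.val_injective, fun m => ⟨⟨m, ?_⟩, rfl⟩⟩
  rw [spanOf_univ]
  trivial

end NormSystem

/-! ### Cohomology of the universal norm distribution -/

namespace NormSystem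

section Index

variable {X : Type*} (z : X → ℕ)

/-- A pair `(y, w)` of elements over the primes dividing `z`, as an element of the index set
`CanonicalIndex z`, whose pairs are over all of `X` with support in the primes dividing `z`. -/
noncomputable def toCanonical (i : Σ n, GradedIndex (Set.univ : Set (Primes z)) n) :
    CanonicalIndex z where
  y := i.2.y.map (Function.Embedding.subtype _)
  w := i.2.w.embDomain (Function.Embedding.subtype _)
  y_dvd := by
    rw [Finsupp.support_embDomain]
    exact Finset.map_subset_map.2 i.2.y_subset
  w_dvd x hx := by
    rw [Finsupp.support_embDomain] at hx
    obtain ⟨x, -, rfl⟩ := Finset.mem_map.1 hx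
    exact x.2

lemma degree_toCanonical (i : Σ n, GradedIndex (Set.univ : Set (Primes z)) n) :
    i.1 + (toCanonical z i).y.card = (toCanonical z i).w.degree := by
  have h : (toCanonical z i).w.degree = i.2.w.degree := by
    change (i.2.w.embDomain _).degree = _
    rw [Finsupp.embDomain_eq_mapDomain, Finsupp.degree_mapDomain]
  rw [h, ← i.2.degree]
  exact congrArg (i.1 + ·) (Finset.card_map _)

lemma toCanonical_bijective : Function.Bijective (toCanonical z) := by
  constructor
  · rintro ⟨n, i⟩ ⟨m, j⟩ h
    exact GradedIndex.sigma_ext (Finset.map_injective _ (congrArg CanonicalIndex.y h))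
      (Finsupp.embDomain_injective _ (congrArg CanonicalIndex.w h))
  · rintro ⟨y, w, hy, hw⟩
    obtain ⟨w, rfl⟩ : ∃ w' : Primes z →₀ ℕ, w'.embDomain (Function.Embedding.subtype _) = w :=
      ⟨w.comapDomain _ (Function.Embedding.subtype _).injective.injOn,
        Finsupp.embDomain_comapDomain fun x hx => ⟨⟨x, hw x hx⟩, rfl⟩⟩
    rw [Finsupp.support_embDomain] at hy
    obtain ⟨y, hy', rfl⟩ := Finset.subset_map_iff.1 hy
    have hle : y.card ≤ w.degree := by
      refine (Finset.card_le_card hy').trans ?_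
      rw [Finsupp.degree_apply, Finset.card_eq_sum_ones]
      exact Finset.sum_le_sum fun x hx => Nat.one_le_iff_ne_zero.2 (Finsupp.mem_support_iff.1 hx)
    exact ⟨⟨w.degree - y.card, y, w, hy', fun _ _ => trivial, Nat.sub_add_cancel hle⟩, rfl⟩

end Index

universe uX uG uT

variable {O : Type*} [CommRing O] (T : Type uT) [CommRing T] [Algebra O T] (M : O)
  {X : Type uX} [LinearOrder X] {G : Type uG} [Group G] [TopologicalSpace G]
  (S : NormSystem X G) [IsTopologicalGroup G] [CompactSpace G] (p : X → Polynomial T) (z : X → ℕ)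

instance : DiscreteTopology (S.repUred T M p z) :=
  inferInstanceAs (DiscreteTopology (S.Ured T M p z))

/-- The cohomology of `𝒰_z / M 𝒰_z` is that of its model. -/
noncomputable def cohUredEquiv (n : ℕ) :
    coh.{uT, max uX uG, uT} ((S.redData T M p z).distRep Set.univ) n ≃ₗ[Tred T M]
      S.cohUred T M p z n :=
  (LinearEquiv.ofBijective _ (cohMap_bijective.{uT, max uX uG, uT} (S.glimEquiv z)
    (S.distHom T M p z) (S.distHom_bijective T M p z) n)).trans
    (continuousCohomologyEquiv.{uT, max uX uG, uT} (S.repUred T M p z) n).symm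

/-- The hypotheses on `|G_{z(x)}|` and `p(x; 1)` say that both vanish in `T / M T`, as
`exists_basis_univ` requires. -/
lemma exists_basis_cohUred
    (hcyc : ∀ x, z x ≠ 0 → IsCyclic (S.Gfin (primePart z x)))
    (hMG : ∀ x, z x ≠ 0 → M ∣ (Nat.card (S.Gfin (primePart z x)) : O))
    (hMp : ∀ x, z x ≠ 0 → algebraMap O T M ∣ (p x).eval 1) (n : ℕ) :
    Nonempty (Module.Basis (GradedIndex (Set.univ : Set (Primes z)) n) (Tred T M)
      (S.cohUred T M p z n)) := by
  have h1 : ∀ x : Primes z, IsCyclic (S.Comp z x) := fun x => by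
    have := hcyc x.1 x.2
    rwa [← stalk_singleton] at this
  have h2 : ∀ x : Primes z, (Fintype.card (S.Comp z x) : Tred T M) = 0 := fun x => by
    have h := hMG x.1 x.2
    rw [← stalk_singleton, Nat.card_eq_fintype_card] at h
    have h' := (redMap_eq_zero_iff T M).2 (map_dvd (algebraMap O T) h)
    rwa [map_natCast, map_natCast] at h'
  have h3 : ∀ x : Primes z, ((S.redData T M p z).poly x).eval 1 = 0 := fun x => by
    have h := (redMap_eq_zero_iff T M).2 (hMp x.1 x.2)
    change ((p x.1).map (redMap T M)).eval 1 = 0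
    rw [← h, Polynomial.eval_one_map]
  obtain ⟨b⟩ := (S.redData T M p z).exists_basis_univ h1 h2 h3 n
  exact ⟨b.map (S.cohUredEquiv T M p z n)⟩

end NormSystem

/-- Bases of the summands form a homogeneous basis of a direct sum. -/
lemma DirectSum.exists_basis_sigma {R : Type*} [CommRing R] {N : ℕ → Type*}
    [∀ n, AddCommGroup (N n)] [∀ n, Module R (N n)] {K : ℕ → Type*}
    (b : ∀ n, Module.Basis (K n) R (N n)) :
    ∃ B : Module.Basis (Σ n, K n) R (DirectSum ℕ N),
      ∀ i, B i ∈ LinearMap.range (DirectSum.lof R ℕ N i.1) := by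
  refine ⟨DFinsupp.basis b, fun i => ⟨b i.1 i.2, ?_⟩⟩
  refine (DFinsupp.basis b).repr.injective ?_
  rw [Module.Basis.repr_self]
  change (sigmaFinsuppLequivDFinsupp R).symm
    ((DFinsupp.single i.1 (b i.1 i.2)).mapRange (fun n => (b n).repr) fun n => map_zero _) = _
  rw [LinearEquiv.symm_apply_eq, DFinsupp.mapRange_single, Module.Basis.repr_self]
  exact (sigmaFinsuppEquivDFinsupp_single i 1).symm

open scoped DirectSum in
theorem mainTheorem3
    {X G O T : Type*} [LinearOrder X]
    [Group G] [TopologicalSpace G] [IsTopologicalGroup G]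
    [CompactSpace G] [T2Space G] [TotallyDisconnectedSpace G]
    [CommRing O] [IsDomain O]
    [CommRing T] [Algebra O T] [Module.Finite O T] [Module.IsTorsionFree O T]
    (S : NormSystem X G) (p : X → Polynomial T) (z : X → ℕ)
    (hcyc : ∀ x, z x ≠ 0 → IsCyclic (S.Gfin (NormSystem.primePart z x)))
    (M : O)
    (hMG : ∀ x, z x ≠ 0 → M ∣ (Nat.card (S.Gfin (NormSystem.primePart z x)) : O))
    (hMp : ∀ x, z x ≠ 0 → algebraMap O T M ∣ (p x).eval 1) :
    ∃ c : Module.Basis (NormSystem.CanonicalIndex z) (NormSystem.Tred T M)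
        (⨁ n : ℕ, S.cohUred T M p z n),
      ∀ (i : NormSystem.CanonicalIndex z) (n : ℕ), n + i.y.card = i.w.degree →
        c i ∈ LinearMap.range (DirectSum.lof (NormSystem.Tred T M) ℕ
          (fun n => S.cohUred T M p z n) n) := by
  have b := fun n => (S.exists_basis_cohUred T M p z hcyc hMG hMp n).some
  obtain ⟨B, hB⟩ := DirectSum.exists_basis_sigma b
  let e := Equiv.ofBijective _ (NormSystem.toCanonical_bijective z)
  refine ⟨B.reindex e, fun i n hn => ?_⟩
  obtain ⟨i, rfl⟩ := e.surjective i
  have h := NormSystem.degree_toCanonical z i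
  obtain rfl : n = i.1 := Nat.add_right_cancel (hn.trans h.symm)
  rw [Module.Basis.reindex_apply, Equiv.symm_apply_apply]
  exact hB i
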